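/- A parameterized problem is a language $L\subseteq\Sigma^*\times\mathbb{N}$ over a finite alphabet $\Sigma$. A polynomial parameter transformation (PPT) from $P\subseteq\Sigma^*\times\mathbb{N}$ to $Q\subseteq\Gamma^*\times\mathbb{N}$ is a mapping $\pi\colon\Sigma^*\times\mathbb{N}\to\Gamma^*\times\mathbb{N}$, computable in time polynomial in $|x|+k$ on input $(x,k)$, such that, with $(x',k')=\pi(x,k)$, we have $(x,k)\in P$ if and only if $(x',k')\in Q$, and $k'\le q(k)$ for a fixed polynomial $q$. Consider the following parameterized problems. - Hitting Set$[n]$: given a finite ground set $U$, a family $\mathcal{F}$ of subsets of $U$ and $k\in\mathbb{N}$, is there $S\subseteq U$ with $|S|\le k$ that meets every $F\in\mathcal{F}$? The parameter is $n=|U|$. - Set Splitting$[n]$: given a finite ground set $U$ and a family $\mathcal{F}$ of subsets of $U$, is there $S\subseteq U$ with $F\nsubseteq S$ and $F\nsubseteq U\setminus S$ for all $F\in\mathcal{F}$? The parameter is $n=|U|$. - Stable Cutset[mod lin forest]: given a finite simple graph $G=(V,E)$ and $X\subseteq V$ such that $G-X$ is a linear forest (a disjoint union of paths), does $G$ have a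 stable cutset, i.e. a set $S\subseteq V$ of pairwise non-adjacent vertices such that $G-S$ is disconnected? The parameter is $|X|$. The class $\mathsf{MK[2]}$ consists of all parameterized problems that have a PPT to Hitting Set$[n]$. A parameterized problem $Q$ is $\mathsf{MK[2]}$-hard under PPTs if every problem in $\mathsf{MK[2]}$ has a PPT to $Q$. **Theorem.** Stable Cutset[mod lin forest] is $\mathsf{MK[2]}$-hard under PPTs. Moreover, there is a PPT from Set Splitting$[n]$ to Stable Cutset[mod lin forest] that maps every input with parameter $n$ to an output with parameter exactly $2n+5$. -/

import Mathlib

/-! ### Parameterized problems and polynomial parameter transformations -/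

/-- A parameterized problem over the alphabet `α`: a language `L ⊆ α* × ℕ`. -/
abbrev ParamProblem (α : Type) : Type := Set (List α × ℕ)

/-- The tape contents that present `(x, k)` to a machine: the string `x`, followed by `k` copies of
an additional symbol `none`. The length is `|x| + k`, so that polynomial time in the length of the
input is polynomial time in `|x| + k`. -/
def encodeParamInstance {α : Type} (p : List α × ℕ) : List (Option α) :=
  p.1.map some ++ List.replicate p.2 none

/-- `f` is computed by a (multi-stack) Turing machine in time polynomial in `|x| + k`. -/
def IsPolyTime {α β : Type} (f : List α × ℕ → List β × ℕ) : Prop :=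
  Nonempty (Turing.TM2ComputableInPolyTime
    (encodeParamInstance (α := α)) (encodeParamInstance (α := β)) f)

/-- `f` is a polynomial parameter transformation from `P` to `Q`. -/
structure IsPPT {α β : Type} (P : ParamProblem α) (Q : ParamProblem β)
    (f : List α × ℕ → List β × ℕ) : Prop where
  polyTime : IsPolyTime f
  correct : ∀ p, p ∈ P ↔ f p ∈ Q
  param_le : ∃ q : Polynomial ℕ, ∀ x k, (f (x, k)).2 ≤ q.eval k

/-- There is a polynomial parameter transformation from `P` to `Q`. -/
def PPTReducible {α β : Type} (P : ParamProblem α) (Q : ParamProblem β) : Prop :=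
  ∃ f, IsPPT P Q f

/-! ### Encoding of finite objects as strings -/

/-- The alphabet of the concrete problems: `some b` is a bit and `none` is a separator. -/
abbrev Symb : Type := Option Bool

/-- A natural number in unary, terminated by a separator. -/
def unaryCode (n : ℕ) : List Symb := List.replicate n (some true) ++ [none]

/-- A subset of `{0, …, n - 1}` as its characteristic bit string of length `n`, terminated by a
separator. -/
def subsetCode {n : ℕ} (A : Finset (Fin n)) : List Symb :=
  List.ofFn (fun i => some (decide (i ∈ A))) ++ [none]

/-- A pair of elements of `{0, …, n - 1}`, written as two numbers. -/
def pairCode {n : ℕ} (e : Fin n × Fin n) : List Symb := unaryCode e.1 ++ unaryCode e.2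

/-! ### Hitting Set, Set Splitting, and the class MK[2]

The ground set is `{0, …, n - 1}` and a family of subsets is given as a list. -/

/-- `S` is a hitting set for the family `F`. -/
def IsHittingSet {n : ℕ} (F : List (Finset (Fin n))) (S : Finset (Fin n)) : Prop :=
  ∀ A ∈ F, (A ∩ S).Nonempty

/-- Hitting Set, parameterized by the size `n` of the ground set: is there a hitting set of size at
most `k`? (The bound `k` is written in unary; as values `k ≥ n` are equivalent to `k = n`, this is
polynomially equivalent to writing it in binary.) -/
def HittingSetN : ParamProblem Symb :=
  {p | ∃ (n k : ℕ) (F : List (Finset (Fin n))),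
    p = (unaryCode n ++ unaryCode k ++ F.flatMap subsetCode, n) ∧
    ∃ S : Finset (Fin n), S.card ≤ k ∧ IsHittingSet F S}

/-- `S` splits every set of the family `F`. -/
def IsSplittingSet {n : ℕ} (F : List (Finset (Fin n))) (S : Finset (Fin n)) : Prop :=
  ∀ A ∈ F, ¬ A ⊆ S ∧ ¬ A ⊆ Sᶜ

/-- Set Splitting, parameterized by the size `n` of the ground set. -/
def SetSplittingN : ParamProblem Symb :=
  {p | ∃ (n : ℕ) (F : List (Finset (Fin n))),
    p = (unaryCode n ++ F.flatMap subsetCode, n) ∧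
    ∃ S : Finset (Fin n), IsSplittingSet F S}

/-- Membership in MK[2]: the parameterized problem has a polynomial parameter transformation to
Hitting Set parameterized by the size of the ground set. -/
def InMK2 {α : Type} (P : ParamProblem α) : Prop := PPTReducible P HittingSetN

/-- Hardness for MK[2] under polynomial parameter transformations: every parameterized problem in
MK[2], over any finite alphabet, has such a transformation to `Q`. -/
def IsMK2Hard {β : Type} (Q : ParamProblem β) : Prop :=
  ∀ (α : Type) [Fintype α] (P : ParamProblem α), InMK2 P → PPTReducible P Q

/-! ### Stable Cutset -/

/-- A linear forest: a disjoint union of paths, that is, a forest of maximum degree at most two. -/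
def IsLinearForest {V : Type} (G : SimpleGraph V) : Prop :=
  G.IsAcyclic ∧ ∀ v, (G.neighborSet v).encard ≤ 2

/-- `S` is a stable set and `G - S` is disconnected. (The graph without vertices is not
disconnected.) -/
def IsStableCutset {V : Type} (G : SimpleGraph V) (S : Set V) : Prop :=
  G.IsIndepSet S ∧ ¬ (G.induce Sᶜ).Preconnected

/-- The list `E` lists the edges of `G`, each in at least one of its two orientations. -/
def IsEdgeList {n : ℕ} (G : SimpleGraph (Fin n)) (E : List (Fin n × Fin n)) : Prop :=
  ∀ u v, G.Adj u v ↔ (u, v) ∈ E ∨ (v, u) ∈ E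

/-- Stable Cutset, parameterized by the size of a given set `X` such that `G - X` is a linear
forest. An instance is given by the characteristic string of `X` and a list of the edges of `G`. -/
def StableCutsetModLinForest : ParamProblem Symb :=
  {p | ∃ (n : ℕ) (G : SimpleGraph (Fin n)) (E : List (Fin n × Fin n)) (X : Finset (Fin n)),
    IsEdgeList G E ∧ p = (subsetCode X ++ E.flatMap pairCode, X.card) ∧
    IsLinearForest (G.induce (X : Set (Fin n))ᶜ) ∧ ∃ S : Set (Fin n), IsStableCutset G S}

/-! PPTs compose (`PPTReducible.trans`), so it suffices to transform Hitting Set[n] into Set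
Splitting[n], and Set Splitting[n] into Stable Cutset with parameter exactly 2n+5.

From Hitting Set to Set Splitting: the new ground set consists of n·n pairs (i, j), read as "element
i occupies slot j", and two reference elements, which a set containing just these two forces apart.
Call a pair chosen if it lies on the same side as the second reference element. For each set A of
the family, the pairs (i, j) with i in A together with the first reference element force a chosen
pair with i in A. Sets {(i, j), (i', j), second reference} forbid two elements in one slot and, with
i = i', forbid the slots j ≥ k. The elements with a chosen pair thus inject into k slots
(`exists_hitting_of_split`, `exists_split_of_hitting`).

From Set Splitting to Stable Cutset: take a vertex 4 and two edges 0-1 and 2-3 (the cliques), each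
forming a triangle with 4. Every vertex outside a stable set avoiding 4 is linked to 4 outside the
set, so every stable cutset contains 4 (`Good.special`); then it contains no neighbour of 4, and it
must separate the two cliques (`Good.not_iff`). Each element has two adjacent vertices, one attached
to each clique, so exactly one of them is cut: this choice is a set T of elements. For each set of
the family there are two paths between the cliques, in opposite directions, with two vertices v, w
per element position. All w, and the v at elements outside the set, are adjacent to 4 and cannot be
cut. At a member, v and w are joined to the member's vertex of that path, so v can be cut only if
this vertex is not. One path thus yields a member outside T, the other a member in T
(`Good.exists_not_mem`, `Good.splits`). Conversely, for a splitting set every path can be cut at its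
first possible position (`good_cut`). Without 4, the cliques and the 2n element vertices, only the
paths and isolated vertices remain, hence a linear forest.

Polynomial time is proved for actual stack machines. Machines compose (`IsPolyTime.comp`), because
an output is at most polynomially longer than the input. The two transformations, including the
syntax check of the input, are values of expressions in a small language of nested loops over input
positions; every such expression compiles to a polynomial-time machine (`LoopExpr.isPolyTime`). -/

/-! ### Runs of a transition function -/

/-- `Runs f n a b`: iterating the partial transition function `f` for `n` steps leads from `a`
to `b`. -/
inductive Runs {σ : Type} (f : σ → Option σ) : ℕ → σ → σ → Prop
  | refl (a : σ) : Runs f 0 a a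
  | head {a b c : σ} {n : ℕ} : f a = some b → Runs f n b c → Runs f (n + 1) a c

namespace Runs

variable {σ : Type} {f : σ → Option σ}

theorem single {a b : σ} (h : f a = some b) : Runs f 1 a b := .head h (.refl b)

theorem trans {a b c : σ} {m n : ℕ} (h₁ : Runs f m a b) (h₂ : Runs f n b c) :
    Runs f (m + n) a c := by
  induction h₁ with
  | refl a => simpa using h₂
  | head h _ ih => rw [Nat.add_right_comm]; exact .head h (ih h₂)

theorem iterate_none (n : ℕ) : (flip bind f)^[n] none = none := by
  induction n with
  | zero => rfl
  | succ n ih => rw [Function.iterate_succ_apply]; exact ih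

/-- The link to `TM2ComputableInPolyTime`, whose evaluations are iterates of `flip bind f`. -/
theorem iff_iterate {n : ℕ} {a b : σ} : Runs f n a b ↔ (flip bind f)^[n] (some a) = some b := by
  constructor
  · intro h
    induction h with
    | refl a => rfl
    | head h _ ih =>
      rw [Function.iterate_succ_apply]
      have : flip bind f (some _) = _ := h
      rw [this, ih]
  · induction n generalizing a with
    | zero => intro h; cases h; exact .refl _
    | succ n ih =>
      intro h
      rw [Function.iterate_succ_apply] at h
      cases hf : f a with
      | none =>
        have : flip bind f (some a) = none := hf
        rw [this, iterate_none] at h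
        cases h
      | some c =>
        have : flip bind f (some a) = some c := hf
        rw [this] at h
        exact .head hf (ih h)

end Runs

/-! ### Embedding a stack machine into a larger one -/

namespace Turing.TM2

open Function

variable {K K₁ : Type} [DecidableEq K] [DecidableEq K₁] {Γ : K → Type} {Λ Λ₁ σ σ₁ : Type}

/-- Embed a statement into a machine with more stacks (along `κ`), labels (along `lab`) and
variables (read by `get`, written by `set`); `halt` is replaced by the statement `ex`. -/
def Stmt.lift (κ : K₁ → K) (lab : Λ₁ → Λ) (ex : Stmt Γ Λ σ) (get : σ → σ₁) (set : σ₁ → σ → σ) :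
    Stmt (fun k => Γ (κ k)) Λ₁ σ₁ → Stmt Γ Λ σ
  | .push k f q => .push (κ k) (fun v => f (get v)) (Stmt.lift κ lab ex get set q)
  | .peek k f q => .peek (κ k) (fun v o => set (f (get v) o) v) (Stmt.lift κ lab ex get set q)
  | .pop k f q => .pop (κ k) (fun v o => set (f (get v) o) v) (Stmt.lift κ lab ex get set q)
  | .load f q => .load (fun v => set (f (get v)) v) (Stmt.lift κ lab ex get set q)
  | .branch f q₁ q₂ =>
    .branch (fun v => f (get v)) (Stmt.lift κ lab ex get set q₁) (Stmt.lift κ lab ex get set q₂)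
  | .goto l => .goto (fun v => lab (l (get v)))
  | .halt => ex

/-- Induction on the statement. The clause `set x v' = set x v` records that `v'` differs from `v`
only in the component of the embedded machine; the remaining variables and the stacks outside the
range of `κ` survive untouched. -/
theorem stepAux_lift {κ : K₁ → K} (hκ : Injective κ) {lab : Λ₁ → Λ} {ex : Stmt Γ Λ σ}
    {get : σ → σ₁} {set : σ₁ → σ → σ} (get_set : ∀ a v, get (set a v) = a)
    (set_set : ∀ a b v, set a (set b v) = set a v) (q : Stmt (fun k => Γ (κ k)) Λ₁ σ₁)
    (v : σ) (S : ∀ k, List (Γ k)) :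
    ∃ v' S', get v' = (stepAux q (get v) fun k => S (κ k)).var ∧ (∀ x, set x v' = set x v) ∧
      (∀ k, S' (κ k) = (stepAux q (get v) fun k => S (κ k)).stk k) ∧
      (∀ k, (∀ k₁, k ≠ κ k₁) → S' k = S k) ∧
      stepAux (Stmt.lift κ lab ex get set q) v S =
        match (stepAux q (get v) fun k => S (κ k)).l with
        | some l => ⟨some (lab l), v', S'⟩
        | none => stepAux ex v' S' := by
  have upd : ∀ (S : ∀ k, List (Γ k)) (k : K₁) (x : List (Γ (κ k))),
      (fun j => update S (κ k) x (κ j)) = update (fun j => S (κ j)) k x :=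
    fun S k x => update_comp_eq_of_injective' S hκ k x
  induction q generalizing v S with
  | push k f q ih =>
    obtain ⟨v', S', h1, h2, h3, h4, h5⟩ := ih v (update S (κ k) (f (get v) :: S (κ k)))
    rw [upd] at h1 h3 h5
    refine ⟨v', S', h1, h2, h3, fun j hj => ?_, h5⟩
    rw [h4 j hj, update_of_ne (hj k)]
  | peek k f q ih =>
    obtain ⟨v', S', h1, h2, h3, h4, h5⟩ := ih (set (f (get v) (S (κ k)).head?) v) S
    rw [get_set] at h1 h3 h5
    exact ⟨v', S', h1, fun x => by rw [h2, set_set], h3, h4, h5⟩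
  | pop k f q ih =>
    obtain ⟨v', S', h1, h2, h3, h4, h5⟩ :=
      ih (set (f (get v) (S (κ k)).head?) v) (update S (κ k) (S (κ k)).tail)
    rw [get_set, upd] at h1 h3 h5
    refine ⟨v', S', h1, fun x => by rw [h2, set_set], h3, fun j hj => ?_, h5⟩
    rw [h4 j hj, update_of_ne (hj k)]
  | load f q ih =>
    obtain ⟨v', S', h1, h2, h3, h4, h5⟩ := ih (set (f (get v)) v) S
    rw [get_set] at h1 h3 h5
    exact ⟨v', S', h1, fun x => by rw [h2, set_set], h3, h4, h5⟩
  | branch f q₁ q₂ ih₁ ih₂ =>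
    simp only [stepAux, Stmt.lift]
    cases f (get v)
    · exact ih₂ v S
    · exact ih₁ v S
  | goto l => exact ⟨v, S, rfl, fun _ => rfl, fun _ => rfl, fun _ _ => rfl, rfl⟩
  | halt => exact ⟨v, S, rfl, fun _ => rfl, fun _ => rfl, fun _ _ => rfl, rfl⟩

/-- A halting run of a machine is simulated, in the same number of steps, by a machine into which
it is embedded, provided that the replacement `ex` of `halt` ends in a single step. -/
theorem runs_lift {κ : K₁ → K} (hκ : Injective κ) {lab : Λ₁ → Λ} {ex : Stmt Γ Λ σ}
    {get : σ → σ₁} {set : σ₁ → σ → σ} (get_set : ∀ a v, get (set a v) = a)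
    (set_set : ∀ a b v, set a (set b v) = set a v)
    {M₁ : Λ₁ → Stmt (fun k => Γ (κ k)) Λ₁ σ₁} {M : Λ → Stmt Γ Λ σ}
    (hM : ∀ l, M (lab l) = Stmt.lift κ lab ex get set (M₁ l)) {n : ℕ}
    {c c' : Cfg (fun k => Γ (κ k)) Λ₁ σ₁} (h : Runs (step M₁) n c c') (hc' : c'.l = none)
    {l : Λ₁} (hl : c.l = some l) {v : σ} (hv : get v = c.var)
    {S : ∀ k, List (Γ k)} (hS : ∀ k, S (κ k) = c.stk k) :
    ∃ v' S', get v' = c'.var ∧ (∀ x, set x v' = set x v) ∧ (∀ k, S' (κ k) = c'.stk k) ∧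
      (∀ k, (∀ k₁, k ≠ κ k₁) → S' k = S k) ∧ Runs (step M) n ⟨some (lab l), v, S⟩
        (stepAux ex v' S') := by
  induction h generalizing l v S with
  | refl a => rw [hl] at hc'; cases hc'
  | @head a b c n hab h ih =>
    obtain ⟨_, av, aS⟩ := a
    simp only at hl hv hS
    subst hl
    simp only [step, Option.some.injEq] at hab
    obtain ⟨v', S', h1, h2, h3, h4, h5⟩ :=
      stepAux_lift hκ (lab := lab) (ex := ex) get_set set_set (M₁ l) v S
    have hS' : (fun k => S (κ k)) = aS := funext hS
    rw [hv, hS', hab] at h1 h3 h5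
    cases hb : b.l with
    | none =>
      rw [hb] at h5
      cases h with
      | refl =>
        exact ⟨v', S', h1, h2, h3, h4, .single (by rw [step, hM, h5])⟩
      | head h' _ =>
        obtain ⟨_, _, _⟩ := b
        simp only at hb
        subst hb
        cases h'
    | some l' =>
      rw [hb] at h5
      obtain ⟨v'', S'', g1, g2, g3, g4, g5⟩ := ih hc' hb h1 h3
      refine ⟨v'', S'', g1, fun x => by rw [g2, h2], g3, fun k hk => by rw [g4 k hk, h4 k hk],
        .head (by rw [step, hM, h5]) g5⟩

/-- The number of `push` instructions in a statement. -/
def Stmt.pushes {Γ : K → Type} : Stmt Γ Λ σ → ℕ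
  | .push _ _ q => q.pushes + 1
  | .peek _ _ q => q.pushes
  | .pop _ _ q => q.pushes
  | .load _ q => q.pushes
  | .branch _ q₁ q₂ => q₁.pushes + q₂.pushes
  | .goto _ => 0
  | .halt => 0

/-- Only pushes lengthen a stack. The count is generous: both branches are counted although one is
executed, and pushes to all stacks are charged to each. -/
theorem length_stepAux_le (q : Stmt Γ Λ σ) (v : σ) (S : ∀ k, List (Γ k)) (k : K) :
    ((stepAux q v S).stk k).length ≤ (S k).length + q.pushes := by
  induction q generalizing v S with
  | push j f q ih =>
    refine (ih v _).trans ?_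
    rcases eq_or_ne k j with rfl | h
    · simp [Stmt.pushes]; omega
    · simp [Stmt.pushes, update_of_ne h]
  | peek j f q ih => exact ih _ _
  | pop j f q ih =>
    refine (ih _ _).trans ?_
    rcases eq_or_ne k j with rfl | h
    · simp [Stmt.pushes]
    · simp [Stmt.pushes, update_of_ne h]
  | load f q ih => exact ih _ _
  | branch f q₁ q₂ ih₁ ih₂ =>
    simp only [stepAux, Stmt.pushes]
    cases f v
    · exact (ih₂ v S).trans (by omega)
    · exact (ih₁ v S).trans (by omega)
  | goto l => simp [Stmt.pushes]
  | halt => simp [Stmt.pushes]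

/-- This bounds the output of the first machine of a composition, hence the input length of the
second. -/
theorem length_le_of_runs {M : Λ → Stmt Γ Λ σ} {C : ℕ} (hC : ∀ l, (M l).pushes ≤ C) {n : ℕ}
    {c c' : Cfg Γ Λ σ} (h : Runs (step M) n c c') (k : K) :
    (c'.stk k).length ≤ (c.stk k).length + C * n := by
  induction h with
  | refl => simp
  | @head a b c n hab _ ih =>
    obtain ⟨_ | l, v, S⟩ := a
    · cases hab
    · simp only [step, Option.some.injEq] at hab
      have := length_stepAux_le (M l) v S k
      rw [hab] at this
      have := hC l
      rw [Nat.mul_succ]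
      dsimp only
      omega

end Turing.TM2

/-! ### Composition of stack machines -/

namespace Turing.FinTM2

open Function

variable (M₁ M₂ : FinTM2)

/-- The stack alphabets of the composition of two machines: those of the two machines and one
auxiliary stack, used to transfer the output of the first machine to the input of the second. -/
@[reducible] def compΓ : (M₁.K ⊕ M₂.K) ⊕ Unit → Type
  | .inl (.inl k) => M₁.Γ k
  | .inl (.inr k) => M₂.Γ k
  | .inr _ => M₂.Γ M₂.k₀

abbrev compΛ : Type := M₁.Λ ⊕ Bool ⊕ M₂.Λ

abbrev compσ : Type := (M₁.σ × M₂.σ) × Option (M₂.Γ M₂.k₀)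

/-- The program of the composition of two machines. -/
def compProg (tr : M₁.Γ M₁.k₁ → M₂.Γ M₂.k₀) (d : M₂.Γ M₂.k₀) :
    compΛ M₁ M₂ → TM2.Stmt (compΓ M₁ M₂) (compΛ M₁ M₂) (compσ M₁ M₂)
  | .inl l => TM2.Stmt.lift (Γ := compΓ M₁ M₂) (fun k => Sum.inl (Sum.inl k)) Sum.inl
      (.goto fun _ => Sum.inr (Sum.inl false)) (fun v => v.1.1) (fun a v => ((a, v.1.2), v.2))
      (M₁.m l)
  | .inr (.inl false) =>
      .pop (.inl (.inl M₁.k₁)) (fun v o => (v.1, o.map tr)) <|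
        .branch (fun v => v.2.isSome)
          (.push (.inr ()) (fun v => v.2.getD d) <| .goto fun _ => .inr (.inl false))
          (.goto fun _ => .inr (.inl true))
  | .inr (.inl true) =>
      .pop (.inr ()) (fun v o => (v.1, o)) <|
        .branch (fun v => v.2.isSome)
          (.push (.inl (.inr M₂.k₀)) (fun v => v.2.getD d) <| .goto fun _ => .inr (.inl true))
          (.goto fun _ => .inr (.inr M₂.main))
  | .inr (.inr l) => TM2.Stmt.lift (Γ := compΓ M₁ M₂) (fun k => Sum.inl (Sum.inr k))
      (fun l => Sum.inr (Sum.inr l)) .halt (fun v => v.1.2) (fun a v => ((v.1.1, a), v.2)) (M₂.m l)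

/-- The composition of two machines. -/
def comp (tr : M₁.Γ M₁.k₁ → M₂.Γ M₂.k₀) (d : M₂.Γ M₂.k₀) : FinTM2 :=
  haveI := M₁.kFin
  haveI := M₂.kFin
  haveI := M₁.ΛFin
  haveI := M₂.ΛFin
  haveI := M₁.σFin
  haveI := M₂.σFin
  haveI := M₁.Γk₀Fin
  haveI := M₂.Γk₀Fin
  { K := (M₁.K ⊕ M₂.K) ⊕ Unit
    k₀ := .inl (.inl M₁.k₀)
    k₁ := .inl (.inr M₂.k₁)
    Γ := compΓ M₁ M₂
    Λ := compΛ M₁ M₂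
    main := .inl M₁.main
    σ := compσ M₁ M₂
    initialState := ((M₁.initialState, M₂.initialState), none)
    Γk₀Fin := M₁.Γk₀Fin
    m := compProg M₁ M₂ tr d }

variable {M₁ M₂}

/-- The stacks of the composition of two machines. -/
def compStk (S₁ : ∀ k, List (M₁.Γ k)) (S₂ : ∀ k, List (M₂.Γ k)) (T : List (M₂.Γ M₂.k₀)) :
    ∀ k, List (compΓ M₁ M₂ k)
  | .inl (.inl k) => S₁ k
  | .inl (.inr k) => S₂ k
  | .inr _ => T

theorem compStk_update_left (S₁ : ∀ k, List (M₁.Γ k)) (S₂ : ∀ k, List (M₂.Γ k))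
    (T : List (M₂.Γ M₂.k₀)) (k : M₁.K) (x : List (M₁.Γ k)) :
    update (compStk S₁ S₂ T) (.inl (.inl k)) x = compStk (update S₁ k x) S₂ T := by
  funext j
  rcases j with (j | j) | j
  · rcases eq_or_ne j k with rfl | h
    · simp [compStk]
    · rw [update_of_ne (by simpa using h)]
      simp [compStk, h]
  · rw [update_of_ne (by simp)]; rfl
  · rw [update_of_ne (by simp)]; rfl

theorem compStk_update_right (S₁ : ∀ k, List (M₁.Γ k)) (S₂ : ∀ k, List (M₂.Γ k))
    (T : List (M₂.Γ M₂.k₀)) (k : M₂.K) (x : List (M₂.Γ k)) :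
    update (compStk S₁ S₂ T) (.inl (.inr k)) x = compStk S₁ (update S₂ k x) T := by
  funext j
  rcases j with (j | j) | j
  · rw [update_of_ne (by simp)]; rfl
  · rcases eq_or_ne j k with rfl | h
    · simp [compStk]
    · rw [update_of_ne (by simpa using h)]
      simp [compStk, h]
  · rw [update_of_ne (by simp)]; rfl

theorem compStk_update_aux (S₁ : ∀ k, List (M₁.Γ k)) (S₂ : ∀ k, List (M₂.Γ k))
    (T x : List (M₂.Γ M₂.k₀)) :
    update (compStk S₁ S₂ T) (.inr ()) x = compStk S₁ S₂ x := by
  funext j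
  rcases j with (j | j) | j
  · rw [update_of_ne (by simp)]; rfl
  · rw [update_of_ne (by simp)]; rfl
  · simp [compStk]

/-- Moving a stack symbol by symbol reverses it, which is why the transfer takes a detour through
the auxiliary stack; the second transfer restores the order. -/
theorem runs_transfer_fst (tr : M₁.Γ M₁.k₁ → M₂.Γ M₂.k₀) (d : M₂.Γ M₂.k₀)
    (v : M₁.σ × M₂.σ) (x : Option (M₂.Γ M₂.k₀)) (S₁ : ∀ k, List (M₁.Γ k))
    (S₂ : ∀ k, List (M₂.Γ k)) (T : List (M₂.Γ M₂.k₀)) (l : List (M₁.Γ M₁.k₁)) :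
    Runs (TM2.step (compProg M₁ M₂ tr d)) (l.length + 1)
      ⟨some (.inr (.inl false)), (v, x), compStk (update S₁ M₁.k₁ l) S₂ T⟩
      ⟨some (.inr (.inl true)), (v, none),
        compStk (update S₁ M₁.k₁ []) S₂ ((l.map tr).reverse ++ T)⟩ := by
  induction l generalizing T x with
  | nil =>
    refine .single ?_
    simp [compProg, compStk_update_left, compStk]
  | cons a l ih =>
    refine .head ?_ (by simpa using ih (some (tr a)) (tr a :: T))
    simp [compProg, compStk_update_left, compStk_update_aux, compStk]

theorem runs_transfer_snd (tr : M₁.Γ M₁.k₁ → M₂.Γ M₂.k₀) (d : M₂.Γ M₂.k₀)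
    (v : M₁.σ × M₂.σ) (x : Option (M₂.Γ M₂.k₀)) (S₁ : ∀ k, List (M₁.Γ k))
    (S₂ : ∀ k, List (M₂.Γ k)) (T l : List (M₂.Γ M₂.k₀)) :
    Runs (TM2.step (compProg M₁ M₂ tr d)) (T.length + 1)
      ⟨some (.inr (.inl true)), (v, x), compStk S₁ (update S₂ M₂.k₀ l) T⟩
      ⟨some (.inr (.inr M₂.main)), (v, none),
        compStk S₁ (update S₂ M₂.k₀ (T.reverse ++ l)) []⟩ := by
  induction T generalizing l x with
  | nil =>
    refine .single ?_
    simp [compProg, compStk_update_aux, compStk]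
  | cons a T ih =>
    refine .head ?_ (by simpa using ih (some a) (a :: l))
    simp [compProg, compStk_update_right, compStk_update_aux, compStk]

theorem stk_initList (M : FinTM2) (s : List (M.Γ M.k₀)) :
    (initList M s).stk = update (fun _ => []) M.k₀ s := by
  funext k
  rcases eq_or_ne k M.k₀ with rfl | h
  · simp [initList]
  · simp [initList, h]

theorem stk_haltList (M : FinTM2) (s : List (M.Γ M.k₁)) :
    (haltList M s).stk = update (fun _ => []) M.k₁ s := by
  funext k
  rcases eq_or_ne k M.k₁ with rfl | h
  · simp [haltList]
  · simp [haltList, h]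

theorem cfg_ext {K : Type} {Γ : K → Type} {Λ σ : Type} {c c' : TM2.Cfg Γ Λ σ} (h₁ : c.l = c'.l)
    (h₂ : c.var = c'.var) (h₃ : c.stk = c'.stk) : c = c' := by
  cases c; cases c'; simp_all

/-- The embedded machines share no stacks and no variables, so each runs as it would alone. A
halting configuration is clean (initial variables, all stacks but the output empty), so that after
the two transfers the second machine starts in its own initial configuration. -/
theorem runs_comp (tr : M₁.Γ M₁.k₁ → M₂.Γ M₂.k₀) (d : M₂.Γ M₂.k₀) {n₁ n₂ : ℕ}
    {s : List (M₁.Γ M₁.k₀)} {t : List (M₁.Γ M₁.k₁)} {u : List (M₂.Γ M₂.k₁)}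
    (h₁ : Runs M₁.step n₁ (initList M₁ s) (haltList M₁ t))
    (h₂ : Runs M₂.step n₂ (initList M₂ (t.map tr)) (haltList M₂ u)) :
    Runs (comp M₁ M₂ tr d).step (n₁ + (t.length + 1) + (t.length + 1) + n₂)
      (initList (comp M₁ M₂ tr d) s) (haltList (comp M₁ M₂ tr d) u) := by
  have inj₁ : Injective fun k : M₁.K => (Sum.inl (Sum.inl k) : (M₁.K ⊕ M₂.K) ⊕ Unit) :=
    fun a b h => by simpa using h
  have inj₂ : Injective fun k : M₂.K => (Sum.inl (Sum.inr k) : (M₁.K ⊕ M₂.K) ⊕ Unit) :=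
    fun a b h => by simpa using h
  obtain ⟨v₁, S₁, a1, a2, a3, a4, a5⟩ := TM2.runs_lift (Γ := compΓ M₁ M₂) inj₁
    (lab := (Sum.inl : M₁.Λ → compΛ M₁ M₂))
    (ex := .goto fun _ => Sum.inr (Sum.inl false)) (get := fun v : compσ M₁ M₂ => v.1.1)
    (set := fun a v => ((a, v.1.2), v.2)) (fun _ _ => rfl) (fun _ _ _ => rfl) (M₁ := M₁.m)
    (M := compProg M₁ M₂ tr d) (fun _ => rfl) h₁ rfl (l := M₁.main) rfl
    (v := ((M₁.initialState, M₂.initialState), none)) rfl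
    (S := compStk (initList M₁ s).stk (fun _ => []) []) (fun _ => rfl)
  -- The updates with an empty list change nothing; they bring the stacks into the form required by
  -- the transfer lemmas.
  have e1 : S₁ = compStk (update (fun _ => []) M₁.k₁ t) (update (fun _ => []) M₂.k₀ []) [] := by
    rw [← stk_haltList]
    funext k
    rcases k with (k | k) | k
    · exact a3 k
    · rw [a4 _ (by simp)]; simp [compStk]
    · rw [a4 _ (by simp)]; simp [compStk]
  have e2 : v₁ = ((M₁.initialState, M₂.initialState), none) := by
    have := a2 M₁.initialState
    obtain ⟨⟨x, y⟩, z⟩ := v₁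
    simp only [Prod.mk.injEq] at this a1 ⊢
    exact ⟨⟨a1, this.1.2⟩, this.2⟩
  rw [e1, e2] at a5
  have b := runs_transfer_fst tr d (M₁.initialState, M₂.initialState) none (fun _ => [])
    (update (fun _ => []) M₂.k₀ []) [] t
  have c := runs_transfer_snd tr d (M₁.initialState, M₂.initialState) none
    (update (fun _ => []) M₁.k₁ []) (fun _ => []) ((t.map tr).reverse ++ []) []
  obtain ⟨v₂, S₂, g1, g2, g3, g4, g5⟩ := TM2.runs_lift (Γ := compΓ M₁ M₂) inj₂
    (lab := (fun l => Sum.inr (Sum.inr l) : M₂.Λ → compΛ M₁ M₂))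
    (ex := .halt) (get := fun v : compσ M₁ M₂ => v.1.2)
    (set := fun a v => ((v.1.1, a), v.2)) (fun _ _ => rfl) (fun _ _ _ => rfl) (M₁ := M₂.m)
    (M := compProg M₁ M₂ tr d) (fun _ => rfl) h₂ rfl (l := M₂.main) rfl
    (v := ((M₁.initialState, M₂.initialState), none)) rfl
    (S := compStk (update (fun _ => []) M₁.k₁ [])
      (update (fun _ => []) M₂.k₀ (((t.map tr).reverse ++ []).reverse ++ [])) [])
    (fun k => by rw [stk_initList]; simp [compStk])
  have := ((a5.trans b).trans c).trans g5
  have e3 : initList (comp M₁ M₂ tr d) s = ⟨some (.inl M₁.main),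
      ((M₁.initialState, M₂.initialState), none),
      compStk (initList M₁ s).stk (fun _ => []) []⟩ := by
    refine cfg_ext rfl rfl ((stk_initList (comp M₁ M₂ tr d) s).trans ?_)
    change update (fun _ => [] : ∀ k, List (compΓ M₁ M₂ k)) (.inl (.inl M₁.k₀)) s =
      compStk (initList M₁ s).stk (fun _ => []) []
    rw [stk_initList, ← compStk_update_left]
    congr 1
    funext k
    rcases k with (k | k) | k <;> rfl
  have e4 : haltList (comp M₁ M₂ tr d) u = ⟨none, v₂, S₂⟩ := by
    refine cfg_ext rfl ?_ ?_
    · have := g2 M₂.initialState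
      obtain ⟨⟨x, y⟩, z⟩ := v₂
      simp only [Prod.mk.injEq] at this g1
      have g1 : y = M₂.initialState := g1
      rw [this.1.1, this.2, g1]
      rfl
    · refine (stk_haltList (comp M₁ M₂ tr d) u).trans ?_
      have hS₂ : S₂ = compStk (fun _ => []) (haltList M₂ u).stk [] := by
        funext k
        rcases k with (k | k) | k
        · rw [g4 _ (by simp)]; simp [compStk]
        · exact g3 k
        · rw [g4 _ (by simp)]; simp [compStk]
      change update (fun _ => [] : ∀ k, List (compΓ M₁ M₂ k)) (.inl (.inr M₂.k₁)) u = S₂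
      rw [hS₂, stk_haltList, ← compStk_update_right]
      congr 1
      funext k
      rcases k with (k | k) | k <;> rfl
  rw [e3, e4]
  simp only [List.append_nil, List.length_reverse, List.length_map, TM2.stepAux] at this
  exact this

end Turing.FinTM2

open Turing in
theorem Polynomial.eval_nat_mono (p : Polynomial ℕ) {a b : ℕ} (h : a ≤ b) :
    p.eval a ≤ p.eval b := by
  rw [Polynomial.eval_eq_sum, Polynomial.eval_eq_sum]
  exact Finset.sum_le_sum fun i _ => Nat.mul_le_mul_left _ (Nat.pow_le_pow_left h i)

open Turing in
/-- Polynomial-time computable functions are closed under composition. -/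
theorem IsPolyTime.comp {α β γ : Type} {f : List α × ℕ → List β × ℕ}
    {g : List β × ℕ → List γ × ℕ} (hg : IsPolyTime g) (hf : IsPolyTime f) :
    IsPolyTime (g ∘ f) := by
  obtain ⟨⟨⟨M₁, i₁, o₁⟩, t₁, h₁⟩⟩ := hf
  obtain ⟨⟨⟨M₂, i₂, o₂⟩, t₂, h₂⟩⟩ := hg
  have := M₁.ΛFin
  -- A bound for the number of pushes in a single step of the first machine.
  let C := ∑ l, (M₁.m l).pushes
  have hC : ∀ l, (M₁.m l).pushes ≤ C := fun l =>
    Finset.single_le_sum (f := fun l => (M₁.m l).pushes) (fun _ _ => Nat.zero_le _)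
      (Finset.mem_univ l)
  let tr : M₁.Γ M₁.k₁ → M₂.Γ M₂.k₀ := fun a => i₂.symm (o₁ a)
  -- The output of the first machine is at most its input plus `C` symbols for each of its steps.
  -- This bounds both transfers and is substituted into the time bound of the second machine.
  let B : Polynomial ℕ := Polynomial.X + Polynomial.C C * t₁
  refine ⟨⟨⟨M₁.comp M₂ tr (i₂.symm none), i₁, o₂⟩,
    t₁ + (B + 1) + (B + 1) + t₂.comp B, fun a => ?_⟩⟩
  have r₁ := Runs.iff_iterate.2 (h₁ a).evals_in_steps
  have r₂ := Runs.iff_iterate.2 (h₂ (f a)).evals_in_steps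
  have htr : ((encodeParamInstance (f a)).map o₁.invFun).map tr =
      (encodeParamInstance (f a)).map i₂.invFun := by
    rw [List.map_map]
    refine List.map_congr_left fun x _ => ?_
    simp [tr]
  have len : (encodeParamInstance (f a)).length ≤
      B.eval (encodeParamInstance a).length := by
    have := TM2.length_le_of_runs hC r₁ M₁.k₁
    have e1 := FinTM2.stk_haltList M₁ ((encodeParamInstance (f a)).map o₁.invFun)
    have e2 := FinTM2.stk_initList M₁ ((encodeParamInstance a).map i₁.invFun)
    have e3 : ((initList M₁ ((encodeParamInstance a).map i₁.invFun)).stk M₁.k₁).length ≤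
        (encodeParamInstance a).length := by
      rw [e2]
      -- The output stack may be the input stack, which initially holds the whole input; any other
      -- stack is initially empty.
      by_cases h : M₁.k₁ = M₁.k₀
      · rw [h]; simp
      · simp [h]
    change ((haltList M₁ ((encodeParamInstance (f a)).map o₁.invFun)).stk M₁.k₁).length ≤
      ((initList M₁ ((encodeParamInstance a).map i₁.invFun)).stk M₁.k₁).length + _ at this
    rw [e1] at this
    simp only [Function.update_self, List.length_map] at this
    have e4 : C * (h₁ a).steps ≤ C * t₁.eval (encodeParamInstance a).length :=
      Nat.mul_le_mul_left _ (h₁ a).steps_le_m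
    simp only [B, Polynomial.eval_add, Polynomial.eval_X, Polynomial.eval_mul, Polynomial.eval_C]
    exact this.trans (add_le_add e3 e4)
  have r := FinTM2.runs_comp tr (i₂.symm none) r₁ (u := _) (by rw [htr]; exact r₂)
  refine ⟨⟨_, Runs.iff_iterate.1 r⟩, ?_⟩
  have s₁ := (h₁ a).steps_le_m
  have s₂ := ((h₂ (f a)).steps_le_m).trans (t₂.eval_nat_mono len)
  simp only [Polynomial.eval_add, Polynomial.eval_one, Polynomial.eval_comp, List.length_map]
  exact add_le_add (add_le_add (add_le_add s₁ (by omega)) (by omega)) s₂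

theorem PPTReducible.trans {α β γ : Type} {P : ParamProblem α} {Q : ParamProblem β}
    {R : ParamProblem γ} (h₁ : PPTReducible P Q) (h₂ : PPTReducible Q R) : PPTReducible P R := by
  obtain ⟨f, hf⟩ := h₁
  obtain ⟨g, hg⟩ := h₂
  obtain ⟨p, hp⟩ := hf.param_le
  obtain ⟨q, hq⟩ := hg.param_le
  refine ⟨g ∘ f, hg.polyTime.comp hf.polyTime, fun x => (hf.correct x).trans (hg.correct (f x)),
    q.comp p, fun x k => ?_⟩
  rw [Polynomial.eval_comp]
  exact (hq _ _).trans (q.eval_nat_mono (hp x k))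

/-! ### A structured programming language for stack machines -/

namespace StackProg

open Function Turing

/-- The contents of the stacks: those indexed by `KA` hold symbols from `A`, those indexed by `KB`
hold symbols from `B`. -/
structure Store (KA KB A B : Type) where
  a : KA → List A
  b : KB → List B

/-- Basic operations. `moveA k ks` pops a symbol from the stack `k` and pushes it to each of the
stacks `ks`; it does nothing if the stack `k` is empty. -/
inductive Op (KA KB B : Type)
  | skip : Op KA KB B
  | pushB : KB → B → Op KA KB B
  | popB : KB → Op KA KB B
  | moveA : KA → List KA → Op KA KB B

/-- Tests: whether there is a top symbol on a stack and it satisfies a predicate, and whether a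
stack is nonempty. -/
inductive Test (KA KB A : Type)
  | topA : KA → (A → Bool) → Test KA KB A
  | neB : KB → Test KA KB A

/-- Structured programs. -/
inductive Prog (KA KB A B : Type)
  | op : Op KA KB B → Prog KA KB A B
  | seq : Prog KA KB A B → Prog KA KB A B → Prog KA KB A B
  | ite : Test KA KB A → Prog KA KB A B → Prog KA KB A B → Prog KA KB A B
  | loop : Test KA KB A → Prog KA KB A B → Prog KA KB A B

variable {KA KB A B : Type} [DecidableEq KA] [DecidableEq KB]

/-- Push a symbol to several stacks. -/
def pushAll (ks : List KA) (x : A) (a : KA → List A) : KA → List A :=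
  ks.foldl (fun a j => update a j (x :: a j)) a

def Op.act (s : Store KA KB A B) : Op KA KB B → Store KA KB A B
  | .skip => s
  | .pushB k x => ⟨s.a, update s.b k (x :: s.b k)⟩
  | .popB k => ⟨s.a, update s.b k (s.b k).tail⟩
  | .moveA k ks =>
    match s.a k with
    | [] => s
    | x :: l => ⟨pushAll ks x (update s.a k l), s.b⟩

def Test.holds (s : Store KA KB A B) : Test KA KB A → Bool
  | .topA k p => (s.a k).head?.elim false p
  | .neB k => (s.b k).head?.isSome

/-- `Exec p s n s'`: the program `p` transforms the store `s` into `s'` in `n` steps. -/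
inductive Exec : Prog KA KB A B → Store KA KB A B → ℕ → Store KA KB A B → Prop
  | op (o s) : Exec (.op o) s 1 (o.act s)
  | seq {p q s s₁ s₂ m n} : Exec p s m s₁ → Exec q s₁ n s₂ → Exec (.seq p q) s (m + n) s₂
  | ite_true {t p q s s₁ n} : t.holds s = true → Exec p s n s₁ → Exec (.ite t p q) s (n + 1) s₁
  | ite_false {t p q s s₁ n} : t.holds s = false → Exec q s n s₁ → Exec (.ite t p q) s (n + 1) s₁
  | loop_false {t p s} : t.holds s = false → Exec (.loop t p) s 1 s
  | loop_true {t p s s₁ s₂ m n} : t.holds s = true → Exec p s m s₁ → Exec (.loop t p) s₁ n s₂ →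
      Exec (.loop t p) s (m + n + 1) s₂

/-! #### Compilation -/

@[reducible] def stkΓ (KA KB A B : Type) : KA ⊕ KB → Type
  | .inl _ => A
  | .inr _ => B

def Store.stk (s : Store KA KB A B) : ∀ k, List (stkΓ KA KB A B k)
  | .inl k => s.a k
  | .inr k => s.b k

theorem Store.update_inl (s : Store KA KB A B) (k : KA) (x : List A) :
    update s.stk (.inl k) x = Store.stk ⟨update s.a k x, s.b⟩ := by
  funext j
  rcases j with j | j
  · rcases eq_or_ne j k with rfl | h
    · simp [Store.stk]
    · rw [update_of_ne (by simpa using h)]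
      simp [Store.stk, h]
  · rw [update_of_ne (by simp)]; rfl

theorem Store.update_inr (s : Store KA KB A B) (k : KB) (x : List B) :
    update s.stk (.inr k) x = Store.stk ⟨s.a, update s.b k x⟩ := by
  funext j
  rcases j with j | j
  · rw [update_of_ne (by simp)]; rfl
  · rcases eq_or_ne j k with rfl | h
    · simp [Store.stk]
    · rw [update_of_ne (by simpa using h)]
      simp [Store.stk, h]

variable {Λ : Type}

/-- The variables hold the symbol last read from a stack over `A`, and the result of the last
emptiness test of a stack over `B`. -/
abbrev Code (KA KB A B Λ : Type) : Type := TM2.Stmt (stkΓ KA KB A B) Λ (Option A × Bool)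

def Test.code (l₁ l₂ : Λ) : Test KA KB A → Code KA KB A B Λ
  | .topA k p => .peek (.inl k) (fun v o => (o, v.2)) <|
      .branch (fun v => v.1.elim false p) (.goto fun _ => l₁) (.goto fun _ => l₂)
  | .neB k => .peek (.inr k) (fun v o => (v.1, o.isSome)) <|
      .branch (fun v => v.2) (.goto fun _ => l₁) (.goto fun _ => l₂)

theorem stepAux_testCode (t : Test KA KB A) (l₁ l₂ : Λ) (v : Option A × Bool)
    (s : Store KA KB A B) :
    ∃ v', TM2.stepAux (t.code l₁ l₂) v s.stk = ⟨some (cond (t.holds s) l₁ l₂), v', s.stk⟩ := by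
  cases t with
  | topA k p =>
    refine ⟨((s.a k).head?, v.2), ?_⟩
    simp only [Test.code, Test.holds, TM2.stepAux, Store.stk]
    cases (s.a k).head?.elim false p <;> rfl
  | neB k =>
    refine ⟨(v.1, (s.b k).head?.isSome), ?_⟩
    simp only [Test.code, Test.holds, TM2.stepAux, Store.stk]
    cases (s.b k).head?.isSome <;> rfl

variable [Inhabited A]

def pushAllCode (ks : List KA) (q : Code KA KB A B Λ) : Code KA KB A B Λ :=
  ks.foldr (fun j q => .push (.inl j) (fun v => v.1.getD default) q) q

def Op.code (l : Λ) : Op KA KB B → Code KA KB A B Λ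
  | .skip => .goto fun _ => l
  | .pushB k x => .push (.inr k) (fun _ => x) <| .goto fun _ => l
  | .popB k => .pop (.inr k) (fun v _ => v) <| .goto fun _ => l
  | .moveA k ks => .pop (.inl k) (fun v o => (o, v.2)) <|
      .branch (fun v => v.1.isSome) (pushAllCode ks <| .goto fun _ => l) (.goto fun _ => l)

namespace Prog

/-- The labels of a program. -/
def Lab : Prog KA KB A B → Type
  | .op _ => Unit
  | .seq p q => p.Lab ⊕ q.Lab
  | .ite _ p q => Option (p.Lab ⊕ q.Lab)
  | .loop _ p => Option p.Lab

@[reducible] def labFintype : ∀ p : Prog KA KB A B, Fintype p.Lab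
  | .op _ => inferInstanceAs (Fintype Unit)
  | .seq p q => @instFintypeSum _ _ p.labFintype q.labFintype
  | .ite _ p q => @instFintypeOption _ (@instFintypeSum _ _ p.labFintype q.labFintype)
  | .loop _ p => @instFintypeOption _ p.labFintype

def entry : ∀ p : Prog KA KB A B, p.Lab
  | .op _ => ()
  | .seq p _ => .inl p.entry
  | .ite _ _ _ => none
  | .loop _ _ => none

/-- The code of a program whose labels are embedded by `emb` and which continues at `x`. -/
def code : ∀ (p : Prog KA KB A B), (p.Lab → Λ) → Λ → p.Lab → Code KA KB A B Λ
  | .op o, _, x, _ => o.code x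
  | .seq p q, emb, _, .inl l => p.code (fun l => emb (.inl l)) (emb (.inr q.entry)) l
  | .seq _ q, emb, x, .inr l => q.code (fun l => emb (.inr l)) x l
  | .ite t p q, emb, _, none => t.code (emb (some (.inl p.entry))) (emb (some (.inr q.entry)))
  | .ite _ p _, emb, x, some (.inl l) => p.code (fun l => emb (some (.inl l))) x l
  | .ite _ _ q, emb, x, some (.inr l) => q.code (fun l => emb (some (.inr l))) x l
  | .loop t p, emb, x, none => t.code (emb (some p.entry)) x
  | .loop _ p, emb, _, some l => p.code (fun l => emb (some l)) (emb none) l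

end Prog

theorem stepAux_pushAllCode (ks : List KA) (q : Code KA KB A B Λ) (x : A) (c : Bool)
    (a : KA → List A) (b : KB → List B) :
    TM2.stepAux (pushAllCode ks q) (some x, c) (Store.stk ⟨a, b⟩) =
      TM2.stepAux q (some x, c) (Store.stk ⟨pushAll ks x a, b⟩) := by
  induction ks generalizing a with
  | nil => rfl
  | cons k ks ih =>
    have := ih (update a k (x :: a k))
    simp only [pushAllCode, List.foldr_cons, TM2.stepAux, Store.update_inl, Option.getD_some]
    exact this

theorem stepAux_opCode (o : Op KA KB B) (l : Λ) (v : Option A × Bool) (s : Store KA KB A B) :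
    ∃ v', TM2.stepAux (o.code l) v s.stk = ⟨some l, v', (o.act s).stk⟩ := by
  cases o with
  | skip => exact ⟨v, rfl⟩
  | pushB k x => exact ⟨v, by simp [Op.code, Op.act, Store.update_inr, Store.stk]⟩
  | popB k => exact ⟨v, by simp [Op.code, Op.act, Store.update_inr, Store.stk]⟩
  | moveA k ks =>
    cases h : s.a k with
    | nil =>
      refine ⟨(none, v.2), ?_⟩
      have h' : s.stk (.inl k) = [] := h
      simp only [Op.code, Op.act, TM2.stepAux, Store.update_inl, h, h', List.head?_nil,
        Option.isSome_none, cond_false, List.tail_nil]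
      rw [← h, update_eq_self]
    | cons x t =>
      refine ⟨(some x, v.2), ?_⟩
      have h' : s.stk (.inl k) = x :: t := h
      simp only [Op.code, Op.act, TM2.stepAux, Store.update_inl, h, h', List.head?_cons,
        Option.isSome_some, cond_true, List.tail_cons, stepAux_pushAllCode]

/-- Every part is compiled with the label at which to continue, so runs of parts concatenate and the
step count is exact. The variables may be arbitrary at entry, because tests and operations write
them before reading them. -/
theorem Exec.runs {p : Prog KA KB A B} {s s' : Store KA KB A B} {n : ℕ} (h : Exec p s n s')
    {M : Λ → Code KA KB A B Λ} {emb : p.Lab → Λ} {x : Λ} (hM : ∀ l, M (emb l) = p.code emb x l)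
    (v : Option A × Bool) :
    ∃ v', Runs (TM2.step M) n ⟨some (emb p.entry), v, s.stk⟩ ⟨some x, v', s'.stk⟩ := by
  induction h generalizing x v with
  | op o s =>
    obtain ⟨v', h⟩ := stepAux_opCode o x v s
    exact ⟨v', .single (by rw [TM2.step, hM, ← h]; rfl)⟩
  | @seq p q _ _ _ _ _ _ _ ih₁ ih₂ =>
    obtain ⟨v₁, h₁⟩ := ih₁ (emb := fun l => emb (.inl l)) (x := emb (.inr q.entry))
      (fun l => hM (.inl l)) v
    obtain ⟨v₂, h₂⟩ := ih₂ (emb := fun l => emb (.inr l)) (fun l => hM (.inr l)) v₁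
    exact ⟨v₂, h₁.trans h₂⟩
  | @ite_true t p q s _ _ ht _ ih =>
    obtain ⟨v₁, h₁⟩ := stepAux_testCode t (emb (some (.inl p.entry))) (emb (some (.inr q.entry))) v s
    obtain ⟨v₂, h₂⟩ := ih (emb := fun l => emb (some (.inl l))) (fun l => hM (some (.inl l))) v₁
    rw [ht] at h₁
    exact ⟨v₂, .head (by rw [TM2.step, hM]; exact congrArg some h₁) h₂⟩
  | @ite_false t p q s _ _ ht _ ih =>
    obtain ⟨v₁, h₁⟩ := stepAux_testCode t (emb (some (.inl p.entry))) (emb (some (.inr q.entry))) v s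
    obtain ⟨v₂, h₂⟩ := ih (emb := fun l => emb (some (.inr l))) (fun l => hM (some (.inr l))) v₁
    rw [ht] at h₁
    exact ⟨v₂, .head (by rw [TM2.step, hM]; exact congrArg some h₁) h₂⟩
  | @loop_false t p s ht =>
    obtain ⟨v₁, h₁⟩ := stepAux_testCode t (emb (some p.entry)) x v s
    rw [ht] at h₁
    exact ⟨v₁, .single (by rw [TM2.step, hM]; exact congrArg some h₁)⟩
  | @loop_true t p s _ _ _ _ ht _ _ ih₁ ih₂ =>
    obtain ⟨v₁, h₁⟩ := stepAux_testCode t (emb (some p.entry)) x v s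
    obtain ⟨v₂, h₂⟩ := ih₁ (emb := fun l => emb (some l)) (x := emb none) (fun l => hM (some l)) v₁
    obtain ⟨v₃, h₃⟩ := ih₂ hM v₂
    rw [ht] at h₁
    exact ⟨v₃, .head (by rw [TM2.step, hM]; exact congrArg some h₁) (h₂.trans h₃)⟩

/-- The stack machine that executes a program and halts. -/
def Prog.machine [Fintype KA] [Fintype KB] [Fintype A] (p : Prog KA KB A B) (i : KA) (o : KB) :
    FinTM2 :=
  haveI := p.labFintype
  { K := KA ⊕ KB
    k₀ := .inl i
    k₁ := .inr o
    Γ := stkΓ KA KB A B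
    Λ := Option p.Lab
    main := some p.entry
    σ := Option A × Bool
    initialState := (none, false)
    Γk₀Fin := inferInstanceAs (Fintype A)
    m := fun l => match l with
      -- The variables are reset because a halting configuration must carry the initial state; this
      -- is the one extra step of the machine.
      | none => .load (fun _ => (none, false)) .halt
      | some l => p.code some none l }

theorem Exec.runs_machine [Fintype KA] [Fintype KB] [Fintype A] {p : Prog KA KB A B} {i : KA}
    {o : KB} {n : ℕ} {x : List A} {y : List B}
    (h : Exec p ⟨update (fun _ => []) i x, fun _ => []⟩ n ⟨fun _ => [], update (fun _ => []) o y⟩) :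
    Runs (p.machine i o).step (n + 1) (initList (p.machine i o) x)
      (haltList (p.machine i o) y) := by
  obtain ⟨v, r⟩ := h.runs (M := (p.machine i o).m) (emb := some) (x := none) (fun _ => rfl)
    (none, false)
  have e₁ : initList (p.machine i o) x = ⟨some (some p.entry), (none, false),
      Store.stk ⟨update (fun _ => []) i x, fun _ => []⟩⟩ := by
    refine FinTM2.cfg_ext rfl rfl ((FinTM2.stk_initList (p.machine i o) x).trans ?_)
    refine Eq.trans ?_ (Store.update_inl (B := B) ⟨fun _ => [], fun _ => []⟩ i x)
    congr 1
    funext k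
    rcases k with k | k <;> rfl
  have e₂ : haltList (p.machine i o) y = ⟨none, (none, false),
      Store.stk ⟨fun _ => [], update (fun _ => []) o y⟩⟩ := by
    refine FinTM2.cfg_ext rfl rfl ((FinTM2.stk_haltList (p.machine i o) y).trans ?_)
    refine Eq.trans ?_ (Store.update_inr (A := A) ⟨fun _ => [], fun _ => []⟩ o y)
    congr 1
    funext k
    rcases k with k | k <;> rfl
  rw [e₁, e₂]
  exact Runs.trans r (.single rfl)

end StackProg

/-! ### A loop language over the positions of the input -/

/-- Expressions that denote lists. The variables range over positions of the input word. -/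
inductive LoopExpr (V A B : Type)
  | nil : LoopExpr V A B
  | emit : B → LoopExpr V A B
  | append : LoopExpr V A B → LoopExpr V A B → LoopExpr V A B
  | ifSym : V → (A → Bool) → LoopExpr V A B → LoopExpr V A B → LoopExpr V A B
  | rep : V → B → LoopExpr V A B
  | ifLe : LoopExpr V A B → LoopExpr V A B → LoopExpr V A B → LoopExpr V A B → LoopExpr V A B
  | loop : V → LoopExpr V A B → LoopExpr V A B

namespace LoopExpr

open Function StackProg Turing

variable {V A B : Type} [DecidableEq V]

/-- The value of an expression on the input word `w`: `ifSym x p` tests the symbol at position `x`,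
`rep x b` repeats the symbol `b` as many times as the position `x` says, `ifLe` compares the lengths
of the values of two expressions, and `loop x` concatenates over all values of `x`. -/
def eval (w : List A) : LoopExpr V A B → (V → ℕ) → List B
  | nil, _ => []
  | emit b, _ => [b]
  | append e₁ e₂, env => eval w e₁ env ++ eval w e₂ env
  | ifSym x p e₁ e₂, env => if (w[env x]?).elim false p = true then eval w e₁ env else eval w e₂ env
  | rep x b, env => List.replicate (env x) b
  | ifLe a b e₁ e₂, env =>
    if (eval w a env).length ≤ (eval w b env).length then eval w e₁ env else eval w e₂ env
  | loop x e, env => (List.range w.length).flatMap fun i => eval w e (update env x i)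

/-- No variable of a loop is reused inside the loop, and those in `U` are not used for loops. -/
def Scoped : LoopExpr V A B → List V → Prop
  | nil, _ => True
  | emit _, _ => True
  | append e₁ e₂, U => e₁.Scoped U ∧ e₂.Scoped U
  | ifSym _ _ e₁ e₂, U => e₁.Scoped U ∧ e₂.Scoped U
  | rep _ _, _ => True
  | ifLe a b e₁ e₂, U => a.Scoped U ∧ b.Scoped U ∧ e₁.Scoped U ∧ e₂.Scoped U
  | loop x e, U => x ∉ U ∧ e.Scoped (x :: U)

/-- The nesting depth of comparisons. -/
def height : LoopExpr V A B → ℕ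
  | nil => 0
  | emit _ => 0
  | append e₁ e₂ => max e₁.height e₂.height
  | ifSym _ _ e₁ e₂ => max e₁.height e₂.height
  | rep _ _ => 0
  | ifLe a b e₁ e₂ => max (max a.height b.height + 1) (max e₁.height e₂.height)
  | loop _ e => e.height

/-- A bound for the running time, as a polynomial in the length of the input. -/
noncomputable def cost : LoopExpr V A B → Polynomial ℕ
  | nil => 1
  | emit _ => 1
  | append e₁ e₂ => e₁.cost + e₂.cost
  | ifSym _ _ e₁ e₂ => 1 + e₁.cost + e₂.cost
  | rep _ _ => 5 * .X + 2
  | ifLe a b e₁ e₂ => 3 * a.cost + 4 * b.cost + e₁.cost + e₂.cost + 3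
  | loop _ e => .X * (e.cost + 4) + 2

/-- Each symbol costs at least one step to produce. The bound is needed for comparisons, where
computed values are popped again. -/
theorem length_eval_le (w : List A) (e : LoopExpr V A B) (env : V → ℕ)
    (henv : ∀ x, env x ≤ w.length) : (e.eval w env).length ≤ e.cost.eval w.length := by
  induction e generalizing env with
  | nil => simp [eval, cost]
  | emit b => simp [eval, cost]
  | append e₁ e₂ ih₁ ih₂ => simpa [eval, cost] using add_le_add (ih₁ env henv) (ih₂ env henv)
  | ifSym x p e₁ e₂ ih₁ ih₂ =>
    have h₁ := ih₁ env henv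
    have h₂ := ih₂ env henv
    simp only [eval, cost, Polynomial.eval_add, Polynomial.eval_one]
    split <;> omega
  | rep x b =>
    have := henv x
    simp only [eval, cost, List.length_replicate, Polynomial.eval_add, Polynomial.eval_mul,
      Polynomial.eval_X, Polynomial.eval_ofNat]
    omega
  | ifLe a b e₁ e₂ _ _ ih₁ ih₂ =>
    have h₁ := ih₁ env henv
    have h₂ := ih₂ env henv
    simp only [eval, cost, Polynomial.eval_add]
    split <;> omega
  | loop x e ih =>
    simp only [eval, cost, List.length_flatMap, Polynomial.eval_add, Polynomial.eval_mul,
      Polynomial.eval_X, Polynomial.eval_ofNat]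
    have : ((List.range w.length).map fun i => (eval w e (update env x i)).length).sum ≤
        (List.range w.length).length • e.cost.eval w.length := by
      rw [← List.length_map (as := List.range w.length)]
      refine List.sum_le_card_nsmul _ _ fun y hy => ?_
      obtain ⟨i, hi, rfl⟩ := List.mem_map.1 hy
      refine ih _ fun y => ?_
      rw [List.mem_range] at hi
      rcases eq_or_ne y x with rfl | h
      · simpa using hi.le
      · simpa [h] using henv y
    rw [List.length_range, smul_eq_mul] at this
    rw [mul_add]
    exact this.trans (by omega)

/-! #### Compilation -/

/-- Stacks with symbols of the input: the input, an auxiliary stack, and for each variable the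
input before (in reverse) and from the current position. -/
abbrev KA (V : Type) : Type := Bool ⊕ (Bool × V)

/-- Stacks with symbols of the output: the output and two stacks for each nested comparison. -/
abbrev KB (H : ℕ) : Type := Option (Bool × Fin H)

abbrev inp : KA V := .inl true
abbrev aux : KA V := .inl false
abbrev left (x : V) : KA V := .inr (true, x)
abbrev right (x : V) : KA V := .inr (false, x)

/-- The level is reduced modulo `H`, so different levels give different stacks only below `H`. -/
def scratch {H : ℕ} [NeZero H] (b : Bool) (h : ℕ) : KB H := some (b, Fin.ofNat H h)

theorem scratch_ne {H : ℕ} [NeZero H] {b c : Bool} {h k : ℕ} (hh : h < H) (hk : k < H)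
    (hne : b ≠ c ∨ h ≠ k) : (scratch b h : KB H) ≠ scratch c k := by
  intro e
  simp only [scratch, Option.some.injEq, Prod.mk.injEq] at e
  have := congrArg Fin.val e.2
  simp only [Fin.ofNat, Nat.mod_eq_of_lt hh, Nat.mod_eq_of_lt hk] at this
  exact hne.elim (fun h => h e.1) fun h => h this

/-- Whether a stack is nonempty. -/
abbrev ne {H : ℕ} (k : KA V) : Test (KA V) (KB H) A := .topA k fun _ => true

/-- The value is pushed onto a stack whose top is its first symbol, so it is produced from its end:
`append` runs its second part first, and loops go from the last position down to the first. A
comparison writes both values to scratch stacks and pops them in parallel. -/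
def compile {H : ℕ} [NeZero H] : LoopExpr V A B → KB H → Prog (KA V) (KB H) A B
  | nil, _ => .op .skip
  | emit b, o => .op (.pushB o b)
  | append e₁ e₂, o => .seq (e₂.compile o) (e₁.compile o)
  | ifSym x p e₁ e₂, o => .ite (.topA (right x) p) (e₁.compile o) (e₂.compile o)
  | rep x b, o =>
    .seq (.loop (ne (left x)) (.seq (.op (.moveA (left x) [aux])) (.op (.pushB o b))))
      (.loop (ne aux) (.op (.moveA aux [left x])))
  | ifLe a b e₁ e₂, o =>
    let k : KB H := scratch false (max a.height b.height)
    let l : KB H := scratch true (max a.height b.height)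
    .seq (a.compile k) <| .seq (b.compile l) <|
      .seq (.loop (.neB l) (.seq (.op (.popB l)) (.op (.popB k)))) <|
        .ite (.neB k) (.seq (.loop (.neB k) (.op (.popB k))) (e₂.compile o)) (e₁.compile o)
  | loop x e, o =>
    .seq (.loop (ne (left x)) (.seq (.op (.moveA (left x) [right x])) (e.compile o)))
      (.loop (ne (right x)) (.op (.moveA (right x) [left x])))

/-! ### Execution of the basic loops -/

section Exec

variable {KA KB : Type} [DecidableEq KA] [DecidableEq KB]

theorem update_nil_of_eq {a : KA → List A} {k : KA} (h : a k = []) : update a k [] = a := by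
  rw [← h, update_eq_self]

theorem _root_.StackProg.Exec.congr {p : Prog KA KB A B} {s s₁ s₂ : Store KA KB A B} {m n : ℕ}
    (h : Exec p s m s₁) (hn : m = n) (hs : s₁ = s₂) : Exec p s n s₂ := hn ▸ hs ▸ h

theorem exec_transfer {k k' : KA} (hk : k ≠ k') (b : KB → List B) (a : KA → List A) :
    Exec (.loop (.topA k fun _ => true) (.op (.moveA k [k']))) ⟨a, b⟩ (2 * (a k).length + 1)
      ⟨update (update a k []) k' ((a k).reverse ++ a k'), b⟩ := by
  generalize hl : a k = l
  induction l generalizing a with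
  | nil =>
    have : update (update a k []) k' ([].reverse ++ a k') = a := by
      rw [update_nil_of_eq hl]; simp
    rw [this]
    exact .loop_false (by simp [Test.holds, hl])
  | cons x l ih =>
    have h := ih (update (update a k l) k' (x :: a k')) (by simp [hk])
    have e₁ : Op.act ⟨a, b⟩ (.moveA k [k']) = ⟨update (update a k l) k' (x :: a k'), b⟩ := by
      simp [Op.act, hl, pushAll, hk.symm]
    have h₁ : Exec (A := A) (.op (.moveA k [k'])) ⟨a, b⟩ 1
        ⟨update (update a k l) k' (x :: a k'), b⟩ := e₁ ▸ .op _ _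
    have h₂ := Exec.loop_true (t := .topA k fun _ => true) (by simp [Test.holds, hl]) h₁ h
    convert h₂ using 2
    · simp; omega
    · funext j
      rcases eq_or_ne j k' with rfl | hj
      · simp
      · rcases eq_or_ne j k with rfl | hj'
        · simp [hj]
        · simp [hj, hj']

theorem exec_transfer_emit {k k' : KA} (hk : k ≠ k') {o : KB} (y : B) (b : KB → List B)
    (a : KA → List A) :
    Exec (.loop (.topA k fun _ => true) (.seq (.op (.moveA k [k'])) (.op (.pushB o y)))) ⟨a, b⟩
      (3 * (a k).length + 1) ⟨update (update a k []) k' ((a k).reverse ++ a k'),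
        update b o (List.replicate (a k).length y ++ b o)⟩ := by
  generalize hl : a k = l
  induction l generalizing a b with
  | nil =>
    have : update (update a k []) k' ([].reverse ++ a k') = a := by
      rw [update_nil_of_eq hl]; simp
    rw [this]
    simpa using Exec.loop_false (by simp [Test.holds, hl])
  | cons x l ih =>
    have h := ih (update b o (y :: b o)) (update (update a k l) k' (x :: a k')) (by simp [hk])
    have e₁ : Op.act ⟨a, b⟩ (.moveA k [k']) = ⟨update (update a k l) k' (x :: a k'), b⟩ := by
      simp [Op.act, hl, pushAll, hk.symm]
    have h₁ : Exec (A := A) (.op (.moveA k [k'])) ⟨a, b⟩ 1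
        ⟨update (update a k l) k' (x :: a k'), b⟩ := e₁ ▸ .op _ _
    have h₂ := Exec.loop_true (t := .topA k fun _ => true) (by simp [Test.holds, hl])
      (h₁.seq (.op (.pushB o y) _)) h
    convert h₂ using 2
    · simp; omega
    · funext j
      rcases eq_or_ne j k' with rfl | hj
      · simp
      · rcases eq_or_ne j k with rfl | hj'
        · simp [hj]
        · simp [hj, hj']
    · simp [List.replicate_succ']

theorem exec_clearA {k : KA} (b : KB → List B) (a : KA → List A) :
    Exec (.loop (.topA k fun _ => true) (.op (.moveA k []))) ⟨a, b⟩ (2 * (a k).length + 1)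
      ⟨update a k [], b⟩ := by
  generalize hl : a k = l
  induction l generalizing a with
  | nil =>
    rw [update_nil_of_eq hl]
    exact .loop_false (by simp [Test.holds, hl])
  | cons x l ih =>
    have h := ih (update a k l) (by simp)
    have e₁ : Op.act ⟨a, b⟩ (.moveA k []) = ⟨update a k l, b⟩ := by
      simp [Op.act, hl, pushAll]
    have h₁ : Exec (A := A) (.op (.moveA k [])) ⟨a, b⟩ 1 ⟨update a k l, b⟩ := e₁ ▸ .op _ _
    have h₂ := Exec.loop_true (t := .topA k fun _ => true) (by simp [Test.holds, hl]) h₁ h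
    convert h₂ using 2
    · simp; omega
    · simp

theorem exec_clearB {k : KB} (a : KA → List A) (b : KB → List B) :
    Exec (.loop (.neB k) (.op (.popB k))) ⟨a, b⟩ (2 * (b k).length + 1) ⟨a, update b k []⟩ := by
  generalize hl : b k = l
  induction l generalizing b with
  | nil =>
    rw [update_nil_of_eq hl]
    exact .loop_false (by simp [Test.holds, hl])
  | cons x l ih =>
    have h := ih (update b k l) (by simp)
    have e₁ : Op.act ⟨a, b⟩ (.popB k) = ⟨a, update b k l⟩ := by simp [Op.act, hl]
    have h₁ : Exec (A := A) (.op (.popB k)) ⟨a, b⟩ 1 ⟨a, update b k l⟩ := e₁ ▸ .op _ _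
    have h₂ := Exec.loop_true (t := .neB k) (by simp [Test.holds, hl]) h₁ h
    convert h₂ using 2
    · simp; omega
    · simp

/-- Popping an empty stack does nothing, so this is truncated subtraction of lengths; something
remains on `k` exactly if it was the longer stack. -/
theorem exec_subtract {k l : KB} (hkl : k ≠ l) (a : KA → List A) (b : KB → List B) :
    Exec (.loop (.neB l) (.seq (.op (.popB l)) (.op (.popB k)))) ⟨a, b⟩ (3 * (b l).length + 1)
      ⟨a, update (update b l []) k ((b k).drop (b l).length)⟩ := by
  generalize hl : b l = t
  induction t generalizing b with
  | nil =>
    have : update (update b l []) k ((b k).drop ([] : List B).length) = b := by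
      rw [update_nil_of_eq hl]; simp
    rw [this]
    exact .loop_false (by simp [Test.holds, hl])
  | cons x t ih =>
    have h := ih (update (update b l t) k (b k).tail) (by simp [hkl.symm])
    have e₁ : Op.act ⟨a, b⟩ (.popB l) = ⟨a, update b l t⟩ := by simp [Op.act, hl]
    have e₂ : Op.act ⟨a, update b l t⟩ (.popB k) = ⟨a, update (update b l t) k (b k).tail⟩ := by
      simp [Op.act, hkl]
    have h₁ : Exec (A := A) (.op (.popB l)) ⟨a, b⟩ 1 ⟨a, update b l t⟩ := e₁ ▸ .op _ _
    have h₂ : Exec (A := A) (.op (.popB k)) ⟨a, update b l t⟩ 1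
      ⟨a, update (update b l t) k (b k).tail⟩ := e₂ ▸ .op _ _
    have h₃ := Exec.loop_true (t := .neB l) (by simp [Test.holds, hl]) (h₁.seq h₂) h
    convert h₃ using 2
    · simp; omega
    · funext j
      rcases eq_or_ne j k with rfl | hj
      · simp
      · rcases eq_or_ne j l with rfl | hj'
        · simp [hj]
        · simp [hj, hj']

theorem pushAll_eq {ks : List KA} (h : ks.Nodup) (x : A) (a : KA → List A) :
    pushAll ks x a = fun j => if j ∈ ks then x :: a j else a j := by
  induction ks generalizing a with
  | nil => rfl
  | cons k ks ih =>
    rw [List.nodup_cons] at h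
    have := ih h.2 (update a k (x :: a k))
    simp only [pushAll, List.foldl_cons] at this ⊢
    rw [this]
    funext j
    rcases eq_or_ne j k with rfl | hj
    · simp [h.1]
    · simp [hj]

end Exec

/-- The contents of the stacks when the position of each variable `x` is `env x`. -/
def heads (w : List A) (env : V → ℕ) : KA V → List A
  | .inl _ => []
  | .inr (true, x) => (w.take (env x)).reverse
  | .inr (false, x) => w.drop (env x)

theorem heads_update (w : List A) (env : V → ℕ) (x : V) (i : ℕ) :
    heads w (update env x i) =
      update (update (heads w env) (left x) (w.take i).reverse) (right x) (w.drop i) := by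
  funext k
  rcases k with k | ⟨_ | _, y⟩
  · simp [heads]
  · rcases eq_or_ne y x with rfl | h
    · simp [heads]
    · simp [heads, h]
  · rcases eq_or_ne y x with rfl | h
    · simp [heads]
    · simp [heads, h]

theorem act_moveLeft {KB : Type} [DecidableEq KB] (w : List A) (env : V → ℕ) (x : V) (i : ℕ)
    (h : i < w.length) (b : KB → List B) :
    Op.act ⟨heads w (update env x (i + 1)), b⟩ (.moveA (left x) [right x]) =
      ⟨heads w (update env x i), b⟩ := by
  have e : heads w (update env x (i + 1)) (left x) = w[i] :: (w.take i).reverse := by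
    simp only [heads, update_self]
    rw [List.take_add_one, List.getElem?_eq_getElem h]
    simp
  simp only [Op.act]
  rw [e]
  simp only [pushAll, List.foldl_cons, List.foldl_nil]
  rw [heads_update, heads_update]
  congr 1
  funext k
  rcases k with k | ⟨_ | _, y⟩
  · simp
  · rcases eq_or_ne y x with rfl | h'
    · simp
    · simp [h']
  · rcases eq_or_ne y x with rfl | h'
    · simp
    · simp [h']

/-- A loop ends with its variable at position 0. Moving it back to the end of the input restores the
invariant that variables not in use stand there. -/
theorem exec_rewind {KB : Type} [DecidableEq KB] (w : List A) (env : V → ℕ) (x : V)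
    (h : env x = w.length) (b : KB → List B) :
    Exec (.loop (.topA (right x) fun _ => true) (.op (.moveA (right x) [left x])))
      ⟨heads w (update env x 0), b⟩ (2 * w.length + 1) ⟨heads w env, b⟩ := by
  have := exec_transfer (k := right x) (k' := left x) (by simp) b (heads w (update env x 0))
  convert this using 2
  · simp [heads]
  · have e : env = update env x w.length := by rw [← h, update_eq_self]
    conv_lhs => rw [e]
    rw [heads_update, heads_update]
    funext k
    rcases k with k | ⟨_ | _, y⟩
    · simp
    · rcases eq_or_ne y x with rfl | h'
      · simp
      · simp [h']
    · rcases eq_or_ne y x with rfl | h'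
      · simp
      · simp [h']

/-- Each round first decrements the position and then runs the body, so the body sees the positions
`i - 1`, …, `0`. Since every round puts its output in front, the result is in increasing order. -/
theorem exec_loop {KB : Type} [DecidableEq KB] {w : List A} {env : V → ℕ} {x : V} {o : KB}
    {p : Prog (KA V) KB A B} {g : ℕ → List B} {T : ℕ} (b : KB → List B)
    (hp : ∀ i < w.length, ∀ l, ∃ n ≤ T, Exec p ⟨heads w (update env x i), update b o l⟩ n
      ⟨heads w (update env x i), update b o (g i ++ l)⟩) (i : ℕ) (hi : i ≤ w.length) (l : List B) :
    ∃ n ≤ i * (T + 2) + 1,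
      Exec (.loop (.topA (left x) fun _ => true) (.seq (.op (.moveA (left x) [right x])) p))
        ⟨heads w (update env x i), update b o l⟩ n
        ⟨heads w (update env x 0), update b o ((List.range i).flatMap g ++ l)⟩ := by
  induction i generalizing l with
  | zero =>
    refine ⟨1, by omega, ?_⟩
    rw [List.range_zero, List.flatMap_nil, List.nil_append]
    exact .loop_false (by simp [Test.holds, heads])
  | succ i ih =>
    obtain ⟨n, hn, h⟩ := hp i (by omega) l
    obtain ⟨m, hm, h'⟩ := ih (by omega) (g i ++ l)
    have h₀ : Exec (.op (.moveA (left x) [right x]))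
        ⟨heads w (update env x (i + 1)), update b o l⟩ 1
        ⟨heads w (update env x i), update b o l⟩ := by
      rw [← act_moveLeft w env x i hi]
      exact .op _ _
    refine ⟨1 + n + m + 1, ?_, ?_⟩
    · rw [Nat.add_mul]; omega
    · have h₁ : (Test.topA (left x) fun _ => true : Test (KA V) KB A).holds
          (⟨heads w (update env x (i + 1)), update b o l⟩ : Store (KA V) KB A B) = true := by
        have : (List.take (i + 1) w).reverse ≠ [] := by
          rw [ne_eq, List.reverse_eq_nil_iff, List.take_eq_nil_iff]
          rintro (h | rfl)
          · omega
          · simp at hi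
        simp only [Test.holds, heads, update_self]
        cases h : (List.take (i + 1) w).reverse with
        | nil => exact absurd h this
        | cons _ _ => rfl
      have := Exec.loop_true h₁ (h₀.seq h) h'
      simpa [List.range_succ] using this

/-- Induction on the expression with two invariants: variables not bound by a surrounding loop
(those outside `U`) stand at the end of the input, so that a loop can start there; and the scratch
stacks of levels below the height are empty and different from the output stack. -/
theorem exec_compile {H : ℕ} [NeZero H] (w : List A) (e : LoopExpr V A B) (U : List V)
    (env : V → ℕ) (o : KB H) (b : KB H → List B) (hU : e.Scoped U)
    (henv : ∀ x, env x ≤ w.length) (hx : ∀ x ∉ U, env x = w.length) (hH : e.height ≤ H)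
    (hb : ∀ h < e.height, ∀ c, (scratch c h : KB H) ≠ o ∧ b (scratch c h) = []) :
    ∃ n ≤ e.cost.eval w.length, Exec (e.compile o) ⟨heads w env, b⟩ n
      ⟨heads w env, update b o (e.eval w env ++ b o)⟩ := by
  induction e generalizing U env o b with
  | nil =>
    refine ⟨1, by simp [cost], ?_⟩
    simpa [eval, compile, Op.act] using Exec.op (A := A) (B := B) .skip (⟨heads w env, b⟩ : Store (KA V) (KB H) A B)
  | emit y => exact ⟨1, by simp [cost], .op (.pushB o y) _⟩
  | append e₁ e₂ ih₁ ih₂ =>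
    simp only [height, sup_le_iff, lt_sup_iff] at hH hb
    obtain ⟨n₂, h₂, r₂⟩ := ih₂ U env o b hU.2 henv hx hH.2 fun h hh => hb h (.inr hh)
    obtain ⟨n₁, h₁, r₁⟩ := ih₁ U env o (update b o (e₂.eval w env ++ b o)) hU.1 henv hx hH.1
      fun h hh c => by
        have := hb h (.inl hh) c
        exact ⟨this.1, by rw [update_of_ne this.1, this.2]⟩
    refine ⟨n₂ + n₁, by simp only [cost, Polynomial.eval_add]; omega, ?_⟩
    have := r₂.seq r₁
    simpa [eval, compile] using this
  | ifSym x p e₁ e₂ ih₁ ih₂ =>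
    simp only [height, sup_le_iff, lt_sup_iff] at hH hb
    have ht : (Test.topA (right x) p : Test (KA V) (KB H) A).holds
        (⟨heads w env, b⟩ : Store (KA V) (KB H) A B) = (w[env x]?).elim false p := by
      simp [Test.holds, heads, List.head?_drop]
    simp only [eval, cost, Polynomial.eval_add, Polynomial.eval_one]
    split
    · next h =>
      obtain ⟨n₁, h₁, r₁⟩ := ih₁ U env o b hU.1 henv hx hH.1 fun h hh => hb h (.inl hh)
      exact ⟨n₁ + 1, by omega, .ite_true (ht.trans h) r₁⟩
    · next h =>
      obtain ⟨n₂, h₂, r₂⟩ := ih₂ U env o b hU.2 henv hx hH.2 fun h hh => hb h (.inr hh)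
      exact ⟨n₂ + 1, by omega, .ite_false (ht.trans (by simpa using h)) r₂⟩
  | rep x y =>
    have r₁ := exec_transfer_emit (k := left x) (k' := aux) (by simp) (o := o) y b (heads w env)
    have r₂ := exec_transfer (k := aux) (k' := left x) (by simp)
      (update b o (List.replicate (heads w env (left x)).length y ++ b o))
      (update (update (heads w env) (left x) []) aux
        ((heads w env (left x)).reverse ++ heads w env aux))
    have hl : (heads w env (left x)).length = env x := by simp [heads, henv x]
    refine ⟨5 * env x + 2, ?_, ?_⟩
    · simpa [cost] using henv x
    · refine (r₁.seq r₂).congr ?_ ?_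
      · simp only [update_self, List.length_append, List.length_reverse, hl]
        simp only [heads, List.length_nil]
        omega
      · congr 1
        · funext k
          rcases eq_or_ne k (left x) with rfl | h
          · simp [heads]
          · rcases eq_or_ne k aux with rfl | h'
            · simp [heads]
            · simp [h, h']
        · rw [hl]; rfl
  | ifLe a c e₁ e₂ iha ihc ih₁ ih₂ =>
    simp only [height, sup_le_iff, lt_sup_iff] at hH hb
    obtain ⟨hUa, hUc, hU₁, hU₂⟩ := hU
    -- Comparisons inside `a` and `c` use levels below `m` only, so level `m` is free to hold their
    -- two values.
    set m := max a.height c.height with hm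
    have ham : a.height ≤ m := le_max_left _ _
    have hcm : c.height ≤ m := le_max_right _ _
    have hmH : m < H := by omega
    set k : KB H := scratch false m with hk
    set l : KB H := scratch true m with hl
    have hkl : k ≠ l := scratch_ne hmH hmH (by simp)
    have hbk := hb m (.inl (by omega)) false
    have hbl := hb m (.inl (by omega)) true
    obtain ⟨na, ha, ra⟩ := iha U env k b hUa henv hx (by omega) fun h hh d =>
      ⟨scratch_ne (by omega) hmH (.inr (by omega)), (hb h (.inl (by omega)) d).2⟩
    rw [← hk] at hbk
    rw [← hl] at hbl
    rw [hbk.2, List.append_nil] at ra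
    obtain ⟨nc, hc, rc⟩ := ihc U env l (update b k (a.eval w env)) hUc henv hx (by omega)
      fun h hh d => ⟨scratch_ne (by omega) hmH (.inr (by omega)), by
        rw [update_of_ne (scratch_ne (by omega) hmH (.inr (by omega)))]
        exact (hb h (.inl (by omega)) d).2⟩
    rw [update_of_ne hkl.symm, hbl.2, List.append_nil] at rc
    have rs := exec_subtract hkl (heads w env)
      (update (update b k (a.eval w env)) l (c.eval w env))
    have e₃ : update (update (update (update b k (a.eval w env)) l (c.eval w env)) l []) k
        ((update (update b k (a.eval w env)) l (c.eval w env) k).drop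
          (update (update b k (a.eval w env)) l (c.eval w env) l).length) =
        update b k ((a.eval w env).drop (c.eval w env).length) := by
      funext j
      rcases eq_or_ne j k with rfl | hj
      · simp [hkl]
      · rcases eq_or_ne j l with rfl | hj'
        · simp [hj, hbl.2]
        · simp [hj, hj']
    rw [e₃, update_self] at rs
    have la := length_eval_le w a env henv
    have lc := length_eval_le w c env henv
    have hbn : update b k [] = b := by
      rw [← hbk.2, update_eq_self]
    simp only [eval, cost, Polynomial.eval_add, Polynomial.eval_mul, Polynomial.eval_ofNat]
    split
    · next h =>
      obtain ⟨n₁, h₁, r₁⟩ := ih₁ U env o b hU₁ henv hx (by omega)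
        fun h hh => hb h (.inr (.inl hh))
      rw [List.drop_of_length_le h, hbn] at rs
      have rt : Exec (.ite (.neB k) (.seq (.loop (.neB k) (.op (.popB k))) (e₂.compile o))
          (e₁.compile o)) _ _ _ := .ite_false (by simp [Test.holds, hbk.2]) r₁
      exact ⟨_, by omega, ra.seq (rc.seq (rs.seq rt))⟩
    · next h =>
      obtain ⟨n₂, h₂, r₂⟩ := ih₂ U env o b hU₂ henv hx (by omega)
        fun h hh => hb h (.inr (.inr hh))
      have rp := exec_clearB (k := k) (heads w env)
        (update b k ((a.eval w env).drop (c.eval w env).length))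
      rw [update_idem, hbn, update_self] at rp
      have rt : Exec (.ite (.neB k) (.seq (.loop (.neB k) (.op (.popB k))) (e₂.compile o))
          (e₁.compile o)) _ _ _ := .ite_true (by
            simp only [Test.holds, update_self, List.head?_drop]
            rw [List.getElem?_eq_getElem (by omega)]
            rfl) (rp.seq r₂)
      refine ⟨_, ?_, ra.seq (rc.seq (rs.seq rt))⟩
      rw [List.length_drop]
      omega
  | loop x e ih =>
    have hxU : env x = w.length := hx x hU.1
    obtain ⟨n, hn, r⟩ := exec_loop (w := w) (env := env) (x := x) (o := o) (p := e.compile o)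
      (g := fun i => e.eval w (update env x i)) (T := e.cost.eval w.length) b
      (fun i hi l => by
        have := ih (x :: U) (update env x i) o (update b o l) hU.2
          (fun y => by
            rcases eq_or_ne y x with rfl | h
            · simpa using hi.le
            · simpa [h] using henv y)
          (fun y hy => by
            rw [List.mem_cons, not_or] at hy
            rw [update_of_ne hy.1, hx y hy.2])
          hH (fun h hh c => ⟨(hb h hh c).1, by rw [update_of_ne (hb h hh c).1, (hb h hh c).2]⟩)
        simpa using this) w.length le_rfl (b o)
    rw [← hxU, update_eq_self, update_eq_self, hxU] at r
    refine ⟨_, ?_, r.seq (exec_rewind w env x hxU _)⟩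
    simp only [cost, Polynomial.eval_add, Polynomial.eval_mul, Polynomial.eval_X,
      Polynomial.eval_ofNat]
    simp only [mul_add] at hn ⊢
    omega

/-! #### The complete program -/

/-- The contents of the stacks after the stacks for the variables in `l` have been cleared. -/
def clearStk (l : List V) (a : KA V → List A) : KA V → List A
  | .inl k => a (.inl k)
  | .inr (true, x) => if x ∈ l then [] else a (left x)
  | .inr (false, x) => a (right x)

/-- A halting configuration must have all stacks empty except the output; the copies of the input
remain to be removed. -/
theorem exec_clear {KB : Type} [DecidableEq KB] (l : List V) (b : KB → List B)
    (a : KA V → List A) (n : ℕ) (ha : ∀ x, (a (left x)).length ≤ n) :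
    ∃ m ≤ l.length * (2 * n + 1) + 1,
      Exec (l.foldr (fun x p => .seq (.loop (.topA (left x) fun _ => true)
        (.op (.moveA (left x) []))) p) (.op .skip)) ⟨a, b⟩ m ⟨clearStk l a, b⟩ := by
  induction l generalizing a with
  | nil =>
    have e : clearStk [] a = a := by
      funext k
      rcases k with _ | ⟨_ | _, y⟩ <;> simp [clearStk]
    refine ⟨1, by simp, ?_⟩
    rw [e]
    exact .op .skip _
  | cons x l ih =>
    obtain ⟨m, hm, r⟩ := ih (update a (left x) []) fun y => by
      rcases eq_or_ne y x with rfl | h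
      · simp
      · simpa [h] using ha y
    refine ⟨2 * (a (left x)).length + 1 + m, ?_, ?_⟩
    · have := ha x
      rw [List.length_cons, add_one_mul]
      omega
    · refine ((exec_clearA (k := left x) b a).seq r).congr rfl ?_
      congr 1
      funext k
      rcases k with _ | ⟨_ | _, y⟩
      · simp [clearStk]
      · simp [clearStk]
      · rcases eq_or_ne y x with rfl | h
        · simp [clearStk]
        · simp [clearStk, h]

section Full

variable [Fintype V]

/-- Copy the input to the stacks for the variables, run the compiled expression, and clear the
stacks for the variables. -/
noncomputable def program {H : ℕ} [NeZero H] (e : LoopExpr V A B) : Prog (KA V) (KB H) A B :=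
  .seq (.loop (ne inp) (.op (.moveA inp (Finset.univ.toList.map left)))) <|
    .seq (e.compile none) <|
      Finset.univ.toList.foldr (fun x p => .seq (.loop (ne (left x)) (.op (.moveA (left x) []))) p)
        (.op .skip)

/-- The contents of the stacks when the rest of the input is `w` and the part `v` (in reverse) has
been copied. -/
def loadStk (w v : List A) : KA V → List A
  | .inl true => w
  | .inl false => []
  | .inr (true, _) => v
  | .inr (false, _) => []

/-- Popping the input from the front leaves its reversal on all left stacks, which places every
variable at the end of the input. -/
theorem exec_init {KB : Type} [DecidableEq KB] (w v : List A) (b : KB → List B) :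
    Exec (.loop (.topA inp fun _ => true) (.op (.moveA inp (Finset.univ.toList.map left))))
      (⟨loadStk w v, b⟩ : Store (KA V) KB A B) (2 * w.length + 1)
      ⟨loadStk [] (w.reverse ++ v), b⟩ := by
  induction w generalizing v with
  | nil => exact .loop_false rfl
  | cons a w ih =>
    have h₁ := Exec.op (B := B) (.moveA inp (Finset.univ.toList.map left))
      (⟨loadStk (a :: w) v, b⟩ : Store (KA V) KB A B)
    have e₁ : Op.act (⟨loadStk (a :: w) v, b⟩ : Store (KA V) KB A B)
        (.moveA inp (Finset.univ.toList.map left)) = ⟨loadStk w (a :: v), b⟩ := by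
      simp only [Op.act, loadStk]
      rw [pushAll_eq ((Finset.nodup_toList _).map fun x y h => by simpa using h)]
      congr 1
      funext k
      rcases k with (_ | _) | ⟨_ | _, y⟩ <;> simp [loadStk]
    rw [e₁] at h₁
    refine (Exec.loop_true (t := .topA inp fun _ => true) rfl h₁ (ih (a :: v))).congr ?_ ?_
    · rw [List.length_cons]; omega
    · simp

/-- The value of an expression is computed in polynomial time. -/
theorem isPolyTime {α β : Type} [Fintype α] (e : LoopExpr V (Option α) (Option β))
    (he : e.Scoped []) (f : List α × ℕ → List β × ℕ)
    (hf : ∀ p, encodeParamInstance (f p) =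
      e.eval (encodeParamInstance p) fun _ => (encodeParamInstance p).length) : IsPolyTime f := by
  let H := e.height + 1
  refine ⟨⟨⟨(e.program (H := H)).machine inp none, Equiv.refl _, Equiv.refl _⟩,
    (2 * .X + 1) + (e.cost + (.C (Fintype.card V) * (2 * .X + 1) + 1)) + 1,
    fun p => Classical.choice ?_⟩⟩
  set w := encodeParamInstance p with hw
  have r₁ := exec_init (V := V) (KB := KB H) (B := Option β) w [] fun _ => []
  obtain ⟨n₂, h₂, r₂⟩ := exec_compile (H := H) w e [] (fun _ => w.length) none (fun _ => []) he
    (fun _ => le_rfl) (fun _ _ => rfl) (by omega) (fun h hh c => ⟨by simp [scratch], rfl⟩)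
  obtain ⟨n₃, h₃, r₃⟩ := exec_clear (KB := KB H) (Finset.univ : Finset V).toList
    (update (fun _ => []) none (e.eval w (fun _ => w.length) ++ []))
    (heads w fun _ => w.length) w.length fun x => by simp [heads]
  have e₁ : loadStk [] (w.reverse ++ []) = heads w (fun _ : V => w.length) := by
    funext k
    rcases k with (_ | _) | ⟨_ | _, y⟩ <;> simp [heads, loadStk]
  have e₂ : (loadStk w [] : KA V → List (Option α)) = update (fun _ => []) inp w := by
    funext k
    rcases k with (_ | _) | ⟨_ | _, y⟩ <;> simp [loadStk]
  have e₃ : clearStk Finset.univ.toList (heads w (fun _ : V => w.length)) = fun _ => [] := by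
    funext k
    rcases k with (_ | _) | ⟨_ | _, y⟩ <;> simp [clearStk, heads]
  rw [e₁, e₂] at r₁
  rw [e₃] at r₃
  have r := r₁.seq (r₂.seq r₃)
  rw [List.append_nil, ← hf p] at r
  have key : ∀ x y, x = w → y = encodeParamInstance (f p) →
      Runs ((e.program (H := H)).machine inp none).step (2 * w.length + 1 + (n₂ + n₃) + 1)
        (initList ((e.program (H := H)).machine inp none) x)
        (haltList ((e.program (H := H)).machine inp none) y) := by
    rintro _ _ rfl rfl
    exact Exec.runs_machine r
  refine ⟨⟨⟨2 * w.length + 1 + (n₂ + n₃) + 1, ?_⟩, ?_⟩⟩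
  · exact Runs.iff_iterate.1 (key _ _ (List.map_id w) (List.map_id _))
  · rw [Finset.length_toList, Finset.card_univ] at h₃
    simp only [Polynomial.eval_add, Polynomial.eval_mul, Polynomial.eval_X, Polynomial.eval_ofNat,
      Polynomial.eval_one, Polynomial.eval_C]
    omega

end Full

end LoopExpr

/-! ### Stable cutsets and linear forests -/

theorem reachable_invariant {V : Type} {G : SimpleGraph V} {c : V → Prop}
    (hc : ∀ u v, G.Adj u v → c u → c v) {u v : V} (h : G.Reachable u v) (hu : c u) : c v := by
  obtain ⟨p⟩ := h
  induction p with
  | nil => exact hu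
  | cons h _ ih => exact ih (hc _ _ h hu)

/-- A stable cutset is a stable set whose complement has a nonconstant 2-colouring that is constant
on edges. -/
theorem isStableCutset_iff {V : Type} {G : SimpleGraph V} {S : Set V} :
    IsStableCutset G S ↔ (∀ u v, G.Adj u v → ¬ (u ∈ S ∧ v ∈ S)) ∧
      ∃ c : V → Prop, (∀ u v, G.Adj u v → u ∉ S → v ∉ S → (c u ↔ c v)) ∧
        (∃ u, u ∉ S ∧ c u) ∧ ∃ v, v ∉ S ∧ ¬ c v := by
  unfold IsStableCutset
  refine and_congr ?_ ?_
  · constructor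
    · exact fun h u v huv ⟨hu, hv⟩ => h hu hv huv.ne huv
    · exact fun h u hu v hv _ huv => h u v huv ⟨hu, hv⟩
  · constructor
    · intro h
      simp only [SimpleGraph.Preconnected, not_forall] at h
      obtain ⟨⟨x, hx⟩, ⟨y, hy⟩, hxy⟩ := h
      refine ⟨fun v => ∃ hv : v ∈ Sᶜ, (G.induce Sᶜ).Reachable ⟨x, hx⟩ ⟨v, hv⟩,
        fun u v huv hu hv => ?_, ⟨x, hx, hx, .refl _⟩, ⟨y, hy, fun ⟨_, h⟩ => hxy h⟩⟩
      have key : ∀ u v, G.Adj u v → u ∉ S → v ∉ S →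
          (∃ hv : u ∈ Sᶜ, (G.induce Sᶜ).Reachable ⟨x, hx⟩ ⟨u, hv⟩) →
          ∃ hv : v ∈ Sᶜ, (G.induce Sᶜ).Reachable ⟨x, hx⟩ ⟨v, hv⟩ :=
        fun u v huv hu hv ⟨hu', h⟩ => ⟨hv, h.trans (SimpleGraph.Adj.reachable
          (show (G.induce Sᶜ).Adj ⟨u, hu'⟩ ⟨v, hv⟩ from huv))⟩
      exact ⟨key u v huv hu hv, key v u huv.symm hv hu⟩
    · rintro ⟨c, hc, ⟨u, hu, hcu⟩, v, hv, hcv⟩ h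
      exact hcv (reachable_invariant (c := fun x : (Sᶜ : Set V) => c x)
        (fun x y hxy hx => (hc x y hxy x.2 y.2).1 hx) (h ⟨u, hu⟩ ⟨v, hv⟩) hcu)

/-- The graph embeds into the two paths formed by the even and the odd numbers. If an edge from `f
v` to `f v + 2` is deleted, the vertices with the parity of `f v` and value at most `f v` are closed
under adjacency, so every edge is a bridge. The neighbours of `v` lie at `f v + 2` and `f v - 2`. -/
theorem isLinearForest_of_injective {V : Type} {G : SimpleGraph V} (f : V → ℕ)
    (hf : Function.Injective f) (hG : ∀ u v, G.Adj u v → f v = f u + 2 ∨ f u = f v + 2) :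
    IsLinearForest G := by
  refine ⟨SimpleGraph.isAcyclic_iff_forall_adj_isBridge.2 fun v w hvw => ?_, fun v => ?_⟩
  · wlog h : f w = f v + 2 generalizing v w
    · rw [Sym2.eq_swap]
      exact this w v hvw.symm ((hG v w hvw).resolve_left h)
    rw [SimpleGraph.isBridge_iff]
    intro hr
    have := reachable_invariant (c := fun x => f x % 2 = f v % 2 ∧ f x ≤ f v) ?_ hr ⟨rfl, le_rfl⟩
    · omega
    · rintro x y hxy ⟨h₁, h₂⟩
      rw [SimpleGraph.deleteEdges_adj] at hxy
      by_contra hy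
      rcases hG x y hxy.1 with h' | h'
      · have hx : f x = f v := by omega
        have hx' := hf hx
        have hy' : y = w := hf (by omega)
        exact hxy.2 (by simp [hx', hy'])
      · omega
  · rw [← (hf.injOn (s := G.neighborSet v)).encard_image]
    refine (Set.encard_le_encard (t := {f v + 2, f v - 2}) ?_).trans ?_
    · rintro _ ⟨w, hw, rfl⟩
      rcases hG v w hw with h | h
      · exact .inl h
      · exact .inr (by simp; omega)
    · exact (Set.encard_insert_le _ _).trans (by norm_num)

/-! ### The graph of a family of sets -/

namespace Gadget

/-- The vertices that belong to position `p` are `node p 0`, …, `node p 3`. -/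
def node (p c : ℕ) : ℕ := 4 * p + 5 + c

/-- The edges at position `p` on one of the two paths (`i = 0, 1`) through it. -/
def pathEdges (n : ℕ) (bit : ℕ → Bool) (p i : ℕ) : List (ℕ × ℕ) :=
  [(node p (2 * i), node p (2 * i + 1)), (node p (2 * i + 1), 4)] ++
  (if bit p = true then [(node p (2 * i), node (p % (n + 1)) i),
    (node p (2 * i + 1), node (p % (n + 1)) i)] else [(node p (2 * i), 4)]) ++
  (if p % (n + 1) = 0 then [(node p (2 * i), 2 - 2 * i), (node p (2 * i), 3 - 2 * i)]
    else [(node (p - 1) (2 * i + 1), node p (2 * i))]) ++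
  (if p % (n + 1) = n then [(node p (2 * i + 1), 2 * i), (node p (2 * i + 1), 2 * i + 1)] else [])

/-- The edges at position `p`. The positions `p < n` represent the elements of the ground set,
the positions `p > n` the sets of the family. -/
def nodeEdges (n : ℕ) (bit : ℕ → Bool) (p : ℕ) : List (ℕ × ℕ) :=
  if p < n then [(node p 0, 0), (node p 0, 1), (node p 1, 2), (node p 1, 3), (node p 0, node p 1),
    (node p 2, 0), (node p 2, 1), (node p 3, 0), (node p 3, 1)]
  else if p = n then [(node p 0, 0), (node p 0, 1), (node p 1, 0), (node p 1, 1),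
    (node p 2, 0), (node p 2, 1), (node p 3, 0), (node p 3, 1)]
  else pathEdges n bit p 0 ++ pathEdges n bit p 1

def edgeList (n P : ℕ) (bit : ℕ → Bool) : List (ℕ × ℕ) :=
  [(0, 1), (2, 3), (4, 0), (4, 1), (4, 2), (4, 3)] ++ (List.range P).flatMap (nodeEdges n bit)

/-- The condition of a stable cutset `S` with colouring `c` of its complement, for the edge
`u v`. -/
def Ok (S c : ℕ → Prop) (u v : ℕ) : Prop := ¬ (S u ∧ S v) ∧ (¬ S u → ¬ S v → (c u ↔ c v))

def Good (n P : ℕ) (bit : ℕ → Bool) (S c : ℕ → Prop) : Prop :=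
  ∀ e ∈ edgeList n P bit, Ok S c e.1 e.2

/-- The set `T` of elements splits all sets of the family. -/
def Splits (n P : ℕ) (bit : ℕ → Bool) (T : ℕ → Prop) : Prop :=
  ∀ p < P, n < p → p % (n + 1) = n →
    (∃ q ≤ p, q / (n + 1) = p / (n + 1) ∧ bit q = true ∧ T (q % (n + 1))) ∧
    ∃ q ≤ p, q / (n + 1) = p / (n + 1) ∧ bit q = true ∧ ¬ T (q % (n + 1))

variable {n P : ℕ} {bit : ℕ → Bool} {S c : ℕ → Prop}

/-! ### The edge conditions, position by position -/

theorem forall_mem_ite {α : Type} {a : Prop} [Decidable a] {l₁ l₂ : List α} {q : α → Prop} :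
    (∀ e ∈ if a then l₁ else l₂, q e) ↔ (a → ∀ e ∈ l₁, q e) ∧ (¬ a → ∀ e ∈ l₂, q e) := by
  split_ifs with h <;> simp [h]

theorem forall_pathEdges {R : ℕ → ℕ → Prop} {p i : ℕ} :
    (∀ e ∈ pathEdges n bit p i, R e.1 e.2) ↔
    R (node p (2 * i)) (node p (2 * i + 1)) ∧ R (node p (2 * i + 1)) 4 ∧
    (bit p = true → R (node p (2 * i)) (node (p % (n + 1)) i) ∧
      R (node p (2 * i + 1)) (node (p % (n + 1)) i)) ∧
    (bit p = false → R (node p (2 * i)) 4) ∧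
    (p % (n + 1) = 0 → R (node p (2 * i)) (2 - 2 * i) ∧ R (node p (2 * i)) (3 - 2 * i)) ∧
    (p % (n + 1) ≠ 0 → R (node (p - 1) (2 * i + 1)) (node p (2 * i))) ∧
    (p % (n + 1) = n → R (node p (2 * i + 1)) (2 * i) ∧ R (node p (2 * i + 1)) (2 * i + 1)) := by
  have hb : bit p = false ↔ ¬ bit p = true := by simp
  simp only [pathEdges, List.forall_mem_append, forall_mem_ite, List.forall_mem_cons, hb, ne_eq,
    List.not_mem_nil, IsEmpty.forall_iff, implies_true, and_true, and_assoc]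

theorem forall_nodeEdges {R : ℕ → ℕ → Prop} {p : ℕ} :
    (∀ e ∈ nodeEdges n bit p, R e.1 e.2) ↔
    (p < n → (R (node p 0) 0 ∧ R (node p 0) 1) ∧ (R (node p 1) 2 ∧ R (node p 1) 3) ∧
      R (node p 0) (node p 1) ∧ (R (node p 2) 0 ∧ R (node p 2) 1) ∧
      R (node p 3) 0 ∧ R (node p 3) 1) ∧
    (p = n → ∀ i < 4, R (node p i) 0 ∧ R (node p i) 1) ∧
    (n < p → ∀ i < 2, ∀ e ∈ pathEdges n bit p i, R e.1 e.2) := by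
  rw [nodeEdges]
  rcases lt_trichotomy p n with h | h | h
  · rw [if_pos h]
    simp [h, h.ne, h.not_gt, and_assoc]
  · rw [if_neg h.not_lt, if_pos h]
    simp only [h, lt_irrefl, IsEmpty.forall_iff, true_and, and_true, forall_const]
    constructor
    · intro h i hi
      simp only [List.forall_mem_cons] at h
      interval_cases i <;> simp [h]
    · intro h
      have h0 := h 0 (by norm_num)
      have h1 := h 1 (by norm_num)
      have h2 := h 2 (by norm_num)
      have h3 := h 3 (by norm_num)
      simp [h0, h1, h2, h3]
  · rw [if_neg h.not_gt, if_neg h.ne', List.forall_mem_append]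
    simp only [h, h.ne', h.not_gt, IsEmpty.forall_iff, true_and, forall_const]
    constructor
    · rintro ⟨h0, h1⟩ i hi
      interval_cases i
      exacts [h0, h1]
    · exact fun h => ⟨h 0 (by norm_num), h 1 (by norm_num)⟩

theorem forall_edgeList {R : ℕ → ℕ → Prop} : (∀ e ∈ edgeList n P bit, R e.1 e.2) ↔
    (R 0 1 ∧ R 2 3 ∧ R 4 0 ∧ R 4 1 ∧ R 4 2 ∧ R 4 3) ∧
      ∀ p < P, ∀ e ∈ nodeEdges n bit p, R e.1 e.2 := by
  simp only [edgeList, List.forall_mem_append, List.mem_flatMap, List.mem_range]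
  refine and_congr (by simp) ⟨fun h p hp e he => h e ⟨p, hp, he⟩, fun h e ⟨p, hp, he⟩ => h p hp e he⟩

theorem node_cases {x : ℕ} (hx : x < 4 * P + 5) :
    x < 5 ∨ ∃ p < P, x = node p 0 ∨ x = node p 1 ∨ x = node p 2 ∨ x = node p 3 := by
  rcases lt_or_ge x 5 with h | h
  · exact .inl h
  · refine .inr ⟨(x - 5) / 4, ?_, ?_⟩
    · omega
    · simp only [node]; omega

/-! ### From a stable cutset to a splitting set -/

theorem Good.atPos (h : Good n P bit S c) {p : ℕ} (hp : p < P) :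
    (p < n → (Ok S c (node p 0) 0 ∧ Ok S c (node p 0) 1) ∧ (Ok S c (node p 1) 2 ∧
      Ok S c (node p 1) 3) ∧ Ok S c (node p 0) (node p 1) ∧
      (Ok S c (node p 2) 0 ∧ Ok S c (node p 2) 1) ∧ Ok S c (node p 3) 0 ∧ Ok S c (node p 3) 1) ∧
    (p = n → ∀ i < 4, Ok S c (node p i) 0 ∧ Ok S c (node p i) 1) ∧
    (n < p → ∀ i < 2, ∀ e ∈ pathEdges n bit p i, Ok S c e.1 e.2) :=
  forall_nodeEdges.1 ((forall_edgeList.1 h).2 p hp)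

/-- A stable set contains at most one end of the edge `k`, `k + 1`; through the other end the colour
passes from `x` to `4`. -/
theorem Ok.trans_clique {k x : ℕ} (h : Ok S c k (k + 1)) (h₀ : Ok S c 4 k) (h₁ : Ok S c 4 (k + 1))
    (hx₀ : Ok S c x k) (hx₁ : Ok S c x (k + 1)) (h4 : ¬ S 4) (hx : ¬ S x) : c x ↔ c 4 := by
  unfold Ok at *
  grind

/-- The special vertex belongs to every stable cutset. -/
theorem Good.special (h : Good n P bit S c) (hbit : ∀ p, bit p = true → p % (n + 1) < n)
    {x y : ℕ} (hx : x < 4 * P + 5) (hy : y < 4 * P + 5) (hSx : ¬ S x) (hSy : ¬ S y)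
    (hcx : c x) (hcy : ¬ c y) : S 4 := by
  by_contra h4
  obtain ⟨⟨b1, b2, b3, b4, b5, b6⟩, -⟩ := forall_edgeList.1 h
  have cl0 : ∀ x, Ok S c x 0 ∧ Ok S c x 1 → ¬ S x → (c x ↔ c 4) := fun x hx =>
    b1.trans_clique b3 b4 hx.1 hx.2 h4
  have cl1 : ∀ x, Ok S c x 2 ∧ Ok S c x 3 → ¬ S x → (c x ↔ c 4) := fun x hx =>
    b2.trans_clique b5 b6 hx.1 hx.2 h4
  have path : ∀ p < P, n < p → ∀ i < 2, (¬ S (node p (2 * i)) → (c (node p (2 * i)) ↔ c 4)) ∧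
      (¬ S (node p (2 * i + 1)) → (c (node p (2 * i + 1)) ↔ c 4)) := by
    intro p hp hnp i hi
    obtain ⟨e1, e2, e3, e4, -⟩ := forall_pathEdges.1 ((h.atPos hp).2.2 hnp i hi)
    cases hb : bit p
    · have e4 := e4 hb
      unfold Ok at e2 e4
      grind
    -- The second path vertex and the element vertex are adjacent, so one of them is outside `S`,
    -- and then it has the colour of `4`. The first path vertex is adjacent to both.
    · have e3 := e3 hb
      have hq := hbit p hb
      have hu : ¬ S (node (p % (n + 1)) i) → (c (node (p % (n + 1)) i) ↔ c 4) := by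
        obtain ⟨f0, f1, -⟩ := (h.atPos (by omega : p % (n + 1) < P)).1 hq
        interval_cases i
        · exact cl0 _ f0
        · exact cl1 _ f1
      unfold Ok at e1 e2 e3
      grind
  have all : ∀ x < 4 * P + 5, ¬ S x → (c x ↔ c 4) := by
    intro x hx hSx
    rcases node_cases hx with h5 | ⟨p, hp, hc⟩
    · unfold Ok at b3 b4 b5 b6
      interval_cases x <;> grind
    · rcases lt_trichotomy p n with hpn | hpn | hpn
      · obtain ⟨f0, f1, -, f2, f3⟩ := (h.atPos hp).1 hpn
        rcases hc with rfl | rfl | rfl | rfl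
        exacts [cl0 _ f0 hSx, cl1 _ f1 hSx, cl0 _ f2 hSx, cl0 _ f3 hSx]
      · have f := (h.atPos hp).2.1 hpn
        rcases hc with rfl | rfl | rfl | rfl
        all_goals exact cl0 _ (f _ (by norm_num)) hSx
      · have f0 := path p hp hpn 0 (by norm_num)
        have f1 := path p hp hpn 1 (by norm_num)
        rcases hc with rfl | rfl | rfl | rfl
        exacts [f0.1 hSx, f0.2 hSx, f1.1 hSx, f1.2 hSx]
  exact hcy ((all y hy hSy).2 ((all x hx hSx).1 hcx))

/-- The two cliques get different colours. -/
theorem Good.not_iff (h : Good n P bit S c) (hbit : ∀ p, bit p = true → p % (n + 1) < n)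
    (h4 : S 4) {x y : ℕ} (hx : x < 4 * P + 5) (hy : y < 4 * P + 5) (hSx : ¬ S x)
    (hSy : ¬ S y) (hcx : c x) (hcy : ¬ c y) : ¬ (c 0 ↔ c 2) := by
  intro h02
  obtain ⟨⟨b1, b2, b3, b4, b5, b6⟩, -⟩ := forall_edgeList.1 h
  have cl0 : ∀ x, Ok S c x 0 ∧ Ok S c x 1 → ¬ S x → (c x ↔ c 0) := fun x hx => by
    unfold Ok at *; grind
  have cl1 : ∀ x, Ok S c x 2 ∧ Ok S c x 3 → ¬ S x → (c x ↔ c 0) := fun x hx => by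
    unfold Ok at *; grind
  -- The colour travels along the path, starting afresh from a clique in each block. The second
  -- vertex at a position is never in `S`, being adjacent to `4`. If the first one is in `S`, the
  -- bit is set, the element vertex is outside `S`, and it hands its colour to the second vertex.
  have path : ∀ p, p < P → n < p → ∀ i < 2, (¬ S (node p (2 * i)) → (c (node p (2 * i)) ↔ c 0)) ∧
      ¬ S (node p (2 * i + 1)) ∧ (c (node p (2 * i + 1)) ↔ c 0) := by
    intro p
    induction p with
    | zero => intro _ h; omega
    | succ p ih =>
      intro hp hnp i hi
      obtain ⟨e1, e2, e3, e4, e5, e6, -⟩ := forall_pathEdges.1 ((h.atPos hp).2.2 hnp i hi)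
      have hw : ¬ S (node (p + 1) (2 * i + 1)) := fun hw => e2.1 ⟨hw, h4⟩
      have hv : ¬ S (node (p + 1) (2 * i)) → (c (node (p + 1) (2 * i)) ↔ c 0) := by
        intro hv
        by_cases hq : (p + 1) % (n + 1) = 0
        · interval_cases i
          · exact cl1 _ (e5 hq) hv
          · exact cl0 _ (e5 hq) hv
        · have hpn : n < p := by
            rcases eq_or_ne p n with rfl | hne
            · simp at hq
            · omega
          have := ih (by omega) hpn i hi
          have e6 := e6 hq
          rw [Nat.add_sub_cancel] at e6
          rw [← e6.2 this.2.1 hv, this.2.2]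
      refine ⟨hv, hw, ?_⟩
      by_cases hSv : S (node (p + 1) (2 * i))
      · cases hb : bit (p + 1)
        · exact absurd ⟨hSv, h4⟩ (e4 hb).1
        · have e3 := e3 hb
          have hq := hbit _ hb
          have hu : ¬ S (node ((p + 1) % (n + 1)) i) → (c (node ((p + 1) % (n + 1)) i) ↔ c 0) := by
            obtain ⟨f0, f1, -⟩ := (h.atPos (by omega : (p + 1) % (n + 1) < P)).1 hq
            interval_cases i
            · exact cl0 _ f0
            · exact cl1 _ f1
          unfold Ok at e3
          grind
      · rw [← hv hSv, e1.2 hSv hw]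
  have all : ∀ x < 4 * P + 5, ¬ S x → (c x ↔ c 0) := by
    intro x hx hSx
    rcases node_cases hx with h5 | ⟨p, hp, hc⟩
    · unfold Ok at b1 b2 b3 b4 b5 b6
      interval_cases x <;> grind
    · rcases lt_trichotomy p n with hpn | hpn | hpn
      · obtain ⟨f0, f1, -, f2, f3⟩ := (h.atPos hp).1 hpn
        rcases hc with rfl | rfl | rfl | rfl
        exacts [cl0 _ f0 hSx, cl1 _ f1 hSx, cl0 _ f2 hSx, cl0 _ f3 hSx]
      · have f := (h.atPos hp).2.1 hpn
        rcases hc with rfl | rfl | rfl | rfl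
        all_goals exact cl0 _ (f _ (by norm_num)) hSx
      · have f0 := path p hp hpn 0 (by norm_num)
        have f1 := path p hp hpn 1 (by norm_num)
        rcases hc with rfl | rfl | rfl | rfl
        exacts [f0.1 hSx, f0.2.2, f1.1 hSx, f1.2.2]
  exact hcy ((all y hy hSy).2 ((all x hx hSx).1 hcx))

/-- On each path some element vertex is not in the stable cutset. -/
theorem Good.exists_not_mem (h : Good n P bit S c) (h4 : S 4) (h02 : ¬ (c 0 ↔ c 2)) {p : ℕ}
    (hp : p < P) (hnp : n < p) (hpn : p % (n + 1) = n) {i : ℕ} (hi : i < 2) :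
    ∃ q ≤ p, q / (n + 1) = p / (n + 1) ∧ bit q = true ∧ ¬ S (node (q % (n + 1)) i) := by
  by_contra! hno
  obtain ⟨⟨b1, b2, b3, b4, b5, b6⟩, -⟩ := forall_edgeList.1 h
  obtain ⟨j, hj⟩ : ∃ j, p = (n + 1) * j + n := ⟨p / (n + 1), by
    conv_lhs => rw [← Nat.div_add_mod p (n + 1), hpn]⟩
  have hdiv : ∀ t ≤ n, ((n + 1) * j + t) / (n + 1) = j := fun t ht => by
    rw [Nat.mul_add_div (by omega), Nat.div_eq_of_lt (by omega), add_zero]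
  have hmod : ∀ t ≤ n, ((n + 1) * j + t) % (n + 1) = t := fun t ht => by
    rw [Nat.mul_add_mod, Nat.mod_eq_of_lt (by omega)]
  have hj0 : 1 ≤ j := by
    rcases Nat.eq_zero_or_pos j with rfl | h
    · simp at hj; omega
    · exact h
  have hjn : n + 1 ≤ (n + 1) * j := Nat.le_mul_of_pos_right _ hj0
  -- If all element vertices met by the path are in `S`, no path vertex is, and the colour of the
  -- initial clique (represented by `2 - 2 * i`) is carried to the end, where the last vertex
  -- touches the other clique.
  have main : ∀ t ≤ n, ¬ S (node ((n + 1) * j + t) (2 * i + 1)) ∧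
      (c (node ((n + 1) * j + t) (2 * i + 1)) ↔ c (2 - 2 * i)) := by
    intro t
    induction t with
    | zero =>
      intro ht
      obtain ⟨e1, e2, e3, e4, e5, -⟩ :=
        forall_pathEdges.1 ((h.atPos (by omega)).2.2 (by omega : n < (n + 1) * j + 0) i hi)
      have e5 := e5 (hmod 0 ht)
      have hv : ¬ S (node ((n + 1) * j + 0) (2 * i)) := by
        intro hv
        cases hb : bit ((n + 1) * j + 0)
        · exact (e4 hb).1 ⟨hv, h4⟩
        · exact (e3 hb).1.1 ⟨hv, hno _ (by omega) (by rw [hdiv 0 ht, hj, hdiv n le_rfl]) hb⟩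
      have hw : ¬ S (node ((n + 1) * j + 0) (2 * i + 1)) := fun hw => e2.1 ⟨hw, h4⟩
      refine ⟨hw, ?_⟩
      rw [← e1.2 hv hw]
      refine e5.1.2 hv ?_
      interval_cases i
      · exact fun h => b5.1 ⟨h4, h⟩
      · exact fun h => b3.1 ⟨h4, h⟩
    | succ t ih =>
      intro ht
      obtain ⟨ihw, ihc⟩ := ih (by omega)
      obtain ⟨e1, e2, e3, e4, -, e6, -⟩ :=
        forall_pathEdges.1 ((h.atPos (by omega)).2.2 (by omega : n < (n + 1) * j + (t + 1)) i hi)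
      have e6 := e6 (by rw [hmod _ ht]; omega)
      have hv : ¬ S (node ((n + 1) * j + (t + 1)) (2 * i)) := by
        intro hv
        cases hb : bit ((n + 1) * j + (t + 1))
        · exact (e4 hb).1 ⟨hv, h4⟩
        · exact (e3 hb).1.1 ⟨hv, hno _ (by omega) (by rw [hdiv _ ht, hj, hdiv n le_rfl]) hb⟩
      have hw : ¬ S (node ((n + 1) * j + (t + 1)) (2 * i + 1)) := fun hw => e2.1 ⟨hw, h4⟩
      refine ⟨hw, ?_⟩
      rw [← e1.2 hv hw, ← ihc]
      exact (e6.2 ihw hv).symm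
  obtain ⟨hw, hc⟩ := main n le_rfl
  rw [← hj] at hw hc
  obtain ⟨-, -, -, -, -, -, e7⟩ := forall_pathEdges.1 ((h.atPos hp).2.2 hnp i hi)
  have e7 := e7 hpn
  unfold Ok at b3 b5 e7
  interval_cases i
  · exact h02 ((e7.1.2 hw fun h => b3.1 ⟨h4, h⟩).symm.trans hc)
  · exact h02 (hc.symm.trans (e7.1.2 hw fun h => b5.1 ⟨h4, h⟩))

/-- Path 0 supplies a member whose vertex `node q 0` is outside `S`. Path 1 supplies one whose
vertex `node q 1` is outside `S`; then `node q 0` is in `S`, as otherwise the edge between the two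
would link the cliques. -/
theorem Good.splits (h : Good n P bit S c) (hbit : ∀ p, bit p = true → p % (n + 1) < n)
    {x y : ℕ} (hx : x < 4 * P + 5) (hy : y < 4 * P + 5) (hSx : ¬ S x) (hSy : ¬ S y)
    (hcx : c x) (hcy : ¬ c y) : Splits n P bit fun q => S (node q 0) := by
  have h4 := h.special hbit hx hy hSx hSy hcx hcy
  have h02 := h.not_iff hbit h4 hx hy hSx hSy hcx hcy
  obtain ⟨⟨b1, b2, b3, b4, b5, b6⟩, -⟩ := forall_edgeList.1 h
  intro p hp hnp hpn
  refine ⟨?_, h.exists_not_mem h4 h02 hp hnp hpn (by norm_num)⟩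
  obtain ⟨q, hq, hqp, hb, hS⟩ := h.exists_not_mem h4 h02 hp hnp hpn (by norm_num : 1 < 2)
  refine ⟨q, hq, hqp, hb, ?_⟩
  have hqn := hbit q hb
  obtain ⟨f0, f1, f, -⟩ := (h.atPos (by omega : q % (n + 1) < P)).1 hqn
  by_contra hS'
  refine h02 ?_
  rw [← f0.1.2 hS' fun h => b3.1 ⟨h4, h⟩, f.2 hS' hS, f1.1.2 hS fun h => b5.1 ⟨h4, h⟩]

variable {T : ℕ → Prop}

/-! #### From a splitting set to a stable cutset -/

/-- A property of vertices, given by `Q₀` for the special vertices and by `Q` for the others. -/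
def onNodes (Q₀ : ℕ → Prop) (Q : ℕ → ℕ → Prop) (x : ℕ) : Prop :=
  if x < 5 then Q₀ x else Q ((x - 5) / 4) ((x - 5) % 4)

theorem onNodes_of_lt {Q₀ : ℕ → Prop} {Q : ℕ → ℕ → Prop} {x : ℕ} (hx : x < 5) :
    onNodes Q₀ Q x ↔ Q₀ x := by simp [onNodes, hx]

theorem onNodes_node {Q₀ : ℕ → Prop} {Q : ℕ → ℕ → Prop} {p i : ℕ} (hi : i < 4) :
    onNodes Q₀ Q (node p i) ↔ Q p i := by
  have h₁ : (node p i - 5) / 4 = p := by simp only [node]; omega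
  have h₂ : (node p i - 5) % 4 = i := by simp only [node]; omega
  have h₃ : ¬ node p i < 5 := by simp only [node]; omega
  rw [onNodes, if_neg h₃, h₁, h₂]

/-- On path `i`, the switch is possible at an element `q`. -/
def allowed (T : ℕ → Prop) (i q : ℕ) : Prop := T q ↔ i = 1

/-- On path `i`, the switch is possible before position `p`. -/
def switchLT (n : ℕ) (bit : ℕ → Bool) (T : ℕ → Prop) (i p : ℕ) : Prop :=
  ∃ q < p, q / (n + 1) = p / (n + 1) ∧ bit q = true ∧ allowed T i (q % (n + 1))

/-- On path `i`, the switch is possible before or at position `p`. -/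
def switchLE (n : ℕ) (bit : ℕ → Bool) (T : ℕ → Prop) (i p : ℕ) : Prop :=
  ∃ q ≤ p, q / (n + 1) = p / (n + 1) ∧ bit q = true ∧ allowed T i (q % (n + 1))

/-- The stable cutset. -/
def cut (n : ℕ) (bit : ℕ → Bool) (T : ℕ → Prop) : ℕ → Prop :=
  onNodes (· = 4) fun p i => if p < n then allowed T (1 - i) p ∧ i < 2 else
    n < p ∧ i % 2 = 0 ∧ switchLE n bit T (i / 2) p ∧ ¬ switchLT n bit T (i / 2) p

/-- The colouring of its complement. -/
def colour (n : ℕ) (bit : ℕ → Bool) (T : ℕ → Prop) : ℕ → Prop :=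
  onNodes (· < 2) fun p i => if p < n then i ≠ 1 else if p = n then True else
    ((if i % 2 = 0 then switchLT n bit T (i / 2) p else switchLE n bit T (i / 2) p) ↔ i < 2)

theorem switchLT.le {i p : ℕ} (h : switchLT n bit T i p) : switchLE n bit T i p :=
  let ⟨q, hq, h⟩ := h
  ⟨q, hq.le, h⟩

theorem switchLE.lt_or {i p : ℕ} (h : switchLE n bit T i p) :
    switchLT n bit T i p ∨ bit p = true ∧ allowed T i (p % (n + 1)) := by
  obtain ⟨q, hq, h₁, h₂, h₃⟩ := h
  rcases hq.lt_or_eq with h | rfl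
  · exact .inl ⟨q, h, h₁, h₂, h₃⟩
  · exact .inr ⟨h₂, h₃⟩

theorem not_switchLT {i p : ℕ} (hp : p % (n + 1) = 0) : ¬ switchLT n bit T i p := by
  rintro ⟨q, hq, h, -⟩
  have h₁ := Nat.div_add_mod p (n + 1)
  have h₂ := Nat.div_add_mod q (n + 1)
  rw [h] at h₂
  omega

/-- Unless `p` begins a block, `p - 1` lies in the same block. This makes the colours agree on the
edge between consecutive positions. -/
theorem switchLT_iff {i p : ℕ} (hp : p % (n + 1) ≠ 0) :
    switchLT n bit T i p ↔ switchLE n bit T i (p - 1) := by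
  have h : (p - 1) / (n + 1) = p / (n + 1) := by
    have h₁ := Nat.div_add_mod p (n + 1)
    have h₂ : p % (n + 1) < n + 1 := Nat.mod_lt p (Nat.succ_pos n)
    have h₃ : p - 1 = (n + 1) * (p / (n + 1)) + (p % (n + 1) - 1) := by omega
    rw [h₃, Nat.mul_add_div (by omega), Nat.div_eq_of_lt (a := p % (n + 1) - 1) (by omega), add_zero]
  have h0 : p ≠ 0 := by rintro rfl; simp at hp
  simp only [switchLT, switchLE, h]
  exact ⟨fun ⟨q, hq, h⟩ => ⟨q, by omega, h⟩, fun ⟨q, hq, h⟩ => ⟨q, by omega, h⟩⟩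

theorem cut_path {p i : ℕ} (hp : n < p) (hi : i < 2) : cut n bit T (node p (2 * i)) ↔
    switchLE n bit T i p ∧ ¬ switchLT n bit T i p := by
  rw [cut, onNodes_node (by omega), if_neg (by omega)]
  have h₁ : 2 * i % 2 = 0 := by omega
  have h₂ : 2 * i / 2 = i := by omega
  simp [h₁, h₂, hp]

theorem not_cut_path {p i : ℕ} (hp : n < p) (hi : i < 2) : ¬ cut n bit T (node p (2 * i + 1)) := by
  rw [cut, onNodes_node (by omega), if_neg (by omega)]
  omega

theorem colour_path {p i : ℕ} (hp : n < p) (hi : i < 2) : colour n bit T (node p (2 * i)) ↔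
    (switchLT n bit T i p ↔ i = 0) := by
  rw [colour, onNodes_node (by omega), if_neg (by omega), if_neg (by omega), if_pos (by omega)]
  have h₂ : 2 * i / 2 = i := by omega
  have h₃ : 2 * i < 2 ↔ i = 0 := by omega
  rw [h₂, h₃]

theorem colour_path' {p i : ℕ} (hp : n < p) (hi : i < 2) : colour n bit T (node p (2 * i + 1)) ↔
    (switchLE n bit T i p ↔ i = 0) := by
  rw [colour, onNodes_node (by omega), if_neg (by omega), if_neg (by omega), if_neg (by omega)]
  have h₂ : (2 * i + 1) / 2 = i := by omega
  have h₃ : 2 * i + 1 < 2 ↔ i = 0 := by omega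
  rw [h₂, h₃]

theorem cut_elem {q i : ℕ} (hq : q < n) (hi : i < 2) :
    cut n bit T (node q i) ↔ ¬ allowed T i q := by
  rw [cut, onNodes_node (by omega), if_pos hq]
  interval_cases i <;> simp [allowed]

theorem colour_elem {q i : ℕ} (hq : q < n) (hi : i < 4) :
    colour n bit T (node q i) ↔ i ≠ 1 := by
  rw [colour, onNodes_node hi, if_pos hq]

theorem cut_special {x : ℕ} (hx : x < 5) : cut n bit T x ↔ x = 4 := onNodes_of_lt hx

theorem colour_special {x : ℕ} (hx : x < 5) : colour n bit T x ↔ x < 2 := onNodes_of_lt hx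

/-- Each path is cut at the first position whose element vertex is not cut. Before it the path has
the colour of its initial clique, after it that of its final clique. An uncut element vertex on path
`i` is attached to the final clique of that path, so it agrees with all path vertices joined to it
that are not cut. -/
theorem good_cut (hbit : ∀ p, bit p = true → p % (n + 1) < n) (hT : Splits n P bit T) :
    Good n P bit (cut n bit T) (colour n bit T) := by
  refine forall_edgeList.2 ⟨?_, fun p hp => forall_nodeEdges.2 ⟨fun hpn => ?_, fun hpn i hi => ?_,
    fun hpn i hi => forall_pathEdges.2 ?_⟩⟩
  · simp [Ok, cut_special, colour_special]
  · have h2 : ∀ i, 2 ≤ i → i < 4 → ¬ cut n bit T (node p i) := fun i h h' => by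
      rw [cut, onNodes_node h', if_pos hpn]
      omega
    have h2' := h2 2 le_rfl (by norm_num)
    have h3' := h2 3 (by norm_num) (by norm_num)
    simp only [Ok, cut_special, colour_special, colour_elem hpn, h2', h3', Nat.reduceLT,
      cut_elem hpn]
    simp [allowed]
  · have h : ¬ cut n bit T (node p i) := by
      rw [cut, onNodes_node hi, if_neg (by omega)]
      omega
    have h' : colour n bit T (node p i) := by
      rw [colour, onNodes_node hi, if_neg (by omega), if_pos hpn]
      trivial
    simp [Ok, cut_special, colour_special, h, h']
  · have hv := cut_path (bit := bit) (T := T) hpn hi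
    have hw := not_cut_path (bit := bit) (T := T) hpn hi
    have cv := colour_path (bit := bit) (T := T) hpn hi
    have cw := colour_path' (bit := bit) (T := T) hpn hi
    have hle : switchLT n bit T i p → switchLE n bit T i p := switchLT.le
    have hlt : switchLE n bit T i p →
      switchLT n bit T i p ∨ bit p = true ∧ allowed T i (p % (n + 1)) := switchLE.lt_or
    have h4 : cut n bit T 4 := (cut_special (by norm_num)).2 rfl
    refine ⟨?_, ?_, fun hb => ?_, fun hb => ?_, fun h0 => ?_, fun h0 => ?_, fun h0 => ?_⟩
    · unfold Ok
      rw [hv, cv, cw]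
      grind
    · unfold Ok
      grind
    · have hq := hbit p hb
      have su := cut_elem (bit := bit) (T := T) hq hi
      have cu := colour_elem (bit := bit) (T := T) hq (by omega : i < 4)
      have cu' : colour n bit T (node (p % (n + 1)) i) ↔ i = 0 := by rw [cu]; omega
      have hal : allowed T i (p % (n + 1)) → switchLE n bit T i p :=
        fun h => ⟨p, le_rfl, rfl, hb, h⟩
      have hal' : switchLT n bit T i p → switchLE n bit T i p := hle
      unfold Ok
      rw [hv, cv, cw, su, cu']
      grind
    · unfold Ok
      rw [hv, cv]
      grind
    · have := not_switchLT (bit := bit) (T := T) (i := i) h0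
      unfold Ok
      rw [hv, cv, cut_special (by omega), cut_special (by omega), colour_special (by omega),
        colour_special (by omega)]
      have e₁ : 2 - 2 * i < 2 ↔ i ≠ 0 := by omega
      have e₂ : 3 - 2 * i < 2 ↔ i ≠ 0 := by omega
      rw [e₁, e₂]
      refine ⟨⟨by omega, ?_⟩, by omega, ?_⟩ <;> grind
    · have hpn' : n < p - 1 := by
        rcases eq_or_ne p (n + 1) with rfl | h
        · simp at h0
        · omega
      unfold Ok
      have := not_cut_path (bit := bit) (T := T) hpn' hi
      rw [cv, colour_path' hpn' hi, switchLT_iff h0]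
      grind
    -- Only here is it used that `T` splits the sets: by the end of the block the switch has taken
    -- place, on path 0 at a member outside `T` and on path 1 at a member of `T`.
    · obtain ⟨⟨q, hq, h₁, h₂, h₃⟩, q', hq', h₁', h₂', h₃'⟩ := hT p hp hpn h0
      have hs : switchLE n bit T i p := by
        interval_cases i
        · exact ⟨q', hq', h₁', h₂', by simp [allowed, h₃']⟩
        · exact ⟨q, hq, h₁, h₂, by simp [allowed, h₃]⟩
      unfold Ok
      rw [cw, cut_special (x := 2 * i) (by omega), cut_special (x := 2 * i + 1) (by omega),
        colour_special (x := 2 * i) (by omega), colour_special (x := 2 * i + 1) (by omega)]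
      have e₁ : 2 * i < 2 ↔ i = 0 := by omega
      have e₂ : 2 * i + 1 < 2 ↔ i = 0 := by omega
      rw [e₁, e₂]
      grind

/-! #### The graph -/

/-- The vertices outside of the linear forest. -/
def special (n x : ℕ) : Prop := x < 5 ∨ x < 4 * n + 5 ∧ (x - 5) % 4 < 2

instance (n x : ℕ) : Decidable (special n x) := inferInstanceAs (Decidable (_ ∨ _))

/-- The position of a vertex on the line into which the linear forest is embedded. -/
def line (x : ℕ) : ℕ := 4 * ((x - 5) / 4) + 2 * ((x - 5) % 4 % 2) + (x - 5) % 4 / 2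

theorem special_of_lt {x : ℕ} (h : x < 5) : special n x := .inl h

theorem special_node {p i : ℕ} (hi : i < 4) : special n (node p i) ↔ p < n ∧ i < 2 := by
  simp only [special, node]; omega

theorem line_node {p i : ℕ} (hi : i < 4) : line (node p i) = 4 * p + 2 * (i % 2) + i / 2 := by
  simp only [line, node]; omega

/-- Outside the special vertices only path edges remain. `line` puts path 0 on the even numbers `4 *
p`, `4 * p + 2` and path 1 on the odd numbers `4 * p + 1`, `4 * p + 3`, so consecutive path vertices
differ by 2. -/
theorem structure_edgeList (hbit : ∀ p, bit p = true → p % (n + 1) < n) :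
    ∀ e ∈ edgeList n P bit, e.1 < 4 * P + 5 ∧ e.2 < 4 * P + 5 ∧ e.1 ≠ e.2 ∧
      (¬ special n e.1 → ¬ special n e.2 → line e.2 = line e.1 + 2 ∨ line e.1 = line e.2 + 2) := by
  have sp : ∀ {u v : ℕ}, v < 5 → 5 ≤ u → u < 4 * P + 5 → u < 4 * P + 5 ∧ v < 4 * P + 5 ∧ u ≠ v ∧
      (¬ special n u → ¬ special n v → line v = line u + 2 ∨ line u = line v + 2) :=
    fun h h' h'' => ⟨h'', by omega, by omega, fun _ hv => absurd (special_of_lt h) hv⟩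
  have nd : ∀ {p i}, p < P → i < 4 → node p i < 4 * P + 5 := fun h h' => by simp only [node]; omega
  have nd' : ∀ {p i}, 5 ≤ node p i := by simp only [node]; omega
  have s5 : ∀ {u}, u < 5 → special n u := special_of_lt
  refine forall_edgeList (R := fun u v => u < 4 * P + 5 ∧ v < 4 * P + 5 ∧ u ≠ v ∧
    (¬ special n u → ¬ special n v → line v = line u + 2 ∨ line u = line v + 2)).2 ⟨?_, fun p hp =>
    forall_nodeEdges (R := fun u v => u < 4 * P + 5 ∧ v < 4 * P + 5 ∧ u ≠ v ∧
    (¬ special n u → ¬ special n v → line v = line u + 2 ∨ line u = line v + 2)).2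
    ⟨fun hpn => ?_, fun hpn i hi => ?_, fun hpn i hi => forall_pathEdges
    (R := fun u v => u < 4 * P + 5 ∧ v < 4 * P + 5 ∧ u ≠ v ∧
    (¬ special n u → ¬ special n v → line v = line u + 2 ∨ line u = line v + 2)).2 ?_⟩⟩
  · refine ⟨?_, ?_, ?_, ?_, ?_, ?_⟩ <;>
      exact ⟨by omega, by omega, by omega, fun h => absurd (s5 (by norm_num)) h⟩
  · refine ⟨⟨?_, ?_⟩, ⟨?_, ?_⟩, ⟨nd hp (by norm_num), nd hp (by norm_num), by simp [node],
      fun h => absurd ((special_node (by norm_num)).2 ⟨hpn, by norm_num⟩) h⟩, ⟨?_, ?_⟩, ?_, ?_⟩ <;>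
      exact sp (by norm_num) nd' (nd hp (by norm_num))
  · exact ⟨sp (by norm_num) nd' (nd hp (by omega)), sp (by norm_num) nd' (nd hp (by omega))⟩
  · refine ⟨⟨nd hp (by omega), nd hp (by omega), by simp only [node]; omega, fun _ _ => .inl ?_⟩,
      sp (by norm_num) nd' (nd hp (by omega)), fun hb => ?_,
      fun _ => sp (by norm_num) nd' (nd hp (by omega)),
      fun _ => ⟨sp (by omega) nd' (nd hp (by omega)), sp (by omega) nd' (nd hp (by omega))⟩,
      fun h0 => ?_,
      fun _ => ⟨sp (by omega) nd' (nd hp (by omega)), sp (by omega) nd' (nd hp (by omega))⟩⟩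
    · rw [line_node (by omega), line_node (by omega)]
      omega
    · have hq := hbit p hb
      have hs : special n (node (p % (n + 1)) i) := (special_node (by omega)).2 ⟨hq, hi⟩
      exact ⟨⟨nd hp (by omega), nd (by omega) (by omega), by simp only [node]; omega,
        fun _ h => absurd hs h⟩, nd hp (by omega), nd (by omega) (by omega),
        by simp only [node]; omega, fun _ h => absurd hs h⟩
    · refine ⟨nd (by omega) (by omega), nd hp (by omega), by simp only [node]; omega,
        fun _ _ => .inl ?_⟩
      rw [line_node (by omega), line_node (by omega)]
      omega

/-- The graph of a family of sets. -/
def graph (n P : ℕ) (bit : ℕ → Bool) (hbit : ∀ p, bit p = true → p % (n + 1) < n) :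
    SimpleGraph (Fin (4 * P + 5)) where
  Adj u v := ((u : ℕ), (v : ℕ)) ∈ edgeList n P bit ∨ ((v : ℕ), (u : ℕ)) ∈ edgeList n P bit
  symm := ⟨fun _ _ h => h.symm⟩
  loopless := ⟨fun _ h => (structure_edgeList hbit _ (h.elim id id)).2.2.1 rfl⟩

theorem isLinearForest_graph (hbit : ∀ p, bit p = true → p % (n + 1) < n)
    {X : Set (Fin (4 * P + 5))} (hX : ∀ x, x ∈ X ↔ special n x) :
    IsLinearForest ((graph n P bit hbit).induce Xᶜ) := by
  refine isLinearForest_of_injective (fun x => line x.1) ?_ ?_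
  · rintro ⟨x, hx⟩ ⟨y, hy⟩ h
    rw [Set.mem_compl_iff, hX] at hx hy
    simp only [special, line] at hx hy h
    simp only [Subtype.mk.injEq, Fin.ext_iff]
    -- Modulo 4 the value of `line` is a permutation of the index within a position, so position and
    -- index can be recovered. Vertices below 5, which truncated subtraction would identify with 5,
    -- are special and hence excluded.
    have h₁ : (x.1 - 5) / 4 = (y.1 - 5) / 4 := by omega
    have h₂ : (x.1 - 5) % 4 < 4 := Nat.mod_lt _ (by norm_num)
    have h₃ : (y.1 - 5) % 4 < 4 := Nat.mod_lt _ (by norm_num)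
    have h₄ : (x.1 - 5) % 4 = (y.1 - 5) % 4 := by omega
    omega
  · rintro ⟨x, hx⟩ ⟨y, hy⟩ h
    rw [Set.mem_compl_iff, hX] at hx hy
    rcases h with h | h
    · exact (structure_edgeList hbit _ h).2.2.2 hx hy
    · exact ((structure_edgeList hbit _ h).2.2.2 hy hx).symm

theorem exists_isStableCutset_iff (hbit : ∀ p, bit p = true → p % (n + 1) < n) :
    (∃ S, IsStableCutset (graph n P bit hbit) S) ↔ ∃ T, Splits n P bit T := by
  simp only [isStableCutset_iff]
  constructor
  · rintro ⟨S, hS, c, hc, ⟨x, hx, hcx⟩, y, hy, hcy⟩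
    have hg : Good n P bit (fun u => ∃ h : u < 4 * P + 5, ⟨u, h⟩ ∈ S)
        (fun u => ∃ h : u < 4 * P + 5, c ⟨u, h⟩) := by
      intro e he
      obtain ⟨h₁, h₂, -⟩ := structure_edgeList hbit e he
      have ha : (graph n P bit hbit).Adj ⟨e.1, h₁⟩ ⟨e.2, h₂⟩ := .inl he
      simp only [Ok, h₁, h₂, exists_true_left]
      exact ⟨hS _ _ ha, hc _ _ ha⟩
    exact ⟨_, hg.splits hbit x.2 y.2 (by simpa using hx) (by simpa using hy) (by simpa using hcx)
      (by simpa using hcy)⟩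
  · rintro ⟨T, hT⟩
    have hg := good_cut hbit hT
    refine ⟨{u | cut n bit T u}, ?_, fun u => colour n bit T u, ?_,
      ⟨⟨0, by omega⟩, ?_, ?_⟩, ⟨2, by omega⟩, ?_, ?_⟩
    · rintro u v (h | h)
      · exact (hg _ h).1
      · exact fun ⟨hu, hv⟩ => (hg _ h).1 ⟨hv, hu⟩
    · rintro u v (h | h) hu hv
      · exact (hg _ h).2 hu hv
      · exact ((hg _ h).2 hv hu).symm
    · exact fun h => absurd ((cut_special (by norm_num)).1 (id h : cut n bit T 0)) (by norm_num)
    · exact (colour_special (by norm_num)).2 (by norm_num)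
    · exact fun h => absurd ((cut_special (by norm_num)).1 (id h : cut n bit T 2)) (by norm_num)
    · exact mt (colour_special (by norm_num)).1 (by norm_num)

end Gadget

/-! ### Strings of instances -/

theorem List.range_mul_flatMap {α : Type} (m k : ℕ) (f : ℕ → List α) :
    (List.range (m * k)).flatMap f =
      (List.range m).flatMap fun j => (List.range k).flatMap fun i => f (j * k + i) := by
  induction m with
  | zero => simp
  | succ m ih =>
    rw [Nat.succ_mul, List.range_add, List.flatMap_append, ih, List.range_succ,
      List.flatMap_append, List.flatMap_map]
    simp

theorem List.range_mul_map {α : Type} (m k : ℕ) (f : ℕ → α) : (List.range (m * k)).map f =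
      (List.range m).flatMap fun j => (List.range k).map fun i => f (j * k + i) := by
  simpa only [List.map_eq_flatMap] using List.range_mul_flatMap m k fun i => [f i]

theorem List.eq_map_range_getD {α : Type} (l : List α) (d : α) :
    l = (List.range l.length).map fun i => l.getD i d :=
  List.ext_getElem (by simp) (by simp +contextual)

theorem List.getElem?_flatMap_of_length {α β : Type} {g : α → List β} {k : ℕ}
    (hg : ∀ a, (g a).length = k) (l : List α) {j i : ℕ} (hi : i < k) :
    (l.flatMap g)[j * k + i]? = l[j]?.bind fun a => (g a)[i]? := by
  induction l generalizing j with
  | nil => simp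
  | cons a l ih =>
    rw [List.flatMap_cons]
    cases j with
    | zero => simp [List.getElem?_append_left, hg, hi]
    | succ j =>
      rw [List.getElem?_append_right (by rw [hg]; nlinarith), hg,
        show (j + 1) * k + i - k = j * k + i by rw [Nat.succ_mul]; omega, ih]
      simp

/-- The code of a set, given by its characteristic function. -/
def bitsCode (n : ℕ) (b : ℕ → Bool) : List Symb := (List.range n).map (fun i => some (b i)) ++ [none]

theorem length_bitsCode (n : ℕ) (b : ℕ → Bool) : (bitsCode n b).length = n + 1 := by
  simp [bitsCode]

theorem unaryCode_eq_bitsCode (n : ℕ) : unaryCode n = bitsCode n fun _ => true := by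
  simp [unaryCode, bitsCode, List.map_const']

theorem subsetCode_filter {n : ℕ} (b : ℕ → Bool) :
    subsetCode (Finset.univ.filter fun i : Fin n => b i = true) = bitsCode n b := by
  simp only [subsetCode, bitsCode]
  congr 1
  exact List.ext_getElem (by simp) (by simp)

theorem exists_bits {n : ℕ} (A : Finset (Fin n)) :
    ∃ b : ℕ → Bool, A = Finset.univ.filter fun i : Fin n => b i = true :=
  ⟨fun i => decide (∃ h : i < n, ⟨i, h⟩ ∈ A), by ext i; simp⟩

theorem exists_list_bits {n : ℕ} (F : List (Finset (Fin n))) : ∃ L : List (ℕ → Bool),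
    F = L.map fun b => Finset.univ.filter fun i : Fin n => b i = true := by
  choose b hb using exists_bits (n := n)
  refine ⟨F.map b, ?_⟩
  rw [List.map_map]
  exact (List.map_id F).symm.trans (List.map_congr_left fun A _ => hb A)

theorem mem_setSplittingN {x : List Symb} {n : ℕ} : (x, n) ∈ SetSplittingN ↔
    ∃ L : List (ℕ → Bool), x = unaryCode n ++ L.flatMap (bitsCode n) ∧
      ∃ T : ℕ → Prop, ∀ b ∈ L, (∃ i < n, b i = true ∧ T i) ∧ ∃ i < n, b i = true ∧ ¬ T i := by
  classical
  constructor
  · rintro ⟨n', F, h, S, hS⟩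
    obtain ⟨rfl, rfl⟩ := Prod.mk.inj h
    obtain ⟨L, rfl⟩ := exists_list_bits F
    refine ⟨L, by simp [List.flatMap_map, subsetCode_filter], fun i => ∃ h : i < n, ⟨i, h⟩ ∈ S,
      fun b hb => ?_⟩
    obtain ⟨h₁, h₂⟩ := hS _ (List.mem_map_of_mem hb)
    simp only [Finset.subset_iff, Finset.mem_filter, Finset.mem_univ, true_and, not_forall,
      Finset.mem_compl, not_not, exists_prop] at h₁ h₂
    obtain ⟨i, hi, hiS⟩ := h₁
    obtain ⟨j, hj, hjS⟩ := h₂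
    exact ⟨⟨j, j.2, hj, j.2, hjS⟩, i, i.2, hi, fun ⟨_, h⟩ => hiS h⟩
  · rintro ⟨L, rfl, T, hT⟩
    refine ⟨n, L.map fun b => Finset.univ.filter fun i : Fin n => b i = true,
      by simp [List.flatMap_map, subsetCode_filter], Finset.univ.filter fun i : Fin n => T i,
      fun A hA => ?_⟩
    obtain ⟨b, hb, rfl⟩ := List.mem_map.1 hA
    obtain ⟨⟨i, hi, hbi, hTi⟩, j, hj, hbj, hTj⟩ := hT b hb
    refine ⟨fun h => hTj ?_, fun h => ?_⟩
    · simpa using h (show (⟨j, hj⟩ : Fin n) ∈ _ by simpa using hbj)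
    · exact absurd hTi (by simpa using h (show (⟨i, hi⟩ : Fin n) ∈ _ by simpa using hbi))

theorem mem_hittingSetN {x : List Symb} {n : ℕ} : (x, n) ∈ HittingSetN ↔
    ∃ (k : ℕ) (L : List (ℕ → Bool)), x = unaryCode n ++ unaryCode k ++ L.flatMap (bitsCode n) ∧
      ∃ S : Finset (Fin n), S.card ≤ k ∧ ∀ b ∈ L, ∃ i ∈ S, b i = true := by
  constructor
  · rintro ⟨n', k, F, h, S, hk, hS⟩
    obtain ⟨rfl, rfl⟩ := Prod.mk.inj h
    obtain ⟨L, rfl⟩ := exists_list_bits F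
    refine ⟨k, L, by simp [List.flatMap_map, subsetCode_filter], S, hk, fun b hb => ?_⟩
    obtain ⟨i, hi⟩ := hS _ (List.mem_map_of_mem hb)
    simp only [Finset.mem_inter, Finset.mem_filter, Finset.mem_univ, true_and] at hi
    exact ⟨i, hi.2, hi.1⟩
  · rintro ⟨k, L, rfl, S, hk, hS⟩
    refine ⟨n, k, L.map fun b => Finset.univ.filter fun i : Fin n => b i = true,
      by simp [List.flatMap_map, subsetCode_filter], S, hk, fun A hA => ?_⟩
    obtain ⟨b, hb, rfl⟩ := List.mem_map.1 hA
    obtain ⟨i, hi, hbi⟩ := hS b hb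
    exact ⟨i, by simpa using ⟨hbi, hi⟩⟩

/-! #### Syntactic correctness -/

/-- The condition on the symbol at position `p` in the strings `unaryCode n ++ …` (for `s = n`) and
`unaryCode n ++ unaryCode k ++ …` (for `s = n + 1 + k`) that are continued by codes of subsets of an
`n`-element set. -/
def ValidAt (x : List Symb) (n s p : ℕ) : Prop :=
  if p = n then x[p]? = some none else if p < s then x[p]? = some (some true) else
    (x[p]? = some none ↔ ∃ m, p = s + m * (n + 1))

def Valid (x : List Symb) (n s : ℕ) : Prop :=
  s < x.length ∧ n ≤ s ∧ (∃ m, x.length = s + 1 + m * (n + 1)) ∧ ∀ p < x.length, ValidAt x n s p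

def header (n s : ℕ) : List Symb :=
  (List.range (s + 1)).map fun p => if p = n ∨ p = s then none else some true

theorem header_self (n : ℕ) : header n n = unaryCode n := by
  refine List.ext_getElem? fun i => ?_
  rcases lt_trichotomy i n with h | rfl | h
  · simp [header, unaryCode, h, h.ne, h.le]
  · simp [header, unaryCode]
  · rw [List.getElem?_eq_none (by simpa [header]), List.getElem?_eq_none (by simpa [unaryCode])]

theorem header_add (n k : ℕ) : header n (n + 1 + k) = unaryCode n ++ unaryCode k := by
  rw [← header_self n, ← header_self k, header, header, header, add_assoc (n + 1), List.range_add,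
    List.map_append, List.map_map]
  congr 1
  · refine List.map_congr_left fun i hi => ?_
    have := List.mem_range.1 hi
    exact if_congr (by omega) rfl rfl
  · refine List.map_congr_left fun i hi => ?_
    simp only [Function.comp]
    refine if_congr ?_ rfl rfl
    omega

/-- A string is well formed exactly if its length is right and separators stand at the right
positions. These conditions concern one position at a time and involve only multiples of `n + 1`, so
loop expressions can check them. -/
theorem valid_iff {x : List Symb} {n s : ℕ} (hs : n ≤ s) : Valid x n s ↔
    ∃ L : List (ℕ → Bool), x = header n s ++ L.flatMap (bitsCode n) := by
  constructor
  · rintro ⟨hsx, -, ⟨m, hm⟩, hx⟩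
    refine ⟨(List.range m).map fun j i => (x[s + 1 + (j * (n + 1) + i)]?.getD none).getD false, ?_⟩
    have hg : ∀ p < x.length, x.getD p none = x[p]?.getD none := fun p hp => by simp
    conv_lhs => rw [List.eq_map_range_getD x none, hm, List.range_add, List.map_append]
    congr 1
    · refine List.map_congr_left fun p hp => ?_
      have hp := List.mem_range.1 hp
      have := hx p (by omega)
      unfold ValidAt at this
      split_ifs at this with h₁ h₂
      · simp [h₁, h₁ ▸ this]
      · rw [if_neg (by omega)]; simp [this]
      · have h : p = s := by omega
        have := this.2 ⟨0, by omega⟩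
        simp [h, h ▸ this]
    · rw [List.flatMap_map, List.map_map, List.range_mul_map]
      refine List.flatMap_congr fun j hj => ?_
      have hj := List.mem_range.1 hj
      have hjm : (j + 1) * (n + 1) ≤ m * (n + 1) := Nat.mul_le_mul_right _ hj
      rw [Nat.succ_mul] at hjm
      rw [bitsCode, List.range_succ, List.map_append]
      congr 1
      · refine List.map_congr_left fun i hi => ?_
        have hi := List.mem_range.1 hi
        have := hx (s + 1 + (j * (n + 1) + i)) (by omega)
        rw [ValidAt, if_neg (by omega), if_neg (by omega)] at this
        have hne : x[s + 1 + (j * (n + 1) + i)]? ≠ some none := by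
          rw [Ne, this]
          rintro ⟨m', h⟩
          have : (n + 1) ∣ j * (n + 1) + (i + 1) := ⟨m', by rw [mul_comm (n + 1)]; omega⟩
          rw [Nat.dvd_add_right (dvd_mul_left _ _)] at this
          have := Nat.le_of_dvd (by omega) this
          omega
        have hlt : s + 1 + (j * (n + 1) + i) < x.length := by omega
        simp only [Function.comp, List.getD_eq_getElem?_getD, List.getElem?_eq_getElem hlt,
          Option.getD_some] at hne ⊢
        cases h : x[s + 1 + (j * (n + 1) + i)] with
        | none => simp [h] at hne
        | some b => simp
      · have := hx (s + 1 + (j * (n + 1) + n)) (by omega)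
        rw [ValidAt, if_neg (by omega), if_neg (by omega)] at this
        have := this.2 ⟨j + 1, by rw [Nat.succ_mul]; omega⟩
        simp [this]
  · rintro ⟨L, rfl⟩
    have hl : (header n s ++ L.flatMap (bitsCode n)).length = s + 1 + L.length * (n + 1) := by
      simp [header, List.length_flatMap, length_bitsCode]
    refine ⟨by omega, hs, ⟨_, hl⟩, fun p hp => ?_⟩
    rw [hl] at hp
    unfold ValidAt
    have hh : (header n s).length = s + 1 := by simp [header]
    have h₁ : ∀ p < s + 1, (header n s ++ L.flatMap (bitsCode n))[p]? =
        some (if p = n ∨ p = s then none else some true) := fun p hp => by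
      rw [List.getElem?_append_left (by omega)]
      simp [header, hp]
    split_ifs with h h'
    · rw [h₁ p (by omega), if_pos (.inl h)]
    · rw [h₁ p (by omega), if_neg (by omega)]
    · rcases (not_lt.1 h').eq_or_lt with rfl | h'
      · rw [h₁ s (by omega), if_pos (.inr rfl)]
        exact iff_of_true rfl ⟨0, by simp⟩
      · obtain ⟨t, rfl⟩ := Nat.exists_eq_add_of_le (Nat.succ_le_of_lt h')
        have ht := Nat.div_add_mod' t (n + 1)
        have ht' : t % (n + 1) < n + 1 := Nat.mod_lt _ (by omega)
        have htL : t / (n + 1) < L.length := by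
          rw [Nat.div_lt_iff_lt_mul (by omega)]; omega
        rw [List.getElem?_append_right (by omega), hh, Nat.succ_eq_add_one, Nat.add_sub_cancel_left]
        conv_lhs => rw [← ht, List.getElem?_flatMap_of_length (length_bitsCode n) _ ht',
          List.getElem?_eq_getElem htL]
        have h₂ : (∃ m, s + 1 + t = s + m * (n + 1)) ↔ t % (n + 1) = n := by
          constructor
          · rintro ⟨m, hm⟩
            have : (n + 1) ∣ t / (n + 1) * (n + 1) + (t % (n + 1) + 1) :=
              ⟨m, by rw [mul_comm (n + 1) m]; omega⟩
            rw [Nat.dvd_add_right (dvd_mul_left _ _)] at this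
            have := Nat.le_of_dvd (by omega) this
            omega
          · exact fun h => ⟨t / (n + 1) + 1, by rw [Nat.succ_mul]; omega⟩
        rw [h₂]
        rcases eq_or_ne (t % (n + 1)) n with h | h
        · simp [h, bitsCode]
        · have : t % (n + 1) < n := by omega
          simp [bitsCode, List.getElem?_append_left, this, h]

/-! #### Set splitting and the gadget graph -/

namespace Gadget

/-- The positions of the elements of the sets. -/
def bits (x : List Symb) (n p : ℕ) : Bool := decide (n < p ∧ x[p]? = some (some true))

/-- In a valid string the residue `n` modulo `n + 1` belongs to the separators. -/
theorem bits_lt {x : List Symb} {n : ℕ} (h : Valid x n n) {p : ℕ} (hp : bits x n p = true) :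
    p % (n + 1) < n := by
  obtain ⟨hnp, hb⟩ := of_decide_eq_true hp
  have hpx : p < x.length := by
    by_contra hlt
    simp [List.getElem?_eq_none (not_lt.1 hlt)] at hb
  have := h.2.2.2 p hpx
  rw [ValidAt, if_neg (by omega), if_neg (by omega), hb] at this
  have h₁ := Nat.div_add_mod' p (n + 1)
  have h₂ : p % (n + 1) < n + 1 := Nat.mod_lt _ (by omega)
  refine (Nat.lt_succ_iff.1 h₂).lt_of_ne fun h₃ => ?_
  simp only [Option.some.injEq, reduceCtorEq, false_iff, not_exists] at this
  exact this (p / (n + 1)) (by omega)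

/-- Block 0 of length `n + 1` is the header, so bit `i` of the `j`-th set stands at position `n + 1
+ (j * (n + 1) + i)`, in block `j + 1`. The separator of each block serves as the end of its paths.
-/
theorem splits_bits {n : ℕ} {L : List (ℕ → Bool)} {x : List Symb}
    (hx : x = unaryCode n ++ L.flatMap (bitsCode n)) {T : ℕ → Prop} :
    Splits n x.length (bits x n) T ↔
      ∀ b ∈ L, (∃ i < n, b i = true ∧ T i) ∧ ∃ i < n, b i = true ∧ ¬ T i := by
  have hu : (unaryCode n).length = n + 1 := by simp [unaryCode]
  have hl : x.length = n + 1 + L.length * (n + 1) := by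
    simp [hx, hu, List.length_flatMap, length_bitsCode]
  have hb : ∀ j (hj : j < L.length) i, i ≤ n →
      (bits x n (n + 1 + (j * (n + 1) + i)) = true ↔ i < n ∧ L[j] i = true) := by
    intro j hj i hi
    rw [bits, decide_eq_true_iff, hx, List.getElem?_append_right (by omega), hu,
      Nat.add_sub_cancel_left, List.getElem?_flatMap_of_length (length_bitsCode n) _ (by omega),
      List.getElem?_eq_getElem hj, Option.bind_some]
    rcases hi.eq_or_lt with rfl | hi
    · simp [bitsCode]
    · simp [bitsCode, List.getElem?_append_left, hi]
      omega
  have hdiv : ∀ j i, i ≤ n → (n + 1 + (j * (n + 1) + i)) / (n + 1) = j + 1 := fun j i hi => by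
    rw [show n + 1 + (j * (n + 1) + i) = i + (j + 1) * (n + 1) by ring,
      Nat.add_mul_div_right _ _ (by omega), Nat.div_eq_of_lt (by omega), zero_add]
  have hmod : ∀ j i, i ≤ n → (n + 1 + (j * (n + 1) + i)) % (n + 1) = i := fun j i hi => by
    rw [show n + 1 + (j * (n + 1) + i) = i + (j + 1) * (n + 1) by ring,
      Nat.add_mul_mod_self_right, Nat.mod_eq_of_lt (by omega)]
  have hq : ∀ j (hj : j < L.length) (R : ℕ → Prop), (∃ q ≤ n + 1 + (j * (n + 1) + n),
      q / (n + 1) = (n + 1 + (j * (n + 1) + n)) / (n + 1) ∧ bits x n q = true ∧ R (q % (n + 1))) ↔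
      ∃ i < n, L[j] i = true ∧ R i := by
    intro j hj R
    rw [hdiv j n le_rfl]
    constructor
    · rintro ⟨q, -, hqj, hbq, hR⟩
      have h₁ := Nat.div_add_mod' q (n + 1)
      have h₂ : q % (n + 1) < n + 1 := Nat.mod_lt _ (by omega)
      rw [hqj, Nat.succ_mul] at h₁
      rw [show q = n + 1 + (j * (n + 1) + q % (n + 1)) by omega, hb j hj _ (by omega)] at hbq
      exact ⟨_, hbq.1, hbq.2, hR⟩
    · rintro ⟨i, hi, hbi, hR⟩
      exact ⟨n + 1 + (j * (n + 1) + i), by omega, hdiv j i hi.le, (hb j hj i hi.le).2 ⟨hi, hbi⟩,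
        by rwa [hmod j i hi.le]⟩
  constructor
  · intro h b hbL
    obtain ⟨j, hj, rfl⟩ := List.mem_iff_getElem.1 hbL
    have hjL : (j + 1) * (n + 1) ≤ L.length * (n + 1) := Nat.mul_le_mul_right _ hj
    rw [Nat.succ_mul] at hjL
    have := h (n + 1 + (j * (n + 1) + n)) (by omega) (by omega) (hmod j n le_rfl)
    exact ⟨(hq j hj T).1 this.1, (hq j hj fun i => ¬ T i).1 this.2⟩
  · intro h p hp hnp hpn
    have h₁ := Nat.div_add_mod' p (n + 1)
    obtain ⟨j, hj⟩ : ∃ j, p / (n + 1) = j + 1 :=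
      Nat.exists_eq_succ_of_ne_zero fun h0 => by rw [h0, hpn] at h₁; omega
    rw [hj, hpn, Nat.succ_mul] at h₁
    obtain rfl : n + 1 + (j * (n + 1) + n) = p := by omega
    have hjL : j < L.length := by
      by_contra hjL
      have := Nat.mul_le_mul_right (n + 1) (not_lt.1 hjL)
      omega
    have := h _ (List.getElem_mem hjL)
    exact ⟨(hq j hjL T).2 this.1, (hq j hjL fun i => ¬ T i).2 this.2⟩

theorem mem_setSplittingN_iff {x : List Symb} {n : ℕ} : (x, n) ∈ SetSplittingN ↔
    Valid x n n ∧ ∃ T, Splits n x.length (bits x n) T := by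
  rw [mem_setSplittingN, valid_iff le_rfl, header_self]
  constructor
  · rintro ⟨L, hx, T, hT⟩
    exact ⟨⟨L, hx⟩, T, (splits_bits hx).2 hT⟩
  · rintro ⟨⟨L, hx⟩, T, hT⟩
    exact ⟨L, hx, T, (splits_bits hx).1 hT⟩

/-! #### Stable cutset instances -/

/-- The characteristic string of the set of special vertices. -/
def specialCode (n P : ℕ) : List Symb :=
  List.replicate 5 (some true) ++ (List.range P).flatMap (fun p =>
    [some (decide (p < n)), some (decide (p < n)), some false, some false]) ++ [none]

def edgeCode (e : ℕ × ℕ) : List Symb := unaryCode e.1 ++ unaryCode e.2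

/-- The instance of the stable cutset problem. -/
def code (n P : ℕ) (bit : ℕ → Bool) : List Symb :=
  specialCode n P ++ (edgeList n P bit).flatMap edgeCode

def specialSet (n P : ℕ) : Finset (Fin (4 * P + 5)) :=
  Finset.univ.filter fun i => decide (special n i) = true

theorem subsetCode_specialSet (n P : ℕ) : subsetCode (specialSet n P) = specialCode n P := by
  rw [specialSet, subsetCode_filter (fun i => decide (special n i)), bitsCode, specialCode,
    show 4 * P + 5 = 5 + P * 4 by ring, List.range_add, List.map_append, List.map_map,
    List.range_mul_map]
  congr 2
  refine List.flatMap_congr fun p _ => ?_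
  simp only [List.range_succ, List.range_zero, List.nil_append, List.cons_append, List.map_cons,
    List.map_nil, special, Function.comp]
  refine congrArg₂ _ ?_ (congrArg₂ _ ?_ (congrArg₂ _ ?_ (congrArg₂ _ ?_ rfl))) <;>
    simp <;> omega

theorem card_specialSet {n P : ℕ} (h' : n ≤ P) : (specialSet n P).card = 2 * n + 5 := by
  -- The minimum makes the induction on `P` possible for fixed `n`: each position below `n`
  -- contributes two special vertices, any other none.
  have key : ∀ P, ∑ i ∈ Finset.range (4 * P + 5), (if special n i then 1 else 0) =
      2 * min n P + 5 := by
    intro P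
    induction P with
    | zero =>
      rw [Finset.sum_congr rfl fun i hi => if_pos (special_of_lt (Finset.mem_range.1 hi))]
      simp
    | succ P ih =>
      have h₀ : special n (4 * P + 5) ↔ P < n := by simp only [special]; omega
      have h₁ : special n (4 * P + 5 + 1) ↔ P < n := by simp only [special]; omega
      have h₂ : ¬ special n (4 * P + 5 + 1 + 1) := by simp only [special]; omega
      have h₃ : ¬ special n (4 * P + 5 + 1 + 1 + 1) := by simp only [special]; omega
      rw [show 4 * (P + 1) + 5 = 4 * P + 5 + 1 + 1 + 1 + 1 by ring, Finset.sum_range_succ,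
        Finset.sum_range_succ, Finset.sum_range_succ, Finset.sum_range_succ, ih, if_neg h₂,
        if_neg h₃]
      simp only [h₀, h₁]
      split_ifs <;> omega
  have h := key P
  rw [min_eq_left h', Finset.sum_range] at h
  rw [specialSet, Finset.card_filter]
  simpa only [decide_eq_true_eq] using h

/-! ### Unique decoding of strings -/

theorem append_none_inj {α : Type} {a b : List α} {r t : List (Option α)}
    (h : a.map some ++ none :: r = b.map some ++ none :: t) : a = b ∧ r = t := by
  induction a generalizing b with
  | nil => cases b <;> simp_all
  | cons x a ih =>
    cases b with
    | nil => simp at h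
    | cons y b =>
      simp only [List.map_cons, List.cons_append, List.cons.injEq, Option.some.injEq] at h
      obtain ⟨rfl, rfl⟩ := ih h.2
      exact ⟨by rw [h.1], rfl⟩

theorem unaryCode_append_inj {m n : ℕ} {r t : List Symb}
    (h : unaryCode m ++ r = unaryCode n ++ t) : m = n ∧ r = t := by
  have := append_none_inj (a := List.replicate m true) (b := List.replicate n true) (r := r)
    (t := t) (by simpa [unaryCode] using h)
  exact ⟨by simpa using congrArg List.length this.1, this.2⟩

theorem flatMap_edgeCode_injective {E F : List (ℕ × ℕ)}
    (h : E.flatMap edgeCode = F.flatMap edgeCode) : E = F := by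
  induction E generalizing F with
  | nil => cases F <;> simp_all [edgeCode, unaryCode]
  | cons e E ih =>
    cases F with
    | nil => simp [edgeCode, unaryCode] at h
    | cons f F =>
      simp only [List.flatMap_cons, edgeCode, List.append_assoc] at h
      obtain ⟨h₁, h⟩ := unaryCode_append_inj h
      obtain ⟨h₂, h⟩ := unaryCode_append_inj h
      rw [Prod.ext h₁ h₂, ih h]

theorem flatMap_pairCode {n : ℕ} (E : List (Fin n × Fin n)) :
    E.flatMap pairCode = (E.map fun e => ((e.1 : ℕ), (e.2 : ℕ))).flatMap edgeCode := by
  rw [List.flatMap_map]; rfl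

theorem subsetCode_append_inj {m n : ℕ} {A : Finset (Fin m)} {B : Finset (Fin n)}
    {r t : List Symb} (h : subsetCode A ++ r = subsetCode B ++ t) : m = n ∧ HEq A B ∧ r = t := by
  have := append_none_inj (a := List.ofFn fun i => decide (i ∈ A))
    (b := List.ofFn fun i => decide (i ∈ B)) (r := r) (t := t)
    (by simpa [subsetCode, List.map_ofFn, Function.comp_def] using h)
  obtain rfl : m = n := by simpa using congrArg List.length this.1
  refine ⟨rfl, heq_of_eq ?_, this.2⟩
  ext i
  simpa using congrFun (List.ofFn_injective this.1) i

theorem mem_map_val {N : ℕ} {E : List (Fin N × Fin N)} {u v : Fin N} :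
    ((u : ℕ), (v : ℕ)) ∈ E.map (fun e => ((e.1 : ℕ), (e.2 : ℕ))) ↔ (u, v) ∈ E := by
  simp [Fin.val_inj]

/-- A priori some other graph might have the same string. Unique decoding shows that vertex number
and edge list, hence the graph, are determined by it. -/
theorem code_mem_iff {n P : ℕ} {bit : ℕ → Bool} (hn : n ≤ P)
    (hbit : ∀ p, bit p = true → p % (n + 1) < n) :
    (code n P bit, 2 * n + 5) ∈ StableCutsetModLinForest ↔ ∃ T, Splits n P bit T := by
  rw [← exists_isStableCutset_iff hbit]
  constructor
  · rintro ⟨n', G, E, X, hE, h, -, hS⟩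
    have h := (Prod.mk.inj h).1
    rw [code, ← subsetCode_specialSet] at h
    obtain ⟨rfl, -, h⟩ := subsetCode_append_inj h
    rw [flatMap_pairCode] at h
    have h := flatMap_edgeCode_injective h
    convert hS
    ext u v
    rw [hE]
    simp only [graph, h, mem_map_val]
  · intro hS
    have hs := structure_edgeList (P := P) hbit
    obtain ⟨E, hE⟩ : ∃ E : List (Fin (4 * P + 5) × Fin (4 * P + 5)),
        E.map (fun e => ((e.1 : ℕ), (e.2 : ℕ))) = edgeList n P bit :=
      ⟨(edgeList n P bit).attach.map fun e => (⟨e.1.1, (hs _ e.2).1⟩, ⟨e.1.2, (hs _ e.2).2.1⟩),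
        by rw [List.map_map]; exact List.attach_map_subtype_val _⟩
    refine ⟨4 * P + 5, graph n P bit hbit, E, specialSet n P, fun u v => ?_, ?_,
      isLinearForest_graph hbit fun x => by simp [specialSet], hS⟩
    · rw [← mem_map_val, ← mem_map_val, hE]
      rfl
    · rw [card_specialSet hn, code, subsetCode_specialSet]
      rw [← hE, flatMap_pairCode]

/-- The empty string serves as the no-instance to which malformed inputs are sent. -/
theorem nil_notMem {k : ℕ} : (([] : List Symb), k) ∉ StableCutsetModLinForest := by
  rintro ⟨n', G, E, X, -, h, -⟩
  simp [subsetCode] at h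

end Gadget

/-! ### Loop expressions on encoded instances -/

theorem List.flatMap_range_ite_lt {α : Type} {N k : ℕ} (hk : k ≤ N) (g : ℕ → List α) :
    ((List.range N).flatMap fun i => if i < k then g i else []) = (List.range k).flatMap g := by
  obtain ⟨d, rfl⟩ := Nat.exists_eq_add_of_le hk
  rw [List.range_add, List.flatMap_append, List.flatMap_map]
  have h : ((List.range d).flatMap fun i => if k + i < k then g (k + i) else []) = [] := by simp
  rw [h, List.append_nil]
  exact List.flatMap_congr fun i hi => if_pos (List.mem_range.1 hi)

/-- A loop whose test at most one index can pass binds its variable to that index; this is how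
expressions make use of computed numbers. -/
theorem List.flatMap_range_ite_iff {α : Type} {N k : ℕ} (hk : k < N) {c : ℕ → Prop}
    [DecidablePred c] (hc : ∀ i, c i → i = k) (g : ℕ → List α) :
    ((List.range N).flatMap fun i => if c i then g i else []) = if c k then g k else [] := by
  obtain ⟨d, rfl⟩ := Nat.exists_eq_add_of_le (Nat.succ_le_of_lt hk)
  rw [List.range_add, List.flatMap_append, List.flatMap_map, List.range_succ, List.flatMap_append]
  have h₁ : ((List.range k).flatMap fun i => if c i then g i else []) = [] := by
    simp only [List.flatMap_eq_nil_iff, List.mem_range]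
    exact fun i hi => if_neg fun h => hi.ne (hc i h)
  have h₂ : ((List.range d).flatMap fun i => if c (k.succ + i) then g (k.succ + i) else []) = [] := by
    simp only [List.flatMap_eq_nil_iff]
    exact fun i _ => if_neg fun h => absurd (hc _ h) (by omega)
  rw [h₁, h₂]
  simp

namespace LoopExpr

open Function

abbrev StrExpr : Type := LoopExpr (Fin 10) (Option Symb) (Option Symb)

section

variable {V A B : Type}

def lits : List B → LoopExpr V A B
  | [] => nil
  | b :: l => append (emit b) (lits l)

@[simp] theorem scoped_lits (l : List B) (U : List V) : (lits l : LoopExpr V A B).Scoped U := by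
  induction l with
  | nil => trivial
  | cons b l ih => exact ⟨trivial, ih⟩

variable [DecidableEq V] (w : List A) (env : V → ℕ)

@[simp] theorem eval_lits (l : List B) : (lits l : LoopExpr V A B).eval w env = l := by
  induction l with
  | nil => rfl
  | cons b l ih => simp [lits, eval, ih]

def ifEq (a b e₁ e₂ : LoopExpr V A B) : LoopExpr V A B := ifLe a b (ifLe b a e₁ e₂) e₂

theorem eval_ifEq (a b e₁ e₂ : LoopExpr V A B) : (ifEq a b e₁ e₂).eval w env =
    if (a.eval w env).length = (b.eval w env).length then e₁.eval w env else e₂.eval w env := by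
  simp only [ifEq, eval]
  split_ifs <;> first | rfl | omega

end

/-- Evaluation on the encoding of an instance. -/
def value (x : List Symb) (n : ℕ) (e : StrExpr) (env : Fin 10 → ℕ) : List (Option Symb) :=
  e.eval (encodeParamInstance (x, n)) env

variable {x : List Symb} {n : ℕ} {env : Fin 10 → ℕ}

theorem length_encodeParamInstance : (encodeParamInstance (x, n)).length = x.length + n := by
  simp [encodeParamInstance]

theorem encode_getElem?_lt {i : ℕ} (hi : i < x.length) :
    (encodeParamInstance (x, n))[i]? = x[i]?.map some := by
  simp [encodeParamInstance, List.getElem?_append_left, hi]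

theorem encode_getElem?_add {i : ℕ} (hi : i < n) :
    (encodeParamInstance (x, n))[x.length + i]? = some none := by
  simp [encodeParamInstance, hi]

/-! ### Counting and searching by loops -/

def isMark (a : Option Symb) : Bool := a == none

def isSep (a : Option Symb) : Bool := a == some none

def isOne (a : Option Symb) : Bool := a == some (some true)

/-- A single symbol, for counting. -/
def unit : StrExpr := emit none

/-- Repeat an expression for every symbol of the parameter. -/
def marks (e : StrExpr) : StrExpr := loop 9 (ifSym 9 isMark e nil)

/-- Repeat an expression for every position in the string. -/
def positions (v : Fin 10) (e : StrExpr) : StrExpr := loop v (ifSym v isMark nil e)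

def strLen : StrExpr := positions 9 unit

def param : StrExpr := marks unit

/-- Repeat an expression for all numbers less than the parameter. -/
def numbers (v : Fin 10) (e : StrExpr) : StrExpr :=
  loop v (ifLe (append (rep v none) unit) param e nil)

theorem value_loop (v : Fin 10) (e : StrExpr) : (loop v e).value x n env =
    (List.range (x.length + n)).flatMap fun i => e.value x n (update env v i) := by
  rw [value, eval, length_encodeParamInstance]; rfl

theorem value_append (e₁ e₂ : StrExpr) :
    (append e₁ e₂).value x n env = e₁.value x n env ++ e₂.value x n env := rfl

theorem value_nil : (nil : StrExpr).value x n env = [] := rfl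

theorem value_unit : unit.value x n env = [none] := rfl

theorem value_rep (v : Fin 10) (b : Option Symb) :
    (rep v b : StrExpr).value x n env = List.replicate (env v) b := rfl

theorem value_lits (l : List (Option Symb)) : (lits l : StrExpr).value x n env = l :=
  eval_lits _ _ l

theorem value_ifLe (a b e₁ e₂ : StrExpr) : (ifLe a b e₁ e₂).value x n env =
    if (a.value x n env).length ≤ (b.value x n env).length then e₁.value x n env
    else e₂.value x n env := rfl

theorem value_ifEq (a b e₁ e₂ : StrExpr) : (ifEq a b e₁ e₂).value x n env =
    if (a.value x n env).length = (b.value x n env).length then e₁.value x n env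
    else e₂.value x n env := eval_ifEq _ _ a b e₁ e₂

theorem value_ifSym_isSep {v : Fin 10} (hv : env v < x.length) (e₁ e₂ : StrExpr) :
    (ifSym v isSep e₁ e₂).value x n env =
      if x[env v]? = some none then e₁.value x n env else e₂.value x n env := by
  simp only [value, eval, encode_getElem?_lt hv, List.getElem?_eq_getElem hv, Option.map_some,
    Option.elim_some, isSep]
  cases x[env v] <;> simp

theorem value_ifSym_isOne {v : Fin 10} (hv : env v < x.length) (e₁ e₂ : StrExpr) :
    (ifSym v isOne e₁ e₂).value x n env =
      if x[env v]? = some (some true) then e₁.value x n env else e₂.value x n env := by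
  simp only [value, eval, encode_getElem?_lt hv, List.getElem?_eq_getElem hv, Option.map_some,
    Option.elim_some, isOne]
  cases x[env v] <;> simp

theorem value_marks (e : StrExpr) (he : ∀ i, e.value x n (update env 9 i) = e.value x n env) :
    (marks e).value x n env = (List.range n).flatMap fun _ => e.value x n env := by
  rw [marks, value_loop, List.range_add, List.flatMap_append, List.flatMap_map]
  have h₁ : ((List.range x.length).flatMap fun i =>
      (ifSym 9 isMark e nil : StrExpr).value x n (update env 9 i)) = [] := by
    rw [List.flatMap_eq_nil_iff]
    intro i hi
    have hi := List.mem_range.1 hi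
    simp [value, eval, encode_getElem?_lt hi, List.getElem?_eq_getElem hi, isMark]
  rw [h₁, List.nil_append]
  refine List.flatMap_congr fun i hi => ?_
  rw [← he (x.length + i)]
  have := encode_getElem?_add (x := x) (List.mem_range.1 hi)
  simp [value, eval, this, isMark]

theorem value_positions (v : Fin 10) (e : StrExpr) : (positions v e).value x n env =
    (List.range x.length).flatMap fun i => e.value x n (update env v i) := by
  rw [positions, value_loop, List.range_add, List.flatMap_append, List.flatMap_map]
  have h₁ : ((List.range n).flatMap fun i =>
      (ifSym v isMark nil e : StrExpr).value x n (update env v (x.length + i))) = [] := by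
    rw [List.flatMap_eq_nil_iff]
    intro i hi
    have := encode_getElem?_add (x := x) (List.mem_range.1 hi)
    simp [value, eval, this, isMark]
  rw [h₁, List.append_nil]
  refine List.flatMap_congr fun i hi => ?_
  have hi := List.mem_range.1 hi
  simp [value, eval, encode_getElem?_lt hi, List.getElem?_eq_getElem hi, isMark]

theorem length_param : (param.value x n env).length = n := by
  rw [param, value_marks _ fun _ => rfl]
  simp [value_unit]

theorem length_strLen : (strLen.value x n env).length = x.length := by
  simp [strLen, value_positions, value_unit]

theorem value_numbers (v : Fin 10) (e : StrExpr) : (numbers v e).value x n env =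
    (List.range n).flatMap fun i => e.value x n (update env v i) := by
  rw [numbers, value_loop, ← List.flatMap_range_ite_lt (Nat.le_add_left n x.length)]
  simp only [value_ifLe, value_append, value_rep, value_unit, length_param, List.length_append,
    List.length_replicate, update_self, List.length_singleton, Nat.succ_le_iff, value_nil]

theorem length_marks_rep {v : Fin 10} (hv : v ≠ 9) {b : Option Symb} :
    ((marks (rep v b)).value x n env).length = n * env v := by
  rw [value_marks _ fun i => by simp [value_rep, update_of_ne hv], value_rep]
  simp [List.length_flatMap]

/-- The number `v * (n + 1)`. -/
def blocks (v : Fin 10) : StrExpr := append (rep v none) (marks (rep v none))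

theorem length_blocks {v : Fin 10} (hv : v ≠ 9) :
    ((blocks v).value x n env).length = env v * (n + 1) := by
  rw [blocks, value_append, List.length_append, length_marks_rep hv, value_rep,
    List.length_replicate]
  ring

/-- Does `a = b + m * (n + 1)` hold for some `m`? -/
def aligned (a b e₁ e₂ : StrExpr) : StrExpr :=
  ifLe unit (loop 8 (ifEq a (append b (blocks 8)) unit nil)) e₁ e₂

/-- The multiplier is found by a search with variable `8`, which ranges only over input positions;
hypothesis `hm` ensures that this range suffices. -/
theorem value_aligned {a b e₁ e₂ : StrExpr} {k l : ℕ}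
    (ha : ∀ i, (a.value x n (update env 8 i)).length = k)
    (hb : ∀ i, (b.value x n (update env 8 i)).length = l)
    (hm : ∀ m, k = l + m * (n + 1) → m < x.length + n) [Decidable (∃ m, k = l + m * (n + 1))] :
    (aligned a b e₁ e₂).value x n env =
      if ∃ m, k = l + m * (n + 1) then e₁.value x n env else e₂.value x n env := by
  rw [aligned, value_ifLe]
  refine if_congr ?_ rfl rfl
  rw [value_loop, value_unit, List.length_singleton, Nat.succ_le_iff, List.length_pos_iff_exists_mem]
  simp only [value_ifEq, ha, value_append, List.length_append, hb, List.mem_flatMap,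
    List.mem_range, length_blocks (by decide : (8 : Fin 10) ≠ 9), update_self, value_unit,
    value_nil]
  constructor
  · rintro ⟨_, m, -, h⟩
    split_ifs at h with h'
    · exact ⟨m, h'⟩
    · simp at h
  · rintro ⟨m, h⟩
    exact ⟨none, m, hm m h, by simp [h]⟩

/-- Evaluate `e` if the input is syntactically correct with last separator of the header at the
value of the variable `0`. -/
def guardValid (e : StrExpr) : StrExpr :=
  ifLe (append (rep 0 none) unit) strLen
    (ifLe param (rep 0 none)
      (aligned strLen (append (rep 0 none) unit)
        (ifLe (positions 7 (ifEq (rep 7 none) param (ifSym 7 isSep nil unit)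
            (ifLe (append (rep 7 none) unit) (rep 0 none) (ifSym 7 isOne nil unit)
              (aligned (rep 7 none) (rep 0 none) (ifSym 7 isSep nil unit)
                (ifSym 7 isSep unit nil))))) nil
          e nil) nil) nil) nil

open Classical in
theorem value_guardValid (e : StrExpr) : (guardValid e).value x n env =
    if Valid x n (env 0) then e.value x n env else [] := by
  -- A symbol is emitted for each position that violates `ValidAt`; the comparison with `nil` then
  -- asks that there be none.
  have hpos : ∀ p < x.length, (ifEq (rep 7 none) param (ifSym 7 isSep nil unit)
      (ifLe (append (rep 7 none) unit) (rep 0 none) (ifSym 7 isOne nil unit)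
        (aligned (rep 7 none) (rep 0 none) (ifSym 7 isSep nil unit)
          (ifSym 7 isSep unit nil))) : StrExpr).value x n (update env 7 p) =
      if ValidAt x n (env 0) p then [] else [none] := by
    intro p hp
    have h7 : update env 7 p 7 < x.length := by simpa using hp
    rw [value_ifEq, value_ifLe, value_aligned (k := p) (l := env 0), value_ifSym_isSep h7,
      value_ifSym_isSep h7, value_ifSym_isOne h7]
    · simp only [value_rep, length_param, List.length_replicate, value_append, value_unit,
        List.length_append, List.length_singleton, update_self, value_nil, ValidAt,
        Nat.succ_le_iff, ne_eq, Fin.isValue, Fin.reduceEq, not_false_eq_true, update_of_ne]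
      split_ifs <;> simp_all
    · simp [value_rep]
    · simp [value_rep]
    · intro m hm
      have : m * 1 ≤ m * (n + 1) := Nat.mul_le_mul_left _ (by omega)
      omega
  rw [guardValid, value_ifLe, value_ifLe, value_aligned (k := x.length) (l := env 0 + 1),
    value_ifLe, value_positions, List.flatMap_congr fun p hp => hpos p (List.mem_range.1 hp)]
  · simp only [length_strLen, length_param, value_append, value_rep, value_unit, value_nil,
      List.length_append, List.length_replicate, List.length_singleton, List.length_nil,
      Nat.succ_le_iff, Nat.le_zero, List.length_eq_zero_iff, List.flatMap_eq_nil_iff,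
      List.mem_range, ite_eq_left_iff, List.cons_ne_nil, imp_false, not_not, ← ite_and, Valid]
    congr
  · simp [length_strLen]
  · simp [value_append, value_rep, value_unit]
  · intro m hm
    have : m * 1 ≤ m * (n + 1) := Nat.mul_le_mul_left _ (by omega)
    omega

theorem scoped_guardValid {e : StrExpr} {U : List (Fin 10)} (he : e.Scoped U)
    (h₇ : 7 ∉ U) (h₈ : 8 ∉ U) (h₉ : 9 ∉ U) : (guardValid e).Scoped U := by
  simp [guardValid, Scoped, aligned, strLen, param, marks, positions, unit, ifEq, blocks, he, h₇,
    h₈, h₉]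

end LoopExpr

/-! ### The transformation from Set Splitting to Stable Cutset -/

namespace Gadget

open LoopExpr Function

/-- A vertex, as a constant plus four times the value of a variable. -/
def vertexExpr (v : Option (Fin 10) × ℕ) : StrExpr :=
  append (v.1.elim nil fun y => append (rep y (some (some true))) (append (rep y (some (some true)))
    (append (rep y (some (some true))) (rep y (some (some true))))))
    (lits (List.replicate v.2 (some (some true)) ++ [some none]))

/-- The number of a vertex. -/
def vertexVal (env : Fin 10 → ℕ) (v : Option (Fin 10) × ℕ) : ℕ := v.1.elim 0 (4 * env ·) + v.2

def edgesExpr : List ((Option (Fin 10) × ℕ) × Option (Fin 10) × ℕ) → StrExpr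
  | [] => nil
  | e :: E => append (append (vertexExpr e.1) (vertexExpr e.2)) (edgesExpr E)

variable {x : List Symb} {n : ℕ} {env : Fin 10 → ℕ}

theorem value_vertexExpr (v : Option (Fin 10) × ℕ) :
    (vertexExpr v).value x n env = (unaryCode (vertexVal env v)).map some := by
  obtain ⟨_ | y, c⟩ := v
  · simp [vertexExpr, vertexVal, value_append, value_lits, value_nil, unaryCode]
  · simp only [vertexExpr, vertexVal, value_append, value_lits, value_rep, unaryCode,
      Option.elim_some, List.map_append, List.map_replicate, ← List.append_assoc,
      List.replicate_append_replicate]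
    simp only [List.map_cons, List.map_nil]
    congr 3
    ring

theorem value_edgesExpr (E : List ((Option (Fin 10) × ℕ) × Option (Fin 10) × ℕ)) :
    (edgesExpr E).value x n env =
      ((E.map fun e => (vertexVal env e.1, vertexVal env e.2)).flatMap edgeCode).map some := by
  induction E with
  | nil => rfl
  | cons e E ih =>
    simp only [edgesExpr, value_append, value_vertexExpr, ih, List.map_cons, List.flatMap_cons,
      edgeCode, List.map_append]

theorem scoped_edgesExpr (E : List ((Option (Fin 10) × ℕ) × Option (Fin 10) × ℕ))
    (U : List (Fin 10)) : (edgesExpr E).Scoped U := by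
  induction E with
  | nil => trivial
  | cons e E ih =>
    have h : ∀ v, (vertexExpr v).Scoped U := by
      rintro ⟨_ | y, c⟩ <;> simp [vertexExpr, Scoped]
    exact ⟨⟨h _, h _⟩, ih⟩

/-- Bind the variables `2` and `3` to the quotient and the remainder of the value of the variable
`1` by `n + 1`. -/
def divMod (e : StrExpr) : StrExpr :=
  loop 2 (loop 3 (ifLe (rep 3 none) param
    (ifEq (rep 1 none) (append (rep 3 none) (blocks 2)) e nil) nil))

theorem value_divMod (e : StrExpr) (h : env 1 < x.length + n) : (divMod e).value x n env =
    e.value x n (update (update env 2 (env 1 / (n + 1))) 3 (env 1 % (n + 1))) := by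
  have h₁ := Nat.div_add_mod' (env 1) (n + 1)
  have h₂ : env 1 % (n + 1) < n + 1 := Nat.mod_lt _ (by omega)
  have h₃ : env 1 / (n + 1) ≤ env 1 := Nat.div_le_self _ _
  have h₄ : env 1 % (n + 1) ≤ env 1 := Nat.mod_le _ _
  -- By uniqueness of division with remainder, a single pair passes the test in the double loop.
  have hq : ∀ j q, q ≤ n ∧ env 1 = q + j * (n + 1) ↔
      j = env 1 / (n + 1) ∧ q = env 1 % (n + 1) := by
    intro j q
    constructor
    · rintro ⟨hq, h⟩
      rw [h, Nat.add_mul_div_right _ _ (by omega), Nat.div_eq_of_lt (by omega),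
        Nat.add_mul_mod_self_right, Nat.mod_eq_of_lt (by omega)]
      simp
    · rintro ⟨rfl, rfl⟩
      omega
  rw [divMod, value_loop]
  simp only [value_loop, value_ifLe, value_ifEq, value_rep, value_append, value_nil,
    List.length_append, List.length_replicate, length_param,
    length_blocks (by decide : (2 : Fin 10) ≠ 9), ← ite_and, update_self, ne_eq, Fin.isValue,
    Fin.reduceEq, not_false_eq_true, update_of_ne, hq]
  have h₅ : ∀ j, ((List.range (x.length + n)).flatMap fun q =>
      if j = env 1 / (n + 1) ∧ q = env 1 % (n + 1) then
        e.value x n (update (update env 2 j) 3 q) else []) =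
      if j = env 1 / (n + 1) then
        e.value x n (update (update env 2 j) 3 (env 1 % (n + 1))) else [] := by
    intro j
    rw [List.flatMap_range_ite_iff (k := env 1 % (n + 1)) (by omega) fun q hq => hq.2]
    simp
  simp only [h₅]
  rw [List.flatMap_range_ite_iff (k := env 1 / (n + 1)) (by omega) fun q hq => hq]
  simp

/-- The counterpart of `pathEdges`. -/
def pathExpr (i : ℕ) : StrExpr :=
  append (append (append (edgesExpr [((some 1, 5 + 2 * i), some 1, 5 + (2 * i + 1)),
      ((some 1, 5 + (2 * i + 1)), none, 4)])
    (ifSym 1 isOne (edgesExpr [((some 1, 5 + 2 * i), some 3, 5 + i),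
      ((some 1, 5 + (2 * i + 1)), some 3, 5 + i)])
      (edgesExpr [((some 1, 5 + 2 * i), none, 4)])))
    (ifLe (rep 3 none) nil (edgesExpr [((some 1, 5 + 2 * i), none, 2 - 2 * i),
      ((some 1, 5 + 2 * i), none, 3 - 2 * i)])
      (edgesExpr [((some 1, 1 + (2 * i + 1)), some 1, 5 + 2 * i)])))
    (ifEq (rep 3 none) param (edgesExpr [((some 1, 5 + (2 * i + 1)), none, 2 * i),
      ((some 1, 5 + (2 * i + 1)), none, 2 * i + 1)]) nil)

/-- The counterpart of `nodeEdges`. -/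
def nodeExpr : StrExpr :=
  ifLe (append (rep 1 none) unit) param (edgesExpr [((some 1, 5), none, 0), ((some 1, 5), none, 1),
      ((some 1, 6), none, 2), ((some 1, 6), none, 3), ((some 1, 5), some 1, 6),
      ((some 1, 7), none, 0), ((some 1, 7), none, 1), ((some 1, 8), none, 0),
      ((some 1, 8), none, 1)])
    (ifEq (rep 1 none) param (edgesExpr [((some 1, 5), none, 0), ((some 1, 5), none, 1),
      ((some 1, 6), none, 0), ((some 1, 6), none, 1), ((some 1, 7), none, 0),
      ((some 1, 7), none, 1), ((some 1, 8), none, 0), ((some 1, 8), none, 1)])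
    (append (pathExpr 0) (pathExpr 1)))

/-- The counterpart of `code`. -/
def codeExpr : StrExpr :=
  append (append (append (lits (List.replicate 5 (some (some true))))
    (positions 1 (ifLe (append (rep 1 none) unit) param
      (lits [some (some true), some (some true), some (some false), some (some false)])
      (lits [some (some false), some (some false), some (some false), some (some false)]))))
    (lits [some none]))
    (append (edgesExpr [((none, 0), none, 1), ((none, 2), none, 3), ((none, 4), none, 0),
      ((none, 4), none, 1), ((none, 4), none, 2), ((none, 4), none, 3)])
      (positions 1 (divMod nodeExpr)))

theorem value_pathExpr {p i : ℕ} (h₁ : env 1 = p) (h₃ : env 3 = p % (n + 1)) (hp : n < p)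
    (hpx : p < x.length) : (pathExpr i).value x n env =
      ((pathEdges n (bits x n) p i).flatMap edgeCode).map some := by
  subst h₁
  -- The position is positive, so truncation is harmless; this explains the constant 1 in `pathExpr`
  -- for vertices of the preceding position.
  have e : 4 * (env 1 - 1) + 5 = 4 * env 1 + 1 := by omega
  simp only [pathExpr, value_append, value_edgesExpr, value_ifSym_isOne hpx, value_ifLe,
    value_ifEq, value_rep, value_nil, length_param, List.length_replicate, List.length_nil,
    Nat.le_zero, h₃, pathEdges, bits, hp, true_and, decide_eq_true_eq, node, List.flatMap_append,
    List.map_append, List.map_cons, List.map_nil, vertexVal, Option.elim_some, Option.elim_none,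
    zero_add, add_assoc]
  rw [← add_assoc (4 * (env 1 - 1)) 5, e]
  simp only [add_assoc]
  congr 1
  · congr 1
    · congr 1
      split_ifs <;> rfl
    · split_ifs <;> rfl
  · split_ifs <;> rfl

theorem value_nodeExpr {p : ℕ} (h₁ : env 1 = p) (h₃ : env 3 = p % (n + 1)) (hpx : p < x.length) :
    nodeExpr.value x n env = ((nodeEdges n (bits x n) p).flatMap edgeCode).map some := by
  rw [nodeExpr, value_ifLe, value_ifEq, nodeEdges]
  simp only [value_append, value_rep, value_unit, length_param, List.length_replicate,
    List.length_append, List.length_singleton, Nat.succ_le_iff, h₁]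
  split_ifs with h h'
  · subst h₁
    simp only [value_edgesExpr, List.map_cons, List.map_nil, vertexVal, Option.elim_some,
      Option.elim_none, zero_add, node, add_assoc, Nat.reduceAdd, add_zero]
  · subst h₁
    simp only [value_edgesExpr, List.map_cons, List.map_nil, vertexVal, Option.elim_some,
      Option.elim_none, zero_add, node, add_assoc, Nat.reduceAdd, add_zero]
  · rw [value_pathExpr h₁ h₃ (by omega) hpx, value_pathExpr h₁ h₃ (by omega) hpx,
      List.flatMap_append, List.map_append]

theorem value_codeExpr : codeExpr.value x n env = (code n x.length (bits x n)).map some := by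
  have h : ∀ p < x.length, (divMod nodeExpr).value x n (update env 1 p) =
      ((nodeEdges n (bits x n) p).flatMap edgeCode).map some := by
    intro p hp
    rw [value_divMod _ (by rw [update_self]; omega)]
    exact value_nodeExpr (by simp) (by simp) hp
  rw [codeExpr, code, specialCode, edgeList]
  simp only [value_append, value_lits, value_positions, value_edgesExpr, List.map_append,
    List.flatMap_append]
  congr 1
  · congr 2
    rw [List.map_flatMap]
    refine List.flatMap_congr fun p _ => ?_
    simp only [value_ifLe, value_append, value_rep, value_unit, length_param, List.length_append,
      List.length_replicate, List.length_singleton, update_self, Nat.succ_le_iff, value_lits]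
    split_ifs with h <;> simp [h]
  · congr 1
    rw [List.flatMap_assoc, List.map_flatMap]
    exact List.flatMap_congr fun p hp => h p (List.mem_range.1 hp)

theorem scoped_codeExpr : codeExpr.Scoped [0] := by
  simp [codeExpr, Scoped, positions, divMod, nodeExpr, pathExpr, param, marks, blocks, ifEq,
    unit, scoped_edgesExpr]

open Classical in
/-- The transformation from Set Splitting to Stable Cutset. -/
noncomputable def stableCutsetInstance (p : List Symb × ℕ) : List Symb × ℕ :=
  (if Valid p.1 p.2 p.2 then code p.2 p.1.length (bits p.1 p.2) else [], 2 * p.2 + 5)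

theorem isPolyTime_stableCutsetInstance : IsPolyTime stableCutsetInstance := by
  -- Variable `0` is bound to `n`, the position of the header's separator. The new parameter is
  -- written as two marks for each old one, and five more.
  refine LoopExpr.isPolyTime (append (loop 0 (ifEq (rep 0 none) param (guardValid codeExpr) nil))
    (append (marks (lits [none, none])) (lits (List.replicate 5 none)))) ?_ _ ?_
  · simp [Scoped, ifEq, param, marks, unit, scoped_guardValid, scoped_codeExpr]
  · rintro ⟨x, n⟩
    symm
    generalize (fun _ : Fin 10 => (encodeParamInstance (x, n)).length) = env
    change LoopExpr.value x n _ env = _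
    classical
    simp only [value_append, value_loop, value_ifEq, value_rep, length_param,
      List.length_replicate, update_self, value_guardValid, value_codeExpr, value_nil, value_lits,
      encodeParamInstance, stableCutsetInstance]
    rw [value_marks _ fun _ => rfl, value_lits, two_mul, List.replicate_add]
    congr 1
    · by_cases hx : 0 < x.length
      · rw [List.flatMap_range_ite_iff (k := n) (by omega) fun _ h => h]
        simp only [if_true]
        split_ifs <;> rfl
      -- On the empty string the positions end before `n`, so the loop yields nothing; this agrees
      -- with the definition because the empty string is not valid.
      · rw [if_neg fun h => by have := h.1; omega]
        simp only [List.map_nil, List.flatMap_eq_nil_iff, List.mem_range]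
        intro i hi
        rw [if_neg (by omega)]
    · congr 1
      rw [List.eq_replicate_iff]
      constructor
      · simp [List.length_flatMap, mul_two]
      · simp

theorem isPPT_stableCutsetInstance :
    IsPPT SetSplittingN StableCutsetModLinForest stableCutsetInstance where
  polyTime := isPolyTime_stableCutsetInstance
  correct := by
    rintro ⟨x, n⟩
    rw [mem_setSplittingN_iff, stableCutsetInstance]
    split_ifs with h
    · have hn : n ≤ x.length := h.1.le
      rw [code_mem_iff hn fun p => bits_lt h]
      exact and_iff_right h
    · exact iff_of_false (fun h' => h h'.1) nil_notMem
  param_le := ⟨2 * .X + 5, fun x k => by simp [stableCutsetInstance]⟩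

end Gadget

/-! ### The transformation from Hitting Set to Set Splitting -/

theorem List.flatMap_range_getElem? {α β : Type} (l : List α) (d : ℕ) (g : α → List β) :
    ((List.range l.length).flatMap fun p => if p < d then [] else l[p]?.elim [] g) =
      (l.drop d).flatMap g := by
  induction l generalizing d with
  | nil => simp
  | cons a l ih =>
    rw [List.length_cons, List.range_succ_eq_map, List.flatMap_cons, List.flatMap_map]
    cases d with
    | zero =>
      have := ih 0
      simp only [Nat.not_lt_zero, if_false, List.drop_zero] at this
      simp [this]
    | succ d => simp [← ih d]

namespace HittingSetSplitting

open LoopExpr Function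

/-- The two additional elements `n * n` and `n * n + 1`. -/
def base (n y : ℕ) : Bool := decide (n * n ≤ y)

/-- The set for a set of the family: all elements `i * n + j` with `i` in the set, and `n * n`. -/
def member (n : ℕ) (b : ℕ → Bool) (y : ℕ) : Bool := if y < n * n then b (y / n) else decide (y = n * n)

/-- The set of the elements `i * n + j`, `i' * n + j` and `n * n + 1`. -/
def conflict (n j i i' y : ℕ) : Bool :=
  if y < n * n then decide (y % n = j ∧ (y / n = i ∨ y / n = i')) else decide (y = n * n + 1)

def conflicts (n k : ℕ) : List (ℕ → Bool) :=
  (List.range n).flatMap fun j => (List.range n).flatMap fun i => (List.range n).flatMap fun i' =>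
    if i = i' then if k ≤ j then [conflict n j i i'] else [] else [conflict n j i i']

def sets (n k : ℕ) (L : List (ℕ → Bool)) : List (ℕ → Bool) :=
  [base n] ++ L.map (member n) ++ conflicts n k

theorem mem_conflicts {n k : ℕ} {b : ℕ → Bool} : b ∈ conflicts n k ↔
    ∃ j < n, ∃ i < n, ∃ i' < n, (i = i' → k ≤ j) ∧ b = conflict n j i i' := by
  simp only [conflicts, List.mem_flatMap, List.mem_range]
  refine exists_congr fun j => and_congr_right fun _ => exists_congr fun i =>
    and_congr_right fun _ => exists_congr fun i' => and_congr_right fun _ => ?_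
  split_ifs with h h' <;> simp [*]

/-! ### Hitting sets and splittings of the grid -/

theorem mul_add_lt {n i j : ℕ} (hi : i < n) (hj : j < n) : i * n + j < n * n := by
  have : (i + 1) * n ≤ n * n := Nat.mul_le_mul_right _ hi
  rw [Nat.succ_mul] at this
  omega

theorem mul_add_div {n i j : ℕ} (hj : j < n) : (i * n + j) / n = i := by
  rw [add_comm, Nat.add_mul_div_right _ _ (by omega), Nat.div_eq_of_lt hj, zero_add]

theorem mul_add_mod {n i j : ℕ} (hj : j < n) : (i * n + j) % n = j := by
  rw [add_comm, Nat.add_mul_mod_self_right, Nat.mod_eq_of_lt hj]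

/-- Call `i * n + j` chosen if it is on the side of `n * n + 1`. The hitting set consists of the `i`
with a chosen pair; mapping each `i` to such a slot `j` is injective with values below `k`, by the
conflict sets with `i ≠ i'` and `i = i'` respectively. -/
theorem exists_hitting_of_split {n k : ℕ} {L : List (ℕ → Bool)} {T : ℕ → Prop}
    (hT : ∀ b ∈ sets n k L, (∃ y < n * n + 2, b y = true ∧ T y) ∧
      ∃ y < n * n + 2, b y = true ∧ ¬ T y) :
    ∃ S : Finset (Fin n), S.card ≤ k ∧ ∀ b ∈ L, ∃ i ∈ S, b i = true := by
  classical
  have h0 : T (n * n) ↔ ¬ T (n * n + 1) := by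
    obtain ⟨⟨y, hy, hby, hTy⟩, z, hz, hbz, hTz⟩ := hT (base n) (by simp [sets])
    have hby := of_decide_eq_true hby
    have hbz := of_decide_eq_true hbz
    obtain rfl | rfl : y = n * n ∨ y = n * n + 1 := by omega
    · obtain rfl | rfl : z = n * n ∨ z = n * n + 1 := by omega
      · exact absurd hTy hTz
      · exact iff_of_true hTy hTz
    · obtain rfl | rfl : z = n * n ∨ z = n * n + 1 := by omega
      · exact iff_of_false hTz (not_not.2 hTy)
      · exact absurd hTy hTz
  have hc : ∀ j < n, ∀ i < n, ∀ i' < n, (i = i' → k ≤ j) →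
      ¬ ((T (i * n + j) ↔ T (n * n + 1)) ∧ (T (i' * n + j) ↔ T (n * n + 1))) := by
    rintro j hj i hi i' hi' hk ⟨h₁, h₂⟩
    obtain ⟨⟨y, hy, hby, hTy⟩, z, hz, hbz, hTz⟩ := hT (conflict n j i i')
      (by simp only [sets, List.mem_append, mem_conflicts]
          exact .inr ⟨j, hj, i, hi, i', hi', hk, rfl⟩)
    have key : ∀ y, conflict n j i i' y = true → (T y ↔ T (n * n + 1)) := by
      intro y hy
      rw [conflict] at hy
      split_ifs at hy with h
      · obtain ⟨hj, hi⟩ := of_decide_eq_true hy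
        have := Nat.div_add_mod' y n
        rcases hi with hi | hi
        · rw [hj, hi] at this
          rwa [← this]
        · rw [hj, hi] at this
          rwa [← this]
      · rw [of_decide_eq_true hy]
    exact hTz ((key z hbz).2 ((key y hby).1 hTy))
  refine ⟨Finset.univ.filter fun i : Fin n => ∃ j < n, T (i * n + j) ↔ T (n * n + 1), ?_, ?_⟩
  · have hj : ∀ i : Fin n, (∃ j < n, T (i * n + j) ↔ T (n * n + 1)) →
        ∃ j < n, T (i * n + j) ↔ T (n * n + 1) := fun _ h => h
    choose! f hf hfT using hj
    have := Finset.card_le_card_of_injOn (t := Finset.range k) f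
      (s := Finset.univ.filter fun i : Fin n => ∃ j < n, T (i * n + j) ↔ T (n * n + 1)) ?_ ?_
    · simpa using this
    · intro i hi
      have hi := (Finset.mem_filter.1 hi).2
      by_contra hk
      rw [Finset.mem_coe, Finset.mem_range, not_lt] at hk
      exact hc _ (hf i hi) i i.2 i i.2 (fun _ => hk) ⟨hfT i hi, hfT i hi⟩
    · intro i hi i' hi' hii'
      have hi := (Finset.mem_filter.1 hi).2
      have hi' := (Finset.mem_filter.1 hi').2
      by_contra hne
      exact hc _ (hf i hi) i i.2 i' i'.2 (fun h => absurd (Fin.ext h) hne)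
        ⟨hfT i hi, hii' ▸ hfT i' hi'⟩
  · intro b hb
    obtain ⟨⟨y, hy, hby, hTy⟩, z, hz, hbz, hTz⟩ := hT (member n b)
      (by simp only [sets, List.mem_append, List.mem_map]; exact .inl (.inr ⟨b, hb, rfl⟩))
    -- One of the two witnesses of splitting is on the side of `n * n + 1`. It is not `n * n`, so it
    -- is a chosen pair.
    have key : ∀ y, member n b y = true → (T y ↔ T (n * n + 1)) →
        ∃ i : Fin n, i ∈ Finset.univ.filter (fun i : Fin n =>
          ∃ j < n, T (i * n + j) ↔ T (n * n + 1)) ∧ b i = true := by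
      intro y hby hy
      rw [member] at hby
      split_ifs at hby with h
      · have hn : 0 < n := Nat.pos_of_ne_zero (by rintro rfl; simp at h)
        refine ⟨⟨y / n, Nat.div_lt_of_lt_mul h⟩, ?_, hby⟩
        rw [Finset.mem_filter]
        exact ⟨Finset.mem_univ _, y % n, Nat.mod_lt _ hn, by rwa [Nat.div_add_mod' y n]⟩
      · rw [of_decide_eq_true hby] at hy
        tauto
    by_cases hw : T (n * n + 1)
    · exact key y hby (iff_of_true hTy hw)
    · exact key z hbz (iff_of_false hTz hw)

/-- Number the elements of `S` and put each into the slot with its number; one side consists of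
these pairs and `n * n + 1`. The numbers are distinct, below `k`, and below `n`, so that they are
slots. -/
theorem exists_split_of_hitting {n k : ℕ} {L : List (ℕ → Bool)} {S : Finset (Fin n)}
    (hk : S.card ≤ k) (hS : ∀ b ∈ L, ∃ i ∈ S, b i = true) :
    ∃ T : ℕ → Prop, ∀ b ∈ sets n k L, (∃ y < n * n + 2, b y = true ∧ T y) ∧
      ∃ y < n * n + 2, b y = true ∧ ¬ T y := by
  set f : S → ℕ := fun i => S.equivFin i
  have hf : ∀ i, f i < S.card := fun i => (S.equivFin i).2
  have hfi : ∀ i i', f i = f i' → i = i' := fun i i' h => S.equivFin.injective (Fin.ext h)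
  have hSn : S.card ≤ n := by simpa using S.card_le_univ
  set T : ℕ → Prop := fun y => (y < n * n ∧ ∃ i : S, y = i.1 * n + f i) ∨ y = n * n + 1
  have hTn : ¬ T (n * n) := by simp [T]
  have hTw : T (n * n + 1) := .inr rfl
  refine ⟨T, fun b hb => ?_⟩
  simp only [sets, List.mem_append, List.mem_singleton, List.mem_map, mem_conflicts] at hb
  rcases hb with (rfl | ⟨b, hb, rfl⟩) | ⟨j, hj, i, hi, i', hi', hii', rfl⟩
  · exact ⟨⟨n * n + 1, by omega, by simp [base], hTw⟩, n * n, by omega, by simp [base], hTn⟩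
  · refine ⟨?_, n * n, by omega, by simp [member], hTn⟩
    obtain ⟨i, hi, hbi⟩ := hS b hb
    have hfn : f ⟨i, hi⟩ < n := (hf _).trans_le hSn
    have hlt := mul_add_lt i.2 hfn
    exact ⟨i * n + f ⟨i, hi⟩, by omega, by simp [member, hlt, mul_add_div hfn, hbi],
      .inl ⟨hlt, ⟨i, hi⟩, rfl⟩⟩
  · refine ⟨⟨n * n + 1, by omega, by simp [conflict], hTw⟩, ?_⟩
    have hT : ∀ i < n, T (i * n + j) → ∃ x : S, x.1.1 = i ∧ f x = j := by
      rintro i hi (⟨-, x, hx⟩ | h)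
      · have hfn : f x < n := (hf x).trans_le hSn
        have h₁ := congrArg (· / n) hx
        have h₂ := congrArg (· % n) hx
        simp only [mul_add_div hj, mul_add_div hfn, mul_add_mod hj, mul_add_mod hfn] at h₁ h₂
        exact ⟨x, h₁.symm, h₂.symm⟩
      · have := mul_add_lt hi hj
        omega
    have hb : ∀ l, l < n → l = i ∨ l = i' → conflict n j i i' (l * n + j) = true := by
      intro l hl h
      simp [conflict, mul_add_lt hl hj, mul_add_div hj, mul_add_mod hj, h]
    -- If the whole conflict set were on one side, `i` and `i'` would have the same number `j`,
    -- hence be equal; then `k ≤ j`, while numbers are below `k`.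
    by_contra! hno
    obtain ⟨x, hx, hxj⟩ := hT i hi (hno _ ((mul_add_lt hi hj).trans (by omega)) (hb i hi (.inl rfl)))
    obtain ⟨x', hx', hxj'⟩ :=
      hT i' hi' (hno _ ((mul_add_lt hi' hj).trans (by omega)) (hb i' hi' (.inr rfl)))
    have hxx' := hfi x x' (hxj.trans hxj'.symm)
    have := hii' (by rw [← hx, ← hx', hxx'])
    have := hf x
    omega

/-! #### The strings -/

theorem bitsCode_square (n : ℕ) (b : ℕ → Bool) : bitsCode (n * n + 2) b =
    ((List.range n).flatMap fun i => (List.range n).map fun j => some (b (i * n + j))) ++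
      [some (b (n * n)), some (b (n * n + 1)), none] := by
  rw [bitsCode, List.range_succ, List.range_succ, List.map_append, List.map_append,
    List.range_mul_map]
  simp

/-- The translation of the codes of the sets of the family. -/
def translate (n : ℕ) : Symb → List Symb
  | none => [some true, some false, none]
  | some b => List.replicate n (some b)

/-- The bit of `i` is repeated over the row `i * n`, …, `i * n + n - 1`; the separator expands to
the bits of the two reference elements and a separator. Hence the family is translated symbol by
symbol. -/
theorem flatMap_translate (n : ℕ) (b : ℕ → Bool) :
    (bitsCode n b).flatMap (translate n) = bitsCode (n * n + 2) (member n b) := by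
  rw [bitsCode_square, bitsCode, List.flatMap_append, List.flatMap_map]
  congr 1
  · refine List.flatMap_congr fun i hi => ?_
    refine (List.eq_replicate_iff.2 ⟨by simp, fun a ha => ?_⟩).symm
    obtain ⟨j, hj, rfl⟩ := List.mem_map.1 ha
    have hi := List.mem_range.1 hi
    have hj := List.mem_range.1 hj
    rw [member, if_pos (mul_add_lt hi hj), mul_add_div hj]
  · simp [translate, member]

def code (x : List Symb) (n s : ℕ) : List Symb :=
  unaryCode (n * n + 2) ++ bitsCode (n * n + 2) (base n) ++ (x.drop (s + 1)).flatMap (translate n) ++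
    (conflicts n (s - n - 1)).flatMap (bitsCode (n * n + 2))

theorem code_eq {n k : ℕ} {L : List (ℕ → Bool)} :
    code (header n (n + 1 + k) ++ L.flatMap (bitsCode n)) n (n + 1 + k) =
      unaryCode (n * n + 2) ++ (sets n k L).flatMap (bitsCode (n * n + 2)) := by
  have h : (header n (n + 1 + k)).length = n + 1 + k + 1 := by simp [header]
  rw [code, List.drop_left' h, List.flatMap_assoc]
  simp only [flatMap_translate, sets, List.flatMap_append, List.flatMap_map, List.append_assoc,
    show n + 1 + k - n - 1 = k by omega]
  simp

/-- A code determines a characteristic function only below `n`, so only properties depending on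
these values transfer. -/
theorem forall_mem_of_flatMap_bitsCode_eq {n : ℕ} {L L' : List (ℕ → Bool)}
    (h : L.flatMap (bitsCode n) = L'.flatMap (bitsCode n)) {R : (ℕ → Bool) → Prop}
    (hR : ∀ b b', (∀ i < n, b i = b' i) → R b → R b') (hL : ∀ b ∈ L, R b) : ∀ b ∈ L', R b := by
  induction L' generalizing L with
  | nil => simp
  | cons b' L' ih =>
    cases L with
    | nil => simp [bitsCode] at h
    | cons b L =>
      have := Gadget.append_none_inj (a := (List.range n).map b) (b := (List.range n).map b')
        (r := L.flatMap (bitsCode n)) (t := L'.flatMap (bitsCode n))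
        (by simpa [bitsCode, Function.comp_def] using h)
      rw [List.forall_mem_cons] at hL ⊢
      refine ⟨hR b b' (fun i hi => ?_) hL.1, ih this.2 hL.2⟩
      exact List.map_inj_left.1 this.1 i (List.mem_range.2 hi)

theorem mem_setSplittingN_of_bitsCode {n : ℕ} {L : List (ℕ → Bool)} :
    (unaryCode n ++ L.flatMap (bitsCode n), n) ∈ SetSplittingN ↔
      ∃ T : ℕ → Prop, ∀ b ∈ L, (∃ i < n, b i = true ∧ T i) ∧ ∃ i < n, b i = true ∧ ¬ T i := by
  rw [mem_setSplittingN]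
  constructor
  · rintro ⟨L', h, T, hT⟩
    refine ⟨T, forall_mem_of_flatMap_bitsCode_eq (List.append_cancel_left h).symm ?_ hT⟩
    rintro b b' hb ⟨⟨i, hi, h⟩, j, hj, h'⟩
    exact ⟨⟨i, hi, hb i hi ▸ h⟩, j, hj, hb j hj ▸ h'⟩
  · rintro ⟨T, hT⟩
    exact ⟨L, rfl, T, hT⟩

/-- With `s < s'`, position `s` would have to be a separator for `s` and a 1 for `s'`. So the bound
`k` can be read off the string. -/
theorem valid_unique {x : List Symb} {n s s' : ℕ} (h : Valid x n s) (h' : Valid x n s')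
    (hs : n < s) (hs' : n < s') : s = s' := by
  wlog hlt : s < s' generalizing s s'
  · rcases lt_trichotomy s s' with h₁ | h₁ | h₁
    exacts [absurd h₁ hlt, h₁, (this h' h hs' hs h₁).symm]
  have h₁ := h.2.2.2 s h.1
  have h₂ := h'.2.2.2 s h.1
  rw [ValidAt, if_neg (by omega), if_neg (by omega)] at h₁
  rw [ValidAt, if_neg (by omega), if_pos hlt] at h₂
  have := h₁.2 ⟨0, by simp⟩
  simp [this] at h₂

open Classical in
/-- The transformation from Hitting Set to Set Splitting. -/
noncomputable def instanceMap (p : List Symb × ℕ) : List Symb × ℕ :=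
  ((List.range (p.1.length + p.2)).flatMap fun s =>
    if p.2 < s then if Valid p.1 p.2 s then code p.1 p.2 s else [] else [], p.2 * p.2 + 2)

theorem instanceMap_of_valid {x : List Symb} {n s : ℕ} (h : Valid x n s) (hs : n < s) :
    instanceMap (x, n) = (code x n s, n * n + 2) := by
  classical
  simp only [instanceMap, ← ite_and]
  rw [List.flatMap_range_ite_iff (k := s) (by have := h.1; omega)
    fun i hi => valid_unique hi.2 h hi.1 hs, if_pos ⟨hs, h⟩]

theorem instanceMap_mem_iff (p : List Symb × ℕ) : p ∈ HittingSetN ↔ instanceMap p ∈ SetSplittingN := by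
  obtain ⟨x, n⟩ := p
  have key : ∀ (k : ℕ) (L : List (ℕ → Bool)), x = header n (n + 1 + k) ++ L.flatMap (bitsCode n) →
      (instanceMap (x, n) ∈ SetSplittingN ↔
        ∃ S : Finset (Fin n), S.card ≤ k ∧ ∀ b ∈ L, ∃ i ∈ S, b i = true) := by
    rintro k L hx
    rw [instanceMap_of_valid ((valid_iff (by omega)).2 ⟨L, hx⟩) (by omega), hx, code_eq,
      mem_setSplittingN_of_bitsCode]
    exact ⟨fun ⟨T, hT⟩ => exists_hitting_of_split hT,
      fun ⟨S, hk, hS⟩ => exists_split_of_hitting hk hS⟩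
  constructor
  · intro h
    obtain ⟨k, L, hx, hS⟩ := mem_hittingSetN.1 h
    exact (key k L (by rw [hx, header_add])).2 hS
  · intro h
    by_cases hv : ∃ s, n < s ∧ Valid x n s
    · obtain ⟨s, hs, hv⟩ := hv
      obtain ⟨k, rfl⟩ := Nat.exists_eq_add_of_le (Nat.succ_le_of_lt hs)
      obtain ⟨L, hx⟩ := (valid_iff hs.le).1 hv
      exact mem_hittingSetN.2 ⟨k, L, by rw [hx, ← header_add], (key k L hx).1 h⟩
    -- Malformed inputs go to the empty string, which is no instance since a unary code is never
    -- empty.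
    · have h0 : instanceMap (x, n) = ([], n * n + 2) := by
        simp only [instanceMap, Prod.mk.injEq, List.flatMap_eq_nil_iff, and_true]
        intro s _
        split_ifs with h₁ h₂
        exacts [absurd ⟨s, h₁, h₂⟩ hv, rfl, rfl]
      rw [h0, mem_setSplittingN] at h
      obtain ⟨L, h, -⟩ := h
      simp [unaryCode] at h

/-! #### The program -/

def pairsExpr (e : StrExpr) : StrExpr := numbers 4 (numbers 5 e)

def bitExpr (b : Bool) : StrExpr := emit (some (some b))

/-- The code of a set `conflict n j i i'`, where the numbers are the values of the variables `1`,
`2` and `3`. -/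
def conflictExpr : StrExpr :=
  append (pairsExpr (ifEq (rep 5 none) (rep 1 none) (ifEq (rep 4 none) (rep 2 none) (bitExpr true)
    (ifEq (rep 4 none) (rep 3 none) (bitExpr true) (bitExpr false))) (bitExpr false)))
    (lits [some (some false), some (some true), some none])

/-- The counterpart of `code`. -/
def codeExpr : StrExpr :=
  append (append (append
    (append (pairsExpr (bitExpr true)) (lits [some (some true), some (some true), some none]))
    (append (pairsExpr (bitExpr false)) (lits [some (some true), some (some true), some none])))
    (positions 1 (ifLe (rep 1 none) (rep 0 none) nil
      (ifSym 1 isSep (lits [some (some true), some (some false), some none])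
        (ifSym 1 isOne (marks (bitExpr true)) (marks (bitExpr false)))))))
    (numbers 1 (numbers 2 (numbers 3 (ifEq (rep 2 none) (rep 3 none)
      (ifLe (rep 0 none) (append (rep 1 none) (append param unit)) conflictExpr nil)
      conflictExpr))))

variable {x : List Symb} {n : ℕ} {env : Fin 10 → ℕ}

theorem value_bitExpr (b : Bool) : (bitExpr b).value x n env = [some (some b)] := rfl

theorem value_pairsExpr {e : StrExpr} {b : ℕ → Bool} (he : ∀ i < n, ∀ j < n,
    e.value x n (update (update env 4 i) 5 j) = [some (some (b (i * n + j)))]) :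
    (pairsExpr e).value x n env ++ [some (some (b (n * n))), some (some (b (n * n + 1))), some none] =
      (bitsCode (n * n + 2) b).map some := by
  rw [bitsCode_square, List.map_append, pairsExpr, value_numbers, List.map_flatMap]
  congr 1
  refine List.flatMap_congr fun i hi => ?_
  rw [value_numbers, List.map_map, List.map_eq_flatMap]
  exact List.flatMap_congr fun j hj => he i (List.mem_range.1 hi) j (List.mem_range.1 hj)

theorem value_conflictExpr {j i i' : ℕ} (h₁ : env 1 = j) (h₂ : env 2 = i) (h₃ : env 3 = i') :
    conflictExpr.value x n env = (bitsCode (n * n + 2) (conflict n j i i')).map some := by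
  rw [← value_pairsExpr (e := ifEq (rep 5 none) (rep 1 none) (ifEq (rep 4 none) (rep 2 none)
    (bitExpr true) (ifEq (rep 4 none) (rep 3 none) (bitExpr true) (bitExpr false)))
    (bitExpr false)) (x := x) (env := env)]
  · simp [conflictExpr, value_append, value_lits, conflict]
  · intro k hk l hl
    simp only [value_ifEq, value_rep, List.length_replicate, value_bitExpr, update_self, ne_eq,
      Fin.isValue, Fin.reduceEq, not_false_eq_true, update_of_ne, h₁, h₂, h₃, conflict,
      mul_add_lt hk hl, if_true, mul_add_div hl, mul_add_mod hl]
    split_ifs <;> simp_all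

theorem value_codeExpr {s : ℕ} (h₀ : env 0 = s) (hs : n < s) :
    codeExpr.value x n env = (code x n s).map some := by
  subst h₀
  rw [codeExpr, code, value_append, value_append, value_append, List.map_append, List.map_append,
    List.map_append]
  congr 1
  · congr 1
    · congr 1
      · rw [unaryCode_eq_bitsCode, ← value_pairsExpr (e := bitExpr true) (x := x) (env := env)]
        · simp [value_append, value_lits]
        · intros; rfl
      · rw [← value_pairsExpr (e := bitExpr false) (x := x) (env := env)]
        · simp [value_append, value_lits, base]
        · intro i hi j hj
          simp [value_bitExpr, base, mul_add_lt hi hj]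
    · rw [value_positions]
      have h : ∀ p < x.length, (ifLe (rep 1 none) (rep 0 none) nil
          (ifSym 1 isSep (lits [some (some true), some (some false), some none])
            (ifSym 1 isOne (marks (bitExpr true)) (marks (bitExpr false)))) : StrExpr).value x n
            (update env 1 p) =
          if p ≤ env 0 then [] else (x[p]?.elim [] (translate n)).map some := by
        intro p hp
        have h1 : update env 1 p 1 < x.length := by simpa using hp
        have hm : ∀ b env, (marks (bitExpr b)).value x n env =
            List.replicate n (some (some b)) := by
          intro b env
          rw [value_marks _ fun _ => rfl, List.eq_replicate_iff]
          simp [value_bitExpr, List.length_flatMap]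
        rw [value_ifLe, value_ifSym_isSep h1, value_ifSym_isOne h1]
        simp only [value_rep, List.length_replicate, update_self, value_nil, value_lits, hm,
          ne_eq, Fin.isValue, Fin.reduceEq, not_false_eq_true, update_of_ne]
        rw [List.getElem?_eq_getElem hp]
        rcases x[p] with _ | _ | _ <;> simp [translate]
      rw [List.flatMap_congr fun p hp => h p (List.mem_range.1 hp)]
      rw [← List.flatMap_range_getElem? x (env 0 + 1), List.map_flatMap]
      refine List.flatMap_congr fun p _ => ?_
      simp only [Nat.lt_succ_iff]
      split_ifs <;> rfl
  · rw [value_numbers, conflicts, List.flatMap_assoc, List.map_flatMap]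
    refine List.flatMap_congr fun j hj => ?_
    rw [value_numbers, List.flatMap_assoc, List.map_flatMap]
    refine List.flatMap_congr fun i hi => ?_
    rw [value_numbers, List.flatMap_assoc, List.map_flatMap]
    refine List.flatMap_congr fun i' hi' => ?_
    rw [value_ifEq, value_ifLe, value_conflictExpr (j := j) (i := i) (i' := i') (by simp) (by simp)
      (by simp)]
    simp only [value_rep, List.length_replicate, value_append, length_param, value_unit,
      List.length_append, List.length_singleton, update_self, value_nil,
      ne_eq, Fin.isValue, Fin.reduceEq, not_false_eq_true, update_of_ne]
    -- With the last header separator at `n + 1 + k`, comparing it with `j + n + 1` decides `k ≤ j`.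
    have : env 0 ≤ j + (n + 1) ↔ env 0 - n - 1 ≤ j := by omega
    simp only [this]
    split_ifs <;> simp

theorem scoped_codeExpr : codeExpr.Scoped [0] := by
  simp [codeExpr, Scoped, positions, pairsExpr, numbers, bitExpr, conflictExpr, param, marks, ifEq,
    unit]

theorem isPolyTime_instanceMap : IsPolyTime instanceMap := by
  -- Variable `0` tries all positions after `n` as last separator of the header; at most one passes
  -- the check. A double loop and two more marks write the parameter.
  refine LoopExpr.isPolyTime (append (loop 0 (ifLe (append param unit) (rep 0 none)
    (guardValid codeExpr) nil)) (append (numbers 1 (numbers 2 unit)) (lits [none, none]))) ?_ _ ?_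
  · simp [Scoped, numbers, param, marks, unit, scoped_guardValid, scoped_codeExpr]
  · rintro ⟨x, n⟩
    symm
    generalize (fun _ : Fin 10 => (encodeParamInstance (x, n)).length) = env
    change LoopExpr.value x n _ env = _
    classical
    rw [value_append, value_append, encodeParamInstance, instanceMap]
    congr 1
    · rw [value_loop, List.map_flatMap]
      refine List.flatMap_congr fun s _ => ?_
      rw [value_ifLe, value_guardValid]
      simp only [value_append, value_rep, value_unit, length_param, List.length_append,
        List.length_replicate, List.length_singleton, update_self, Nat.succ_le_iff, value_nil]
      split_ifs with h₁ h₂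
      · exact value_codeExpr (by simp) h₁
      · rfl
      · rfl
    · rw [List.eq_replicate_iff]
      simp only [value_numbers, value_unit, value_lits]
      exact ⟨by simp [List.length_flatMap], by simp +contextual [or_imp]⟩

theorem isPPT_instanceMap : IsPPT HittingSetN SetSplittingN instanceMap where
  polyTime := isPolyTime_instanceMap
  correct := instanceMap_mem_iff
  param_le := ⟨.X * .X + 2, fun x k => by simp [instanceMap]⟩

end HittingSetSplitting

theorem mainTheorem1 :
    IsMK2Hard StableCutsetModLinForest ∧
      ∃ f : List Symb × ℕ → List Symb × ℕ,
        IsPPT SetSplittingN StableCutsetModLinForest f ∧ ∀ x n, (f (x, n)).2 = 2 * n + 5 :=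
  ⟨fun _ _ _ h => (h.trans ⟨_, HittingSetSplitting.isPPT_instanceMap⟩).trans
    ⟨_, Gadget.isPPT_stableCutsetInstance⟩, _, Gadget.isPPT_stableCutsetInstance, fun _ _ => rfl⟩
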